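/- **Setting.** Functions on $\mathbb R^3$ are real- or complex-valued; a radial function is written $f(x)=f(r)$, $r=|x|$. Let $\Phi_0(t)(f,g)=\cos(t\sqrt{-\Delta})f+\frac{\sin(t\sqrt{-\Delta})}{\sqrt{-\Delta}}g$ be the solution at time $t$ of the linear wave equation on $\mathbb R^3$ with initial data $(f,g)$ (in the sense of distributions). For radial data let $$P_{\pm}(u_0,u_1)=\Big(\tfrac12\big(u_0\mp\tfrac1r\int_0^r\rho\,u_1(\rho)\,d\rho\big),\ \tfrac12\big(\mp (u_0)_r\mp\tfrac{u_0}{r}+u_1\big)\Big),$$ and call radial data $(u_0,u_1)$, with $u_0$ a function and $u_1$ a distribution, *outgoing* if $P_-(u_0,u_1)=0$ in the sense of distributions. For $N>2$ consider the equation $$u(t)=\Phi_0(t)(u_0,u_1)+\int_0^t\Phi_0(t-s)\,P_+\big(0,|u(s)|^Nu(s)\big)\,ds.\qquad(*)$$ Let $\langle x\rangle=(1+|x|^2)^{1/2}$, and let $\dot H^1$ be the space of $f\in L^6(\mathbb R^3)$ with $\nabla f\in L^2$, with norm $\|\nabla f\|_{L^2}$. For $R>0$ let $\mathcal D_R$ be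 the set of radial outgoing $(u_0,u_1)$ with $u_0\in L^{N+2}(\mathbb R^3)$ and $\operatorname{supp}u_0\subset\overline{\mathbb R^3\setminus B(0,R)}$. **Proposition 5.3.** Let $N>2$ be real. There are constants $c,C,\varepsilon>0$ depending only on $N$, and an assignment of a function $u$ on $\mathbb R^3\times[0,\infty)$ ("the corresponding solution") to each $(u_0,u_1)\in\bigcup_{R>0}\mathcal D_R$, such that for all $R>0$ and all $(u_0,u_1)\in\mathcal D_R$, with corresponding solution $u$, the following hold. 1. *Local existence.* Let $I=[0,T]$ with $T\ge 0$ and $T\,\|u_0\|_{L^{N+2}}^{N}\le c\,R^{\frac{2N-2}{N+2}}$ (for $u_0\neq0$ one may take $T=cR^{\frac{2N-2}{N+2}}\|u_0\|_{L^{N+2}}^{-N}$; for $u_0=0$, any $T$). Then: - $u$ solves $(*)$ on $\mathbb R^3\times I$, and $\|u(t)\|_{L^{N+2}}\le C\|u_0\|_{L^{N+2}}$ for all $t\in I$. - For every $(\tilde u_0,\tilde u_1)\in\mathcal D_R$ with $\|\tilde u_0\|_{L^{N+2}}\le2\|u_0\|_{L^{N+2}}$, the corresponding $\tilde u$ solves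 $(*)$ with data $(\tilde u_0,\tilde u_1)$ on the same $\mathbb R^3\times I$, and $\|\tilde u(t)-u(t)\|_{L^{N+2}}\le C\|\tilde u_0-u_0\|_{L^{N+2}}$ for all $t\in I$. - If $u_0\in\dot H^1\cap L^\infty$, then $u\in L^\infty_t\dot H^1_x(\mathbb R^3\times I)\cap L^\infty_{t,x}(\mathbb R^3\times I)$. - If $u_0\in\langle x\rangle^{-1}L^\infty$, then $u\in\langle x\rangle^{-1}L^\infty_{t,x}(\mathbb R^3\times I)$. 2. *Global existence for small data.* Assume in addition that $N>4$ and $R^{\frac{4-N}{N+2}}\|u_0\|_{L^{N+2}}^{N}\le\varepsilon$. Then: - $u$ solves $(*)$ on $\mathbb R^3\times[0,\infty)$, and $\|u(t)\|_{L^{N+2}}\le C\|u_0\|_{L^{N+2}}$ for all $t\ge0$. - For every $(\tilde u_0,\tilde u_1)\in\mathcal D_R$ with $\|\tilde u_0\|_{L^{N+2}}\le2\|u_0\|_{L^{N+2}}$, the corresponding $\tilde u$ solves $(*)$ with data $(\tilde u_0,\tilde u_1)$ on $\mathbb R^3\times[0,\infty)$, and $\|\tilde u(t)-u(t)\|_{L^{N+2}}\le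 C\|\tilde u_0-u_0\|_{L^{N+2}}$ for all $t\ge0$. - If $u_0\in L^\infty$, then $u\in L^\infty_{t,x}(\mathbb R^3\times[0,\infty))$. - For every $T\ge0$: if $u_0\in\dot H^1\cap L^\infty$, then $u\in L^\infty_t\dot H^1_x(\mathbb R^3\times[0,T])$; if $u_0\in\langle x\rangle^{-1}L^\infty$, then $u\in\langle x\rangle^{-1}L^\infty_{t,x}(\mathbb R^3\times[0,T])$. -/

import Mathlib

open MeasureTheory Set Filter Topology
open scoped Distributions ENNReal

noncomputable section

namespace OutgoingWave

/-- Three dimensional Euclidean space. -/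
abbrev E3 : Type := EuclideanSpace ℝ (Fin 3)

/-- Real test functions `C_c^∞(ℝ³)`. -/
abbrev TestFn : Type := 𝓓((⊤ : TopologicalSpace.Opens E3), ℝ)

/-- Real or complex distributions on `ℝ³`. -/
abbrev Distr (𝕜 : Type*) [RCLike 𝕜] : Type _ := 𝓓'((⊤ : TopologicalSpace.Opens E3), 𝕜)

/-- The radial function on `ℝ³` with profile `f`, i.e. `f(x) = f(r)` for `|x| = r`. -/
def rad {𝕜 : Type*} (f : ℝ → 𝕜) : E3 → 𝕜 := fun x => f ‖x‖

/-- The functional on test functions given by the radial function with profile `f`. -/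
def radFunctional {𝕜 : Type*} [RCLike 𝕜] (f : ℝ → 𝕜) : TestFn → 𝕜 :=
  fun φ => ∫ x : E3, φ x • rad f x

/-! ### The linear wave flow -/

/-- `sin(t√-Δ)/√-Δ φ`, given by Kirchhoff's formula in three dimensions: `t` times the mean of `φ`
over the sphere of radius `|t|` around `x`. -/
def waveSinFun (t : ℝ) (φ : E3 → ℝ) (x : E3) : ℝ :=
  t * ⨍ ω : Metric.sphere (0 : E3) 1, φ (x + t • (ω : E3)) ∂(volume : Measure E3).toSphere

/-- `cos(t√-Δ) φ`, given by Kirchhoff's formula in three dimensions: the time derivative of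
`sin(t√-Δ)/√-Δ φ`, that is the mean over the unit sphere of `φ(x + tω) + t ω·∇φ(x + tω)`. -/
def waveCosFun (t : ℝ) (φ : E3 → ℝ) (x : E3) : ℝ :=
  ⨍ ω : Metric.sphere (0 : E3) 1,
    (φ (x + t • (ω : E3)) + t * fderiv ℝ φ (x + t • (ω : E3)) (ω : E3))
      ∂(volume : Measure E3).toSphere

/-- The normalized surface measure on the sphere of radius `|t|` around the origin. -/
def sphereMeas (t : ℝ) : Measure E3 :=
  (((volume : Measure E3).toSphere univ)⁻¹ • (volume : Measure E3).toSphere).map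
    (fun ω : Metric.sphere (0 : E3) 1 => -(t • (ω : E3)))

instance (t : ℝ) : IsFiniteMeasure (sphereMeas t) := by
  unfold sphereMeas
  infer_instance

lemma integral_sphereMeas (t : ℝ) (g : E3 → ℝ) (hg : Continuous g) :
    ∫ y, g y ∂sphereMeas t
      = ⨍ ω : Metric.sphere (0 : E3) 1, g (-(t • (ω : E3))) ∂(volume : Measure E3).toSphere := by
  unfold sphereMeas average
  rw [integral_map (by fun_prop) hg.aestronglyMeasurable]

lemma hasCompactSupport_of_sphere {h φ : E3 → ℝ} (t : ℝ) (hφ : HasCompactSupport φ)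
    (H : ∀ x, (∀ ω : Metric.sphere (0 : E3) 1, x + t • (ω : E3) ∉ tsupport φ) → h x = 0) :
    HasCompactSupport h := by
  obtain ⟨K, hK⟩ := hφ.isCompact.isBounded.subset_closedBall (0 : E3)
  refine HasCompactSupport.intro (isCompact_closedBall (0 : E3) (K + |t|)) ?_
  intro x hx
  apply H
  intro ω hω
  apply hx
  have h1 := hK hω
  have h2 : ‖(ω : E3)‖ = 1 := by simp
  rw [mem_closedBall_zero_iff] at h1 ⊢
  calc ‖x‖ = ‖(x + t • (ω : E3)) - t • (ω : E3)‖ := by simp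
    _ ≤ ‖x + t • (ω : E3)‖ + ‖t • (ω : E3)‖ := norm_sub_le _ _
    _ ≤ K + |t| := by
      rw [norm_smul, h2, Real.norm_eq_abs, mul_one]
      linarith

lemma contDiff_waveSinFun (t : ℝ) (φ : TestFn) :
    ContDiff ℝ (((⊤ : ℕ∞)) : WithTop ℕ∞) (waveSinFun t φ) := by
  have h : waveSinFun t φ = fun x => t *
      convolution (fun _ => (1 : ℝ)) φ (ContinuousLinearMap.mul ℝ ℝ) (sphereMeas t) x := by
    funext x
    unfold waveSinFun convolution
    rw [integral_sphereMeas t _ (by fun_prop)]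
    simp
  rw [h]
  refine contDiff_const.mul ?_
  exact φ.hasCompactSupport.contDiff_convolution_right _
    (continuous_const.locallyIntegrable) φ.contDiff

lemma contDiff_waveCosFun (t : ℝ) (φ : TestFn) :
    ContDiff ℝ (((⊤ : ℕ∞)) : WithTop ℕ∞) (waveCosFun t φ) := by
  have hd : ContDiff ℝ (((⊤ : ℕ∞)) : WithTop ℕ∞) (fderiv ℝ φ) :=
    φ.contDiff.fderiv_right (by simp)
  have hdc : Continuous (fderiv ℝ φ) := hd.continuous
  let L : E3 →L[ℝ] (E3 →L[ℝ] ℝ) →L[ℝ] ℝ := (ContinuousLinearMap.id ℝ (E3 →L[ℝ] ℝ)).flip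
  have h : waveCosFun t φ = fun x =>
      convolution (fun _ => (1 : ℝ)) φ (ContinuousLinearMap.mul ℝ ℝ) (sphereMeas t) x +
      convolution (fun y => -y) (fderiv ℝ φ) L (sphereMeas t) x := by
    funext x
    have hc1 : Continuous fun y => (ContinuousLinearMap.mul ℝ ℝ) 1 (φ (x - y)) := by fun_prop
    have hc2 : Continuous fun y => L (-y) (fderiv ℝ φ (x - y)) := by
      have : Continuous fun y => fderiv ℝ φ (x - y) := by fun_prop
      change Continuous fun y => (fderiv ℝ φ (x - y)) (-y)
      fun_prop
    unfold waveCosFun convolution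
    rw [integral_sphereMeas t _ hc1, integral_sphereMeas t _ hc2]
    simp only [average]
    rw [← integral_add]
    · refine integral_congr_ae (Eventually.of_forall fun ω => ?_)
      simp [L]
    · have : Continuous fun ω : Metric.sphere (0 : E3) 1 =>
          (ContinuousLinearMap.mul ℝ ℝ) 1 (φ (x - -(t • (ω : E3)))) :=
        hc1.comp (by fun_prop : Continuous fun ω : Metric.sphere (0 : E3) 1 => -(t • (ω : E3)))
      exact this.integrable_of_hasCompactSupport (HasCompactSupport.of_compactSpace _)
    · have : Continuous fun ω : Metric.sphere (0 : E3) 1 =>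
          L (- -(t • (ω : E3))) (fderiv ℝ φ (x - -(t • (ω : E3)))) :=
        hc2.comp (by fun_prop : Continuous fun ω : Metric.sphere (0 : E3) 1 => -(t • (ω : E3)))
      exact this.integrable_of_hasCompactSupport (HasCompactSupport.of_compactSpace _)
  rw [h]
  refine ContDiff.add ?_ ?_
  · exact φ.hasCompactSupport.contDiff_convolution_right _
      (continuous_const.locallyIntegrable) φ.contDiff
  · exact (φ.hasCompactSupport.fderiv ℝ).contDiff_convolution_right _
      (continuous_neg.locallyIntegrable) hd

/-- `sin(t√-Δ)/√-Δ` on test functions. -/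
def waveSin (t : ℝ) (φ : TestFn) : TestFn where
  toFun := waveSinFun t φ
  contDiff' := contDiff_waveSinFun t φ
  hasCompactSupport' := hasCompactSupport_of_sphere t φ.hasCompactSupport fun x hx => by
    have : ∀ ω : Metric.sphere (0 : E3) 1, φ (x + t • (ω : E3)) = 0 :=
      fun ω => image_eq_zero_of_notMem_tsupport (hx ω)
    simp [waveSinFun, this]
  tsupport_subset' := subset_univ _

/-- `cos(t√-Δ)` on test functions. -/
def waveCos (t : ℝ) (φ : TestFn) : TestFn where
  toFun := waveCosFun t φ
  contDiff' := contDiff_waveCosFun t φ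
  hasCompactSupport' := hasCompactSupport_of_sphere t φ.hasCompactSupport fun x hx => by
    have h0 : ∀ ω : Metric.sphere (0 : E3) 1, φ (x + t • (ω : E3)) = 0 :=
      fun ω => image_eq_zero_of_notMem_tsupport (hx ω)
    have h1 : ∀ ω : Metric.sphere (0 : E3) 1, fderiv ℝ φ (x + t • (ω : E3)) = 0 :=
      fun ω => image_eq_zero_of_notMem_tsupport
        (fun h => hx ω (tsupport_fderiv_subset ℝ h))
    simp [waveCosFun, h0, h1]
  tsupport_subset' := subset_univ _

/-- The first component `Φ₀(t)(f, g) = cos(t√-Δ) f + sin(t√-Δ)/√-Δ g` of the flow of the linear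
wave equation on `ℝ³`, for distributions `f`, `g`. The operators act by duality; both are symmetric
with respect to `∫ f g dx`. -/
def Phi0 {𝕜 : Type*} [RCLike 𝕜] (t : ℝ) (f g : TestFn → 𝕜) : TestFn → 𝕜 :=
  fun φ => f (waveCos t φ) + g (waveSin t φ)

/-! ### Outgoing states -/

/-- The nonlocal operator `f ↦ (1/r) ∫₀^r ρ f(ρ) dρ` on profiles of radial functions. -/
def radialAvg {𝕜 : Type*} [RCLike 𝕜] (f : ℝ → 𝕜) (r : ℝ) : 𝕜 :=
  r⁻¹ • ∫ ρ in (0 : ℝ)..r, ρ • f ρ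

/-- First component of the projection on outgoing states:
`(1/2) (u₀ - (1/r) ∫₀^r ρ u₁(ρ) dρ)`. -/
def P0plus {𝕜 : Type*} [RCLike 𝕜] (u₀ u₁ : ℝ → 𝕜) (r : ℝ) : 𝕜 :=
  (2⁻¹ : ℝ) • (u₀ r - radialAvg u₁ r)

/-- Second component of the projection on outgoing states:
`(1/2) (-(u₀)_r - u₀/r + u₁)`. It is only used below for a differentiable `u₀` (namely `u₀ = 0`). -/
def P1plus {𝕜 : Type*} [RCLike 𝕜] (u₀ u₁ : ℝ → 𝕜) (r : ℝ) : 𝕜 :=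
  (2⁻¹ : ℝ) • (-deriv u₀ r - r⁻¹ • u₀ r + u₁ r)

/-- `w_r + w/r = f` in the sense of distributions on `ℝ³`. (In polar coordinates the transpose of
`∂_r + 1/r` with respect to `r² dr` is `-(∂_r + 1/r)`.) The first condition, which is the local
integrability of `w(x)/|x|` on `ℝ³`, makes the integral absolutely convergent. -/
def HasRadialDeriv {𝕜 : Type*} [RCLike 𝕜] (w : ℝ → 𝕜) (f : Distr 𝕜) : Prop :=
  (∀ r : ℝ, 0 < r → IntervalIntegrable (fun ρ => ρ • w ρ) volume 0 r) ∧
  ∀ φ : TestFn,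
    f φ = -∫ x : E3, (fderiv ℝ φ x (‖x‖⁻¹ • x) + ‖x‖⁻¹ * φ x) • rad w x

/-- `w = (1/r) ∫₀^r ρ f(ρ) dρ` for a distribution `f`: the function `r w(r)` has derivative
`r f(r)`, that is `w_r + w/r = f`, and it vanishes (in mean) at `r = 0`. -/
def IsRadialAvg {𝕜 : Type*} [RCLike 𝕜] (f : Distr 𝕜) (w : ℝ → 𝕜) : Prop :=
  HasRadialDeriv w f ∧
    Tendsto (fun δ : ℝ => δ⁻¹ * ∫ ρ in (0 : ℝ)..δ, ‖ρ • w ρ‖) (𝓝[>] 0) (𝓝 0)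

/-- The data `(u₀, u₁)` are outgoing, i.e. `P₋(u₀, u₁) = 0`, where
`P₋(u₀, u₁) = ((1/2) (u₀ + (1/r) ∫₀^r ρ u₁ dρ), (1/2) ((u₀)_r + u₀/r + u₁))`. -/
structure IsOutgoing {𝕜 : Type*} [RCLike 𝕜] (u₀ : ℝ → 𝕜) (u₁ : Distr 𝕜) : Prop where
  fst_eq_zero : IsRadialAvg u₁ (fun r => -u₀ r)
  snd_eq_zero : HasRadialDeriv u₀ (-u₁)

/-- Radial outgoing data with `u₀ ∈ L^{N+2}(ℝ³)` and `supp u₀ ⊆ closure (ℝ³ \ B(0,R))`. -/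
structure IsData {𝕜 : Type*} [RCLike 𝕜] (N R : ℝ) (u₀ : ℝ → 𝕜) (u₁ : Distr 𝕜) : Prop where
  memLp : MemLp (rad u₀) (ENNReal.ofReal (N + 2)) volume
  support : ∀ᵐ x : E3, ‖x‖ < R → rad u₀ x = 0
  outgoing : IsOutgoing u₀ u₁

/-! ### The equation -/

/-- The nonlinearity `|u|^N u`. -/
def nonlin {𝕜 : Type*} [RCLike 𝕜] (N : ℝ) (f : ℝ → 𝕜) (r : ℝ) : 𝕜 := (‖f r‖ ^ N : ℝ) • f r

/-- First component of `P₊(0, |f|^N f)`. -/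
def force0 {𝕜 : Type*} [RCLike 𝕜] (N : ℝ) (f : ℝ → 𝕜) : ℝ → 𝕜 :=
  P0plus (fun _ => 0) (nonlin N f)

/-- Second component of `P₊(0, |f|^N f)`. -/
def force1 {𝕜 : Type*} [RCLike 𝕜] (N : ℝ) (f : ℝ → 𝕜) : ℝ → 𝕜 :=
  P1plus (fun _ => 0) (nonlin N f)

/-- `u` (with `u t` the profile of the radial function `u(t)`) solves
`u(t) = Φ₀(t)(u₀, u₁) + ∫₀^t Φ₀(t-s) P₊(0, |u(s)|^N u(s)) ds` on `ℝ³ × [0, T]`. The equation holds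
for every `t`, as an identity of distributions on `ℝ³`; the other fields say that every term in it
is well defined: `P₊(0, |u|^N u)` is given by absolutely convergent integrals and is locally
integrable on `ℝ³ × [0, T]`. -/
structure IsSolutionOn {𝕜 : Type*} [RCLike 𝕜] (N T : ℝ) (u₀ : ℝ → 𝕜) (u₁ : Distr 𝕜)
    (u : ℝ → ℝ → 𝕜) : Prop where
  measurable : AEStronglyMeasurable (fun p : ℝ × E3 => rad (u p.1) p.2)
    ((volume.restrict (Icc 0 T)).prod volume)
  locallyIntegrable : ∀ t ∈ Icc 0 T, LocallyIntegrable (rad (u t)) volume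
  integrable_nonlin : ∀ t ∈ Icc 0 T, ∀ r : ℝ, 0 < r →
    IntervalIntegrable (fun ρ => ρ • nonlin N (u t) ρ) volume 0 r
  integrable_force0 : ∀ M : ℝ, Integrable (fun p : ℝ × E3 => rad (force0 N (u p.1)) p.2)
    ((volume.restrict (Icc 0 T)).prod (volume.restrict (Metric.ball 0 M)))
  integrable_force1 : ∀ M : ℝ, Integrable (fun p : ℝ × E3 => rad (force1 N (u p.1)) p.2)
    ((volume.restrict (Icc 0 T)).prod (volume.restrict (Metric.ball 0 M)))
  equation : ∀ t ∈ Icc 0 T, ∀ φ : TestFn,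
    radFunctional (u t) φ = Phi0 t (radFunctional u₀) u₁ φ +
      ∫ s in (0 : ℝ)..t,
        Phi0 (t - s) (radFunctional (force0 N (u s))) (radFunctional (force1 N (u s))) φ

/-! ### Norms -/

/-- The `L^p(ℝ³)` norm, in `[0, ∞]`, of the radial function with profile `f`. -/
def LpNorm {𝕜 : Type*} [RCLike 𝕜] (p : ℝ≥0∞) (f : ℝ → 𝕜) : ℝ≥0∞ :=
  eLpNorm (rad f) p volume

/-- `f ∈ Ḣ¹(ℝ³)` with `‖f‖_{Ḣ¹} = ‖∇f‖_{L²} ≤ K`; here `Ḣ¹(ℝ³)` is the space of `f ∈ L⁶(ℝ³)` with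
weak gradient in `L²(ℝ³)`. -/
def HdotOneLE {𝕜 : Type*} [RCLike 𝕜] (f : E3 → 𝕜) (K : ℝ) : Prop :=
  MemLp f 6 volume ∧ ∃ g : Fin 3 → E3 → 𝕜,
    (∀ i, MemLp (g i) 2 volume) ∧
    (∀ i, ∀ φ : TestFn, ∫ x, fderiv ℝ φ x (EuclideanSpace.single i 1) • f x
      = -∫ x, φ x • g i x) ∧
    Real.sqrt (∑ i, ∫ x, ‖g i x‖ ^ 2) ≤ K

/-- `|f(x)| ≤ K ⟨x⟩⁻¹` for almost every `x`, i.e. `f` has norm at most `K` in `⟨x⟩⁻¹ L^∞`. -/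
def DecayLE {𝕜 : Type*} [RCLike 𝕜] (f : E3 → 𝕜) (K : ℝ) : Prop :=
  AEStronglyMeasurable f volume ∧ ∀ᵐ x : E3, Real.sqrt (1 + ‖x‖ ^ 2) * ‖f x‖ ≤ K

end OutgoingWave

end

/-! Radial outgoing waves only move outward. If the data are outgoing, the linear flow merely
translates `r u`: the free wave is `(r - t) u₀(r - t) / r` for `r > t` and zero for `r < t`.
Applying `P₊` to the nonlinearity makes each source outgoing too, so every Duhamel contribution is
again a translate. In the characteristic coordinate `q = r - t`, with `v(q) = q u₀(q)` and `V(q, t)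
= (q + t) u(q + t, t)`, the equation therefore becomes `V(q, t) = v(q) - (1/2) ∫₀ᵗ ∫₀^q (p + s)^(-N)
|V|^N V (p, s) dp ds`. The right side vanishes for `q ≤ R` whenever `v` and `V` do, so the
singularity at the origin is never met. The reduction rests on `kirchhoff_outgoing`, `Phi0_outgoing`
and `outShift_force0_prof`.

The `L^{N+2}(ℝ³)` norm of `u(t)` is, up to a fixed constant, the `L^{N+2}` norm of `V(·, t)` for the
measure `ν_t = (p + t)^(-N) dp` on `(R, ∞)` (`LpNorm_prof`). Since `ν_t` has total mass at most `(R
+ t)^(1 - N)`, Hölder bounds the inner integral by the `(N+1)`-st power of the norm times `1/g(s)`,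
where `g(t) = (R + t)^((N-1)/(N+2))`. The correction `D = V - v` is measured pointwise by `|D| ≤ A
g(t)`, which in turn gives norm at most `A` in `L^{N+2}(ν_t)`. As `g` increases, `∫₀ᵗ 1/g ≤ g(t)
θ(t)` with `θ(t) = ∫₀ᵗ g^(-2)`, and the iteration closes with a factor `1/2` as soon as `A^N θ(T)`
is small (`norm_picOp_sub_le`). The crude bound on `θ` is linear in `T` and gives local existence;
for `N > 4` the function `g^(-2)` is integrable on the half line and gives global existence
(`theta_le_linear`, `theta_le_global`).

The solution is the pointwise limit of Picard iterates, a formula in which neither `R`, `T` nor `A`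
occurs. It is applied to a representative of `u₀` chosen without reference to `R`, so a single
assignment serves all data classes and all time intervals.

Persistence is read off from `u = V/r`. Boundedness and decay follow from the pointwise bound on `D`
and the fact that `r > R + t` on the support. For `Ḣ¹`, the derivative `∂_q D` is a time integral of
the kernel, and if `|u| ≤ K` then the square of the kernel is at most `K^N (p + s)^(-N) |V|^{N+2}`,
whose integral the `L^{N+2}` norm already controls (`enorm_kern_sq_le`). Radial weak derivatives on
the half line are linked to weak gradients on `ℝ³` in both directions by
`HdotOneLE.exists_weakDeriv` and `WeakDeriv.integral_fderiv_smul_rad`. -/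

noncomputable section

namespace OutgoingWave

/-! ### Polar coordinates on `ℝ³` -/

/-- The surface measure on the unit sphere of `ℝ³`. -/
abbrev sph : Measure (Metric.sphere (0 : E3) 1) := (volume : Measure E3).toSphere

instance : NeZero sph := ⟨Measure.toSphere_ne_zero _⟩

/-- The measure `r² dr` on `(0, ∞)`. -/
def radMeas : Measure ℝ := (volume.restrict (Ioi 0)).withDensity fun r => ENNReal.ofReal (r ^ 2)

instance : SFinite radMeas := by unfold radMeas; infer_instance

lemma lintegral_radMeas {F : ℝ → ℝ≥0∞} (hF : AEMeasurable F (volume.restrict (Ioi 0))) :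
    ∫⁻ r, F r ∂radMeas = ∫⁻ r in Ioi 0, ENNReal.ofReal (r ^ 2) * F r := by
  unfold radMeas
  rw [lintegral_withDensity_eq_lintegral_mul₀ (by fun_prop) hF]
  rfl

lemma radMeas_ac : radMeas ≪ volume.restrict (Ioi 0) := withDensity_absolutelyContinuous _ _

lemma ac_radMeas : volume.restrict (Ioi 0) ≪ radMeas := by
  refine withDensity_absolutelyContinuous' (by fun_prop) ?_
  filter_upwards [ae_restrict_mem measurableSet_Ioi] with r hr
  have : 0 < r := hr
  simp [this.ne']

lemma lintegral_polar {F : E3 → ℝ≥0∞} (hF : Measurable F) :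
    ∫⁻ x, F x = ∫⁻ r in Ioi (0 : ℝ), ENNReal.ofReal (r ^ 2) *
      ∫⁻ ω : Metric.sphere (0 : E3) 1, F (r • (ω : E3)) ∂sph := by
  have h1 : ∫⁻ x, F x = ∫⁻ x : ({(0 : E3)}ᶜ : Set E3), F x.1 ∂(volume.comap Subtype.val) := by
    rw [lintegral_subtype_comap (measurableSet_singleton _).compl F, restrict_compl_singleton]
  have h2 := (volume : Measure E3).measurePreserving_homeomorphUnitSphereProd.symm
    (homeomorphUnitSphereProd E3).toMeasurableEquiv
  have h3 := h2.lintegral_comp (f := fun x : ({(0 : E3)}ᶜ : Set E3) => F x.1) (by fun_prop)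
  rw [h1, ← h3]
  have hm : Measurable fun p : Metric.sphere (0 : E3) 1 × Ioi (0 : ℝ) =>
      F ((p.2 : ℝ) • (p.1 : E3)) := by fun_prop
  have h4 : ∀ p : Metric.sphere (0 : E3) 1 × Ioi (0 : ℝ),
      F ((((homeomorphUnitSphereProd E3).toMeasurableEquiv.symm p :
        ({(0 : E3)}ᶜ : Set E3))) : E3) = F ((p.2 : ℝ) • (p.1 : E3)) := fun p => rfl
  simp only [h4]
  rw [lintegral_prod_symm _ hm.aemeasurable, Measure.volumeIoiPow,
    lintegral_withDensity_eq_lintegral_mul₀ (by fun_prop)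
      (hm.lintegral_prod_left').aemeasurable]
  have h5 := lintegral_subtype_comap (μ := volume) (measurableSet_Ioi (a := (0:ℝ)))
    (fun r : ℝ => ENNReal.ofReal (r ^ 2) *
      ∫⁻ ω : Metric.sphere (0 : E3) 1, F (r • (ω : E3)) ∂sph)
  rw [← h5]
  simp

/-- Polar coordinates on `ℝ³` as a measure preserving map. -/
lemma measurePreserving_polar :
    MeasurePreserving (fun p : Metric.sphere (0 : E3) 1 × ℝ => p.2 • (p.1 : E3))
      (sph.prod radMeas) volume := by
  have hm : Measurable fun p : Metric.sphere (0 : E3) 1 × ℝ => p.2 • (p.1 : E3) := by fun_prop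
  refine ⟨hm, ?_⟩
  ext s hs
  rw [Measure.map_apply hm hs, ← lintegral_indicator_one (hm hs), ← lintegral_indicator_one hs,
    lintegral_polar (by fun_prop (disch := assumption)),
    lintegral_prod_symm _ ((measurable_one.indicator (hm hs)).aemeasurable), lintegral_radMeas]
  · rfl
  · exact ((measurable_one.indicator (hm hs)).lintegral_prod_left').aemeasurable

lemma norm_smul_sphere {r : ℝ} (hr : 0 < r) (ω : Metric.sphere (0 : E3) 1) :
    ‖r • (ω : E3)‖ = r := by
  simp [norm_smul, abs_of_pos hr]

/-! ### Archimedes' hat-box theorem -/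

section hatBox

/-- Polar coordinates are used twice. In the plane orthogonal to `e` they produce the angle factor
`2π` and the Jacobian `ρ`; in the half plane of pairs `(ρ, z)` they give `ρ = r cos θ`, `z = r sin
θ`, so the total Jacobian is `r² cos θ`, and `s = sin θ` absorbs the cosine. -/
lemma lintegral_cyl (G : ℝ → ℝ → ℝ≥0∞) (hG : Measurable (Function.uncurry G)) (e : E3)
    (he : ‖e‖ = 1) :
    ∫⁻ x : E3, G ‖x‖ (inner ℝ e x) = ENNReal.ofReal (2 * Real.pi) *
      ∫⁻ r in Ioi (0 : ℝ), ENNReal.ofReal (r ^ 2) * ∫⁻ s in Ioo (-1 : ℝ) 1, G r (r * s) := by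
  obtain ⟨b, hb⟩ : ∃ b : OrthonormalBasis (Fin 3) ℝ E3, b 0 = e := by
    have ho : Orthonormal ℝ (({0} : Set (Fin 3)).domRestrict fun _ => e) := by
      refine ⟨fun i => he, fun i j hij => ?_⟩
      exact absurd (Subsingleton.elim i j) hij
    obtain ⟨b, hb⟩ := ho.exists_orthonormalBasis_extension_of_card_eq (by simp)
    exact ⟨b, hb 0 rfl⟩
  let f1 : ℝ × ℝ → ℝ≥0∞ := fun p => (Ioi 0).indicator (fun ρ => ENNReal.ofReal ρ *
    G (Real.sqrt (p.2 ^ 2 + ρ ^ 2)) p.2) p.1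
  have hsq : Measurable fun q : ℝ × ℝ => G (Real.sqrt (q.2 ^ 2 + q.1 ^ 2)) q.2 :=
    hG.comp ((by fun_prop : Measurable fun q : ℝ × ℝ => Real.sqrt (q.2 ^ 2 + q.1 ^ 2)).prodMk
      measurable_snd)
  have hf1 : Measurable f1 := by
    have : f1 = {q : ℝ × ℝ | 0 < q.1}.indicator fun q => ENNReal.ofReal q.1 *
        G (Real.sqrt (q.2 ^ 2 + q.1 ^ 2)) q.2 := by
      ext q; by_cases h : 0 < q.1 <;> simp [f1, h]
    rw [this]
    refine Measurable.indicator ?_ (measurableSet_lt measurable_const measurable_fst)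
    exact (by fun_prop : Measurable fun q : ℝ × ℝ => ENNReal.ofReal q.1).mul hsq
  have step1 : ∫⁻ x : E3, G ‖x‖ (inner ℝ e x)
      = ENNReal.ofReal (2 * Real.pi) * ∫⁻ p, f1 p := by
    have hH : Measurable fun y : EuclideanSpace ℝ (Fin 3) => G ‖y‖ (y 0) :=
      hG.comp (measurable_norm.prodMk (by fun_prop))
    have e1 : ∫⁻ x : E3, G ‖x‖ (inner ℝ e x) = ∫⁻ y : EuclideanSpace ℝ (Fin 3), G ‖y‖ (y 0) := by
      rw [← b.measurePreserving_repr.lintegral_comp hH]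
      refine lintegral_congr fun x => ?_
      rw [b.repr.norm_map, b.repr_apply_apply, hb]
    have hH2 : Measurable fun y : Fin 3 → ℝ => G (Real.sqrt (y 0 ^ 2 + y 1 ^ 2 + y 2 ^ 2)) (y 0) :=
      hG.comp ((by fun_prop : Measurable fun y : Fin 3 → ℝ =>
        Real.sqrt (y 0 ^ 2 + y 1 ^ 2 + y 2 ^ 2)).prodMk (measurable_pi_apply 0))
    have e2 : ∫⁻ y : EuclideanSpace ℝ (Fin 3), G ‖y‖ (y 0) =
        ∫⁻ y : Fin 3 → ℝ, G (Real.sqrt (y 0 ^ 2 + y 1 ^ 2 + y 2 ^ 2)) (y 0) := by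
      rw [← (PiLp.volume_preserving_ofLp (Fin 3)).lintegral_comp hH2]
      refine lintegral_congr fun x => ?_
      rw [EuclideanSpace.norm_eq, Fin.sum_univ_three]
      simp
    have hH3 : Measurable fun q : ℝ × (Fin 2 → ℝ) =>
        G (Real.sqrt (q.1 ^ 2 + q.2 0 ^ 2 + q.2 1 ^ 2)) q.1 :=
      hG.comp ((by fun_prop : Measurable fun q : ℝ × (Fin 2 → ℝ) =>
        Real.sqrt (q.1 ^ 2 + q.2 0 ^ 2 + q.2 1 ^ 2)).prodMk measurable_fst)
    have e3 : ∫⁻ y : Fin 3 → ℝ, G (Real.sqrt (y 0 ^ 2 + y 1 ^ 2 + y 2 ^ 2)) (y 0) =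
        ∫⁻ z : ℝ, ∫⁻ y : Fin 2 → ℝ, G (Real.sqrt (z ^ 2 + y 0 ^ 2 + y 1 ^ 2)) z := by
      rw [← lintegral_prod (fun q : ℝ × (Fin 2 → ℝ) =>
        G (Real.sqrt (q.1 ^ 2 + q.2 0 ^ 2 + q.2 1 ^ 2)) q.1) hH3.aemeasurable]
      exact ((volume_preserving_piFinSuccAbove (fun _ : Fin 3 => ℝ) 0).lintegral_comp hH3)
    have e4 : ∀ z : ℝ, ∫⁻ y : Fin 2 → ℝ, G (Real.sqrt (z ^ 2 + y 0 ^ 2 + y 1 ^ 2)) z =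
        ENNReal.ofReal (2 * Real.pi) * ∫⁻ ρ, f1 (ρ, z) := by
      intro z
      have hH4 : Measurable fun q : ℝ × ℝ => G (Real.sqrt (z ^ 2 + q.1 ^ 2 + q.2 ^ 2)) z :=
        hG.comp ((by fun_prop : Measurable fun q : ℝ × ℝ =>
          Real.sqrt (z ^ 2 + q.1 ^ 2 + q.2 ^ 2)).prodMk measurable_const)
      have := (volume_preserving_finTwoArrow ℝ).lintegral_comp hH4
      simp only [MeasurableEquiv.finTwoArrow_apply] at this
      rw [this, ← lintegral_comp_polarCoord_symm]
      have : ∀ p ∈ polarCoord.target, ENNReal.ofReal p.1 •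
          G (Real.sqrt (z ^ 2 + (polarCoord.symm p).1 ^ 2 + (polarCoord.symm p).2 ^ 2)) z
            = f1 (p.1, z) := by
        intro p hp
        have hp1 : 0 < p.1 := hp.1
        simp only [polarCoord_symm_apply, f1, indicator_of_mem (show p.1 ∈ Ioi 0 from hp1), smul_eq_mul]
        congr 3
        have := Real.sin_sq_add_cos_sq p.2
        linear_combination p.1 ^ 2 * this
      rw [setLIntegral_congr_fun (polarCoord.open_target.measurableSet) this, polarCoord_target,
        Measure.volume_eq_prod, ← Measure.prod_restrict]
      rw [lintegral_prod _ (by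
        exact (hf1.comp (by fun_prop : Measurable fun p : ℝ × ℝ => (p.1, z))).aemeasurable)]
      simp only [lintegral_const, Measure.restrict_apply_univ, Real.volume_Ioo]
      rw [lintegral_mul_const (f := fun ρ => f1 (ρ, z)) _
        (hf1.comp (by fun_prop : Measurable fun p : ℝ => (p, z))), mul_comm]
      congr 1
      · congr 1; ring
      · rw [← lintegral_indicator measurableSet_Ioi]
        refine lintegral_congr fun ρ => ?_
        by_cases h : 0 < ρ <;> simp [f1, h]
    rw [e1, e2, e3]
    simp only [e4]
    rw [lintegral_const_mul _ hf1.lintegral_prod_left', Measure.volume_eq_prod,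
      lintegral_prod_symm _ hf1.aemeasurable]
  rw [step1]
  congr 1
  rw [← lintegral_comp_polarCoord_symm]
  have h2 : ∀ p ∈ polarCoord.target, ENNReal.ofReal p.1 • f1 (polarCoord.symm p) =
      ENNReal.ofReal (p.1 ^ 2) * (Ioo (-(Real.pi / 2)) (Real.pi / 2)).indicator
        (fun θ => ENNReal.ofReal (Real.cos θ) * G p.1 (p.1 * Real.sin θ)) p.2 := by
    intro p hp
    have hp1 : 0 < p.1 := hp.1
    have hp2 : p.2 ∈ Ioo (-Real.pi) Real.pi := hp.2
    simp only [polarCoord_symm_apply, f1, smul_eq_mul]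
    by_cases hc : p.2 ∈ Ioo (-(Real.pi / 2)) (Real.pi / 2)
    · have hcos := Real.cos_pos_of_mem_Ioo hc
      have : p.1 * Real.cos p.2 ∈ Ioi (0 : ℝ) := mul_pos hp1 hcos
      rw [indicator_of_mem this, indicator_of_mem hc, ENNReal.ofReal_mul hp1.le, ← mul_assoc,
        ← mul_assoc, ← mul_assoc, ← ENNReal.ofReal_mul hp1.le, ← sq]
      congr 2
      rw [Real.sqrt_eq_iff_mul_self_eq (by positivity) hp1.le]
      have := Real.sin_sq_add_cos_sq p.2
      linear_combination p.1 ^ 2 * this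
    · have hcos : Real.cos p.2 ≤ 0 := by
        rw [mem_Ioo, not_and_or, not_lt, not_lt] at hc
        rcases hc with h | h
        · rw [← Real.cos_neg]
          exact Real.cos_nonpos_of_pi_div_two_le_of_le (by linarith) (by linarith [hp2.1])
        · exact Real.cos_nonpos_of_pi_div_two_le_of_le h (by linarith [hp2.2])
      have : p.1 * Real.cos p.2 ∉ Ioi (0 : ℝ) := by
        rw [mem_Ioi, not_lt]; exact mul_nonpos_of_nonneg_of_nonpos hp1.le hcos
      rw [indicator_of_notMem this, indicator_of_notMem hc]
      simp
  have hGm : Measurable fun p : ℝ × ℝ => ENNReal.ofReal (p.1 ^ 2) *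
      (Ioo (-(Real.pi / 2)) (Real.pi / 2)).indicator
        (fun θ => ENNReal.ofReal (Real.cos θ) * G p.1 (p.1 * Real.sin θ)) p.2 := by
    refine Measurable.mul (by fun_prop) ?_
    have : (fun p : ℝ × ℝ => (Ioo (-(Real.pi / 2)) (Real.pi / 2)).indicator
        (fun θ => ENNReal.ofReal (Real.cos θ) * G p.1 (p.1 * Real.sin θ)) p.2) =
        (Prod.snd ⁻¹' (Ioo (-(Real.pi / 2)) (Real.pi / 2))).indicator
        (fun p => ENNReal.ofReal (Real.cos p.2) * G p.1 (p.1 * Real.sin p.2)) := by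
      ext p; by_cases h : p.2 ∈ Ioo (-(Real.pi / 2)) (Real.pi / 2)
      · rw [indicator_of_mem h, indicator_of_mem (by exact h)]
      · rw [indicator_of_notMem h, indicator_of_notMem (by exact h)]
    rw [this]
    refine Measurable.indicator ?_ (measurable_snd measurableSet_Ioo)
    exact (by fun_prop : Measurable fun q : ℝ × ℝ => ENNReal.ofReal (Real.cos q.2)).mul
      (hG.comp (by fun_prop : Measurable fun q : ℝ × ℝ => (q.1, q.1 * Real.sin q.2)))
  rw [setLIntegral_congr_fun (polarCoord.open_target.measurableSet) h2, polarCoord_target,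
    Measure.volume_eq_prod, ← Measure.prod_restrict, lintegral_prod _ hGm.aemeasurable]
  refine lintegral_congr fun r => ?_
  dsimp only
  rw [lintegral_const_mul]
  swap
  · refine Measurable.indicator ?_ measurableSet_Ioo
    exact (by fun_prop : Measurable fun q : ℝ => ENNReal.ofReal (Real.cos q)).mul
      (hG.comp (by fun_prop : Measurable fun q : ℝ => (r, r * Real.sin q)))
  congr 1
  rw [lintegral_indicator measurableSet_Ioo, Measure.restrict_restrict measurableSet_Ioo,
    inter_eq_left.2 (Ioo_subset_Ioo (by linarith [Real.pi_pos]) (by linarith [Real.pi_pos]))]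
  have himg : Real.sin '' Ioo (-(Real.pi / 2)) (Real.pi / 2) = Ioo (-1) 1 := by
    ext s; constructor
    · rintro ⟨θ, hθ, rfl⟩
      have := Real.cos_pos_of_mem_Ioo hθ
      have h2 := Real.sin_sq_add_cos_sq θ
      constructor <;> nlinarith
    · intro hs
      exact ⟨Real.arcsin s, ⟨Real.neg_pi_div_two_lt_arcsin.2 hs.1, Real.arcsin_lt_pi_div_two.2 hs.2⟩,
        Real.sin_arcsin hs.1.le hs.2.le⟩
  rw [← himg, lintegral_image_eq_lintegral_abs_deriv_mul measurableSet_Ioo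
    (fun θ _ => (Real.hasDerivAt_sin θ).hasDerivWithinAt)
    (Real.injOn_sin.mono Ioo_subset_Icc_self)]
  refine setLIntegral_congr_fun measurableSet_Ioo fun θ hθ => ?_
  rw [abs_of_pos (Real.cos_pos_of_mem_Ioo hθ)]

/-- The two polar decompositions `lintegral_polar` and `lintegral_cyl` are compared on a function of
the direction alone, cut off to the unit ball. Both sides then carry the radial factor `∫₀¹ r² dr =
1/3`, which cancels. -/
lemma map_inner_sph (e : E3) (he : ‖e‖ = 1) :
    sph.map (fun ω : Metric.sphere (0 : E3) 1 => inner ℝ e (ω : E3))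
      = ENNReal.ofReal (2 * Real.pi) • volume.restrict (Ioo (-1 : ℝ) 1) := by
  have hm : Measurable fun ω : Metric.sphere (0 : E3) 1 => inner ℝ e (ω : E3) := by fun_prop
  ext s hs
  have h0 : ∫⁻ r in Ioi (0 : ℝ), ENNReal.ofReal (r ^ 2) * (Iio (1:ℝ)).indicator 1 r
      = ENNReal.ofReal (1 / 3) := by
    have : ∀ r : ℝ, ENNReal.ofReal (r ^ 2) * (Iio (1:ℝ)).indicator 1 r
        = (Iio (1:ℝ)).indicator (fun r => ENNReal.ofReal (r ^ 2)) r := by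
      intro r; by_cases h : r < 1 <;> simp [h]
    simp only [this]
    rw [lintegral_indicator measurableSet_Iio, Measure.restrict_restrict measurableSet_Iio,
      inter_comm, Ioi_inter_Iio, restrict_Ioo_eq_restrict_Ioc, ← ofReal_integral_eq_lintegral_ofReal,
      ← intervalIntegral.integral_of_le zero_le_one, integral_pow]
    · norm_num
    · exact (continuous_pow 2).integrableOn_Ioc
    · exact ae_of_all _ fun r => sq_nonneg r
  let G : ℝ → ℝ → ℝ≥0∞ := fun r z => (Iio (1:ℝ)).indicator 1 r * s.indicator 1 (z / r)
  have hG : Measurable (Function.uncurry G) := by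
    refine Measurable.mul ?_ ?_
    · exact (measurable_one.indicator measurableSet_Iio).comp measurable_fst
    · exact (measurable_one.indicator hs).comp (measurable_snd.div measurable_fst)
  have h1 := lintegral_cyl G hG e he
  have h2 : ∫⁻ x : E3, G ‖x‖ (inner ℝ e x) =
      ENNReal.ofReal (1/3) * sph.map (fun ω : Metric.sphere (0 : E3) 1 => inner ℝ e (ω : E3)) s := by
    rw [lintegral_polar, ← h0, ← lintegral_mul_const]
    · refine setLIntegral_congr_fun measurableSet_Ioi fun r hr => ?_
      simp only [G, norm_smul_sphere hr]
      have hr' : (0:ℝ) < r := hr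
      rw [mul_assoc]
      congr 1
      rw [lintegral_const_mul _ (by
        refine (measurable_one.indicator hs).comp ?_
        fun_prop)]
      congr 1
      rw [Measure.map_apply hm hs, ← lintegral_indicator_one (hm hs)]
      refine lintegral_congr fun ω => ?_
      rw [real_inner_smul_right, mul_div_cancel_left₀ _ hr'.ne']
      rfl
    · exact (by fun_prop : Measurable fun r : ℝ => ENNReal.ofReal (r ^ 2)).mul
        (measurable_one.indicator measurableSet_Iio)
    · exact hG.comp (measurable_norm.prodMk (by fun_prop))
  have h3 : ∫⁻ r in Ioi (0 : ℝ), ENNReal.ofReal (r ^ 2) * ∫⁻ s in Ioo (-1 : ℝ) 1, G r (r * s)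
      = ENNReal.ofReal (1/3) * volume.restrict (Ioo (-1 : ℝ) 1) s := by
    rw [← h0, ← lintegral_mul_const]
    · refine setLIntegral_congr_fun measurableSet_Ioi fun r hr => ?_
      have hr' : (0:ℝ) < r := hr
      simp only [G, mul_div_cancel_left₀ _ hr'.ne']
      rw [lintegral_const_mul _ (measurable_one.indicator hs), lintegral_indicator_one hs, mul_assoc]
    · exact (by fun_prop : Measurable fun r : ℝ => ENNReal.ofReal (r ^ 2)).mul
        (measurable_one.indicator measurableSet_Iio)
  rw [h2, h3, mul_left_comm] at h1
  rw [Measure.smul_apply, smul_eq_mul]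
  exact (ENNReal.mul_right_inj (by norm_num) (by simp)).1 h1

end hatBox

lemma sph_univ : sph (univ : Set (Metric.sphere (0 : E3) 1)) = ENNReal.ofReal (4 * Real.pi) := by
  have h := congrArg (fun μ : Measure ℝ => μ univ)
    (map_inner_sph (EuclideanSpace.single 0 1) (by simp))
  simp only [Measure.smul_apply, Measure.restrict_apply_univ, Real.volume_Ioo, smul_eq_mul] at h
  rw [Measure.map_apply (by fun_prop) MeasurableSet.univ, preimage_univ,
    ← ENNReal.ofReal_mul (by positivity)] at h
  rw [h]; congr 1; ring

lemma map_norm_volume : (volume : Measure E3).map norm = ENNReal.ofReal (4 * Real.pi) • radMeas := by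
  rw [← measurePreserving_polar.map_eq, Measure.map_map measurable_norm measurePreserving_polar.measurable]
  have : (norm ∘ fun p : Metric.sphere (0 : E3) 1 × ℝ => p.2 • (p.1 : E3))
      =ᵐ[sph.prod radMeas] Prod.snd := by
    have h : ∀ᵐ r ∂radMeas, 0 < r := radMeas_ac.ae_le (ae_restrict_mem measurableSet_Ioi)
    have h2 : ∀ᵐ p : Metric.sphere (0 : E3) 1 × ℝ ∂(sph.prod radMeas), 0 < p.2 :=
      Measure.quasiMeasurePreserving_snd.ae h
    filter_upwards [h2] with p hp
    exact norm_smul_sphere hp p.1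
  rw [Measure.map_congr this, ← sph_univ]
  exact Measure.map_snd_prod

lemma measurePreserving_norm :
    MeasurePreserving (norm : E3 → ℝ) volume (ENNReal.ofReal (4 * Real.pi) • radMeas) :=
  ⟨measurable_norm, map_norm_volume⟩

lemma four_pi_ne_zero : ENNReal.ofReal (4 * Real.pi) ≠ 0 := by
  simp [Real.pi_pos]

/-- In the forward direction Fubini in polar coordinates gives, for almost every `r`, a direction at
which the property holds, and one direction is enough because the property depends only on the norm.
-/
lemma ae_norm_iff {P : ℝ → Prop} :
    (∀ᵐ x : E3, P ‖x‖) ↔ ∀ᵐ r ∂(volume.restrict (Ioi (0 : ℝ))), P r := by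
  constructor
  · intro h
    have h1 : ∀ᵐ p : Metric.sphere (0 : E3) 1 × ℝ ∂(sph.prod radMeas), P ‖p.2 • (p.1 : E3)‖ :=
      measurePreserving_polar.quasiMeasurePreserving.ae h
    have h3 : ∀ᵐ r ∂radMeas, ∀ᵐ ω : Metric.sphere (0 : E3) 1 ∂sph, P ‖r • (ω : E3)‖ := by
      have := Measure.measurePreserving_swap (μ := radMeas) (ν := sph)
      exact Measure.ae_ae_of_ae_prod (this.quasiMeasurePreserving.ae h1)
    filter_upwards [ac_radMeas.ae_le h3, ae_restrict_mem measurableSet_Ioi] with r hr hr0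
    obtain ⟨ω, hω⟩ := hr.exists
    rwa [norm_smul_sphere hr0] at hω
  · intro h
    refine measurePreserving_norm.quasiMeasurePreserving.ae ?_
    exact (Measure.smul_absolutelyContinuous.trans radMeas_ac).ae_le h

lemma lintegral_norm {F : ℝ → ℝ≥0∞} (hF : AEMeasurable F (volume.restrict (Ioi 0))) :
    ∫⁻ x : E3, F ‖x‖ = ENNReal.ofReal (4 * Real.pi) *
      ∫⁻ r in Ioi 0, ENNReal.ofReal (r ^ 2) * F r := by
  have h : AEMeasurable F ((volume : Measure E3).map norm) := by
    rw [map_norm_volume]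
    exact (hF.mono_ac radMeas_ac).smul_measure _
  rw [← lintegral_radMeas hF, ← lintegral_map' h (by fun_prop), map_norm_volume,
    lintegral_smul_measure, smul_eq_mul]

/-- A measurable representative on `ℝ³`, restricted to almost any ray, represents the profile;
conversely the norm pulls representatives back. -/
lemma aestronglyMeasurable_rad_iff {𝕜 : Type*} [RCLike 𝕜] {f : ℝ → 𝕜} :
    AEStronglyMeasurable (rad f) volume ↔ AEStronglyMeasurable f (volume.restrict (Ioi 0)) := by
  constructor
  · rintro ⟨g, hg, hfg⟩
    have h1 : ∀ᵐ p : Metric.sphere (0 : E3) 1 × ℝ ∂(sph.prod radMeas), rad f (p.2 • (p.1 : E3)) = g (p.2 • (p.1 : E3)) :=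
      measurePreserving_polar.quasiMeasurePreserving.ae hfg
    have h2 : ∀ᵐ ω : Metric.sphere (0 : E3) 1 ∂sph, ∀ᵐ r ∂radMeas, rad f (r • (ω : E3)) = g (r • (ω : E3)) :=
      Measure.ae_ae_of_ae_prod h1
    obtain ⟨ω, hω⟩ := h2.exists
    refine ⟨fun r => g (r • (ω : E3)), hg.comp_measurable (by fun_prop), ?_⟩
    filter_upwards [ac_radMeas.ae_le hω, ae_restrict_mem measurableSet_Ioi] with r hr hr0
    rw [← hr, rad, norm_smul_sphere hr0]
  · intro h
    have : AEStronglyMeasurable f ((volume : Measure E3).map norm) := by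
      rw [map_norm_volume]
      exact h.mono_ac (Measure.smul_absolutelyContinuous.trans radMeas_ac)
    exact this.comp_measurable measurable_norm

end OutgoingWave
end

/-! ### Spherical integrals and their calculus -/

noncomputable section

namespace OutgoingWave

/-- The integral of `g` over the sphere of radius `|r|`, in the angular variable. -/
def sphInt {F : Type*} [NormedAddCommGroup F] [NormedSpace ℝ F] (g : E3 → F) (r : ℝ) : F :=
  ∫ ω : Metric.sphere (0 : E3) 1, g (r • (ω : E3)) ∂sph

section polar

variable {F : Type*} [NormedAddCommGroup F]

lemma integrable_polar {G : E3 → F} (hG : Integrable G) :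
    Integrable (fun p : Metric.sphere (0 : E3) 1 × ℝ => G (p.2 • (p.1 : E3)))
      (sph.prod radMeas) :=
  measurePreserving_polar.integrable_comp_of_integrable hG

variable [NormedSpace ℝ F]

lemma integral_radMeas (f : ℝ → F) :
    ∫ r, f r ∂radMeas = ∫ r in Ioi (0 : ℝ), r ^ 2 • f r := by
  unfold radMeas
  rw [integral_withDensity_eq_integral_toReal_smul (by fun_prop) (by simp)]
  refine integral_congr_ae (Eventually.of_forall fun r => ?_)
  simp only
  rw [ENNReal.toReal_ofReal (sq_nonneg r)]

lemma integral_polar {G : E3 → F} (hG : Integrable G) :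
    ∫ x, G x = ∫ r in Ioi (0 : ℝ), r ^ 2 • sphInt G r := by
  have h := integrable_polar hG
  have h1 : ∫ x, G x = ∫ p : Metric.sphere (0 : E3) 1 × ℝ, G (p.2 • (p.1 : E3))
      ∂(sph.prod radMeas) := by
    rw [← measurePreserving_polar.map_eq, integral_map measurePreserving_polar.aemeasurable]
    rw [measurePreserving_polar.map_eq]
    exact hG.aestronglyMeasurable
  rw [h1, integral_prod_symm _ h, integral_radMeas]
  rfl

variable {𝕜 : Type*} [RCLike 𝕜]

lemma locallyIntegrable_rad {w : ℝ → 𝕜}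
    (hw : ∀ M : ℝ, 0 < M → IntervalIntegrable (fun r => r ^ 2 • w r) volume 0 M) :
    LocallyIntegrable (rad w) volume := by
  rw [locallyIntegrable_iff]
  intro k hk
  obtain ⟨M, hM⟩ := hk.isBounded.subset_ball_lt 0 (0 : E3)
  refine IntegrableOn.mono_set ?_ hM.2
  have := (integrableOn_fun_norm_addHaar (volume : Measure E3) (f := w) (r := M)).2
  refine this ?_
  simp only [finrank_euclideanSpace, Fintype.card_fin]
  have := (hw M hM.1).1
  exact this.mono_set Ioo_subset_Ioc_self

lemma locallyIntegrable_rad_of_mul {w : ℝ → 𝕜}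
    (hw : ∀ M : ℝ, 0 < M → IntervalIntegrable (fun r => r • w r) volume 0 M) :
    LocallyIntegrable (rad w) volume := by
  refine locallyIntegrable_rad fun M hM => ?_
  rw [intervalIntegrable_iff_integrableOn_Icc_of_le hM.le]
  have := ((intervalIntegrable_iff_integrableOn_Icc_of_le hM.le).1 (hw M hM)).continuousOn_smul
    (f := fun r : ℝ => r) continuousOn_id isCompact_Icc
  refine this.congr (Eventually.of_forall fun r => ?_)
  simp only [smul_smul, sq]

lemma integrable_mul_rad {w : ℝ → 𝕜} (hw : LocallyIntegrable (rad w) volume)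
    {g : E3 → ℝ} (hg : Continuous g) (hgc : HasCompactSupport g) :
    Integrable (fun x => g x • rad w x) volume :=
  hw.integrable_smul_left_of_hasCompactSupport hg hgc

lemma integral_mul_rad {w : ℝ → 𝕜} (hw : LocallyIntegrable (rad w) volume)
    {g : E3 → ℝ} (hg : Continuous g) (hgc : HasCompactSupport g) :
    ∫ x, g x • rad w x = ∫ r in Ioi (0 : ℝ), (r ^ 2 * sphInt g r) • w r := by
  rw [integral_polar (integrable_mul_rad hw hg hgc)]
  refine setIntegral_congr_fun measurableSet_Ioi fun r hr => ?_
  simp only [sphInt, rad, norm_smul_sphere hr, mul_smul]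
  rw [integral_smul_const]

lemma integrableOn_mul_rad {w : ℝ → 𝕜} (hw : LocallyIntegrable (rad w) volume)
    {g : E3 → ℝ} (hg : Continuous g) (hgc : HasCompactSupport g) :
    IntegrableOn (fun r => (r ^ 2 * sphInt g r) • w r) (Ioi (0 : ℝ)) := by
  have h := (integrable_polar (integrable_mul_rad hw hg hgc)).integral_prod_right
  unfold radMeas at h
  rw [integrable_withDensity_iff_integrable_smul' (by fun_prop) (by simp)] at h
  refine (integrable_congr ?_).1 h
  filter_upwards [ae_restrict_mem measurableSet_Ioi] with r hr
  simp only [sphInt, rad, norm_smul_sphere hr, mul_smul]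
  rw [integral_smul_const, ENNReal.toReal_ofReal (sq_nonneg r)]

end polar

section param

/-- Compactness supplies the dominating constant: the derivative is bounded on the unit ball around
`s₀` times the whole space `Y`. -/
lemma hasDerivAt_integral_compact {Y : Type*} [TopologicalSpace Y] [CompactSpace Y]
    [MeasurableSpace Y] [OpensMeasurableSpace Y]
    {μ : Measure Y} [IsFiniteMeasure μ] {f f' : ℝ → Y → ℝ}
    (hf : ∀ s, Continuous (f s)) (hf' : Continuous (Function.uncurry f'))
    (hd : ∀ s y, HasDerivAt (fun s => f s y) (f' s y) s) (s₀ : ℝ) :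
    HasDerivAt (fun s => ∫ y, f s y ∂μ) (∫ y, f' s₀ y ∂μ) s₀ := by
  have hK : IsCompact (Metric.closedBall s₀ 1 ×ˢ (univ : Set Y)) :=
    (isCompact_closedBall _ _).prod isCompact_univ
  obtain ⟨K, hK⟩ := (hK.image hf').isBounded.exists_norm_le
  have hint : ∀ g : Y → ℝ, Continuous g → Integrable g μ := fun g hg =>
    hg.integrable_of_hasCompactSupport (HasCompactSupport.of_compactSpace _)
  refine (hasDerivAt_integral_of_dominated_loc_of_deriv_le (bound := fun _ => K)
    (Metric.closedBall_mem_nhds s₀ one_pos)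
    (Eventually.of_forall fun s => (hint _ (hf s)).aestronglyMeasurable) (hint _ (hf s₀))
    (hint _ (hf'.comp (by fun_prop : Continuous fun y : Y => (s₀, y)))).aestronglyMeasurable
    ?_ (integrable_const _) ?_).2
  · refine Eventually.of_forall fun y s hs => hK _ ⟨(s, y), ⟨hs, trivial⟩, rfl⟩
  · exact Eventually.of_forall fun y s _ => hd s y

lemma continuous_sphInt {g : E3 → ℝ} (hg : Continuous g) : Continuous (sphInt g) := by
  have := continuous_parametric_integral_of_continuous (μ := sph)
    (f := fun (r : ℝ) (ω : Metric.sphere (0 : E3) 1) => g (r • (ω : E3)))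
    (by unfold Function.uncurry; fun_prop) isCompact_univ
  simpa [sphInt] using! this

lemma sphInt_eq_zero_of_large {g : E3 → ℝ} (hg : HasCompactSupport g) :
    ∃ M : ℝ, 0 < M ∧ ∀ r, M ≤ r → sphInt g r = 0 := by
  obtain ⟨M, hM0, hM⟩ := hg.isCompact.isBounded.subset_ball_lt 0 (0 : E3)
  refine ⟨M, hM0, fun r hr => ?_⟩
  unfold sphInt
  refine integral_eq_zero_of_ae (Eventually.of_forall fun ω => ?_)
  refine image_eq_zero_of_notMem_tsupport fun h => ?_
  have := hM h
  rw [mem_ball_zero_iff, norm_smul_sphere (by linarith)] at this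
  linarith

lemma integrableOn_Ioi_of_continuous {f : ℝ → ℝ} (hf : Continuous f) {M : ℝ}
    (h0 : ∀ r, M ≤ r → f r = 0) : IntegrableOn f (Ioi 0) := by
  have h1 : IntegrableOn f (Ioc 0 M) := hf.integrableOn_Ioc
  refine h1.of_forall_sdiff_eq_zero measurableSet_Ioi fun r hr => h0 r ?_
  by_contra h
  exact hr.2 ⟨hr.1, (not_le.1 h).le⟩

/-- The region `|r - t| < ρ < r + t` is symmetric in `r` and `ρ`. -/
lemma integral_triangle_swap {a b : ℝ → ℝ} (ha : Continuous a) (hb : Continuous b) {A B : ℝ}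
    (ha0 : ∀ r, A ≤ r → a r = 0) (hb0 : ∀ r, B ≤ r → b r = 0) {t : ℝ} (ht : 0 < t) :
    ∫ r in Ioi (0 : ℝ), a r * ∫ ρ in |r - t|..(r + t), b ρ
      = ∫ r in Ioi (0 : ℝ), b r * ∫ ρ in |r - t|..(r + t), a ρ := by
  have key : ∀ c : ℝ → ℝ, ∀ r ∈ Ioi (0 : ℝ), ∫ ρ in |r - t|..(r + t), c ρ =
      ∫ ρ in Ioi (0 : ℝ), (Ioo |r - t| (r + t)).indicator c ρ := by
    intro c r hr
    have hr' : 0 < r := hr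
    rw [integral_indicator measurableSet_Ioo, Measure.restrict_restrict measurableSet_Ioo,
      inter_eq_left.2, intervalIntegral.integral_of_le (abs_le.2 ⟨by linarith, by linarith⟩),
      integral_Ioc_eq_integral_Ioo]
    exact fun x hx => (abs_nonneg _).trans_lt hx.1
  have hsymm : ∀ r ρ : ℝ, ρ ∈ Ioo |r - t| (r + t) ↔ r ∈ Ioo |ρ - t| (ρ + t) := by
    intro r ρ
    simp only [mem_Ioo, abs_lt]
    constructor <;> rintro ⟨⟨h1, h2⟩, h3⟩ <;> refine ⟨⟨?_, ?_⟩, ?_⟩ <;> linarith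
  have h1 : ∀ (a b : ℝ → ℝ), ∫ r in Ioi (0 : ℝ), a r * ∫ ρ in |r - t|..(r + t), b ρ =
      ∫ r in Ioi (0 : ℝ), ∫ ρ in Ioi (0 : ℝ), a r * (Ioo |r - t| (r + t)).indicator b ρ := by
    intro a b
    refine setIntegral_congr_fun measurableSet_Ioi fun r hr => ?_
    rw [key b r hr, integral_const_mul]
  have hE : MeasurableSet {p : ℝ × ℝ | p.2 ∈ Ioo |p.1 - t| (p.1 + t)} := by
    refine MeasurableSet.inter ?_ ?_
    · exact measurableSet_lt (by fun_prop : Measurable fun p : ℝ × ℝ => |p.1 - t|) measurable_snd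
    · exact measurableSet_lt measurable_snd (by fun_prop : Measurable fun p : ℝ × ℝ => p.1 + t)
  rw [h1, h1, integral_integral_swap]
  · refine integral_congr_ae (Eventually.of_forall fun ρ => ?_)
    refine integral_congr_ae (Eventually.of_forall fun r => ?_)
    simp only
    by_cases h : ρ ∈ Ioo |r - t| (r + t)
    · rw [indicator_of_mem h, indicator_of_mem ((hsymm r ρ).1 h), mul_comm]
    · rw [indicator_of_notMem h, indicator_of_notMem (fun h' => h ((hsymm r ρ).2 h'))]
      simp
  · have := ((integrableOn_Ioi_of_continuous ha ha0).mul_prod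
      (integrableOn_Ioi_of_continuous hb hb0)).indicator hE
    refine this.congr (Eventually.of_forall fun p => ?_)
    simp only [Function.uncurry, indicator, mem_ofPred_eq]
    split_ifs <;> simp

end param

/-! ### Integrals over two spheres -/

section double

/-- The mean of a radial function over a sphere of radius `t` around a point. -/
lemma integral_sph_radial {w : ℝ → ℝ} (hw : Continuous w) {x : E3} (hx : x ≠ 0) {t : ℝ}
    (ht : 0 < t) :
    ∫ ω : Metric.sphere (0 : E3) 1, w ‖x + t • (ω : E3)‖ ∂sph
      = 2 * Real.pi / (‖x‖ * t) * ∫ ρ in |‖x‖ - t|..(‖x‖ + t), ρ * w ρ := by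
  have hr : 0 < ‖x‖ := norm_pos_iff.2 hx
  set r := ‖x‖ with hrdef
  set e : E3 := r⁻¹ • x with he
  have hen : ‖e‖ = 1 := by
    rw [he, norm_smul, norm_inv, Real.norm_eq_abs, abs_of_pos hr, ← hrdef, inv_mul_cancel₀ hr.ne']
  let g : ℝ → ℝ := fun s => w (Real.sqrt (r ^ 2 + t ^ 2 + 2 * r * t * s))
  have hg : Continuous g := by fun_prop
  have h1 : ∀ ω : Metric.sphere (0 : E3) 1, w ‖x + t • (ω : E3)‖ = g (inner ℝ e (ω : E3)) := by
    intro ω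
    have h2 : ‖x + t • (ω : E3)‖ ^ 2 = r ^ 2 + t ^ 2 + 2 * r * t * inner ℝ e (ω : E3) := by
      rw [norm_add_sq_real, norm_smul, real_inner_smul_right, he, real_inner_smul_left]
      have : ‖(ω : E3)‖ = 1 := by simp
      rw [this, Real.norm_eq_abs, mul_one, sq_abs, ← hrdef]
      field_simp
      ring
    simp only [g]
    rw [← h2, Real.sqrt_sq (norm_nonneg _)]
  simp only [h1]
  have h3 : ∫ ω : Metric.sphere (0 : E3) 1, g (inner ℝ e (ω : E3)) ∂sph =
      2 * Real.pi * ∫ s in (-1 : ℝ)..1, g s := by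
    rw [← integral_map (φ := fun ω : Metric.sphere (0 : E3) 1 => inner ℝ e (ω : E3)) (f := g)
      (by fun_prop) hg.aestronglyMeasurable, map_inner_sph e hen, integral_smul_measure,
      ENNReal.toReal_ofReal (by positivity), intervalIntegral.integral_of_le (by norm_num),
      integral_Ioc_eq_integral_Ioo, smul_eq_mul]
  rw [h3]
  -- By the law of cosines `ρ² = r² + t² + 2rts`. Solving for `s` gives a substitution with
  -- derivative `ρ / (rt)`, and the endpoints `|r - t|` and `r + t` correspond to `s = -1` and `s =
  -- 1`.
  have h4 : ∫ ρ in |r - t|..(r + t), (g ∘ fun ρ => (ρ ^ 2 - r ^ 2 - t ^ 2) / (2 * r * t)) ρ *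
      (ρ / (r * t)) = ∫ s in (-1 : ℝ)..1, g s := by
    rw [intervalIntegral.integral_comp_mul_deriv (f' := fun ρ => ρ / (r * t))]
    · congr 1
      · rw [sq_abs]; field_simp; ring
      · field_simp; ring
    · intro ρ _
      have := (((hasDerivAt_pow 2 ρ).sub_const (r ^ 2)).sub_const (t ^ 2)).div_const (2 * r * t)
      convert! this using 1
      simp only [Nat.cast_ofNat, Nat.add_one_sub_one, pow_one]
      field_simp
    · fun_prop
    · exact hg
  rw [← h4]
  have hle : |r - t| ≤ r + t := abs_le.2 ⟨by linarith, by linarith⟩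
  have h5 : ∫ ρ in |r - t|..(r + t), (g ∘ fun ρ => (ρ ^ 2 - r ^ 2 - t ^ 2) / (2 * r * t)) ρ *
      (ρ / (r * t)) = ∫ ρ in |r - t|..(r + t), (r * t)⁻¹ * (ρ * w ρ) := by
    refine intervalIntegral.integral_congr fun ρ hρ => ?_
    rw [uIcc_of_le hle] at hρ
    have hρ0 : 0 ≤ ρ := (abs_nonneg _).trans hρ.1
    have : r ^ 2 + t ^ 2 + 2 * r * t * ((ρ ^ 2 - r ^ 2 - t ^ 2) / (2 * r * t)) = ρ ^ 2 := by
      field_simp; ring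
    simp only [Function.comp, g]
    rw [this, Real.sqrt_sq hρ0]
    field_simp
  rw [h5, intervalIntegral.integral_const_mul]
  field_simp

/-- The integral of `φ(rω + tη)` over two independent unit vectors `ω`, `η`. -/
def dblInt (φ : E3 → ℝ) (r t : ℝ) : ℝ :=
  ∫ p : Metric.sphere (0 : E3) 1 × Metric.sphere (0 : E3) 1,
    φ (r • (p.1 : E3) + t • (p.2 : E3)) ∂(sph.prod sph)

lemma continuous_dblInt {φ : E3 → ℝ} (hφ : Continuous φ) (t : ℝ) :
    Continuous fun r => dblInt φ r t := by
  have := continuous_parametric_integral_of_continuous (μ := sph.prod sph)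
    (f := fun (r : ℝ) (p : Metric.sphere (0 : E3) 1 × Metric.sphere (0 : E3) 1) =>
      φ (r • (p.1 : E3) + t • (p.2 : E3)))
    (by unfold Function.uncurry; fun_prop) isCompact_univ
  simpa [dblInt] using! this

/-- Since `φ` is not radial, `integral_sph_radial` cannot be applied to it. By duality the
translation by `tη` is moved from `φ` to the radial weight `w`, whose spherical mean is explicit;
the symmetry of the triangle region then returns the integral over `ρ` to `φ`. -/
lemma dblInt_test {φ : E3 → ℝ} (hφ : Continuous φ) (hφc : HasCompactSupport φ)
    {t : ℝ} (ht : 0 < t) {w : ℝ → ℝ} (hw : Continuous w) (hwc : HasCompactSupport w) :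
    ∫ r in Ioi (0 : ℝ), r ^ 2 * w r * dblInt φ r t
      = ∫ r in Ioi (0 : ℝ), w r * (2 * Real.pi * r / t * ∫ ρ in |r - t|..(r + t), ρ * sphInt φ ρ) := by
  let Q : E3 → ℝ := fun x => ∫ η : Metric.sphere (0 : E3) 1, φ (x + t • (η : E3)) ∂sph
  have hQ : Continuous Q := by
    have := continuous_parametric_integral_of_continuous (μ := sph)
      (f := fun (x : E3) (η : Metric.sphere (0 : E3) 1) => φ (x + t • (η : E3)))
      (by unfold Function.uncurry; fun_prop) isCompact_univ
    simpa [Q] using! this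
  have hQc : HasCompactSupport Q := hasCompactSupport_of_sphere t hφc fun x hx => by
    have : ∀ η : Metric.sphere (0 : E3) 1, φ (x + t • (η : E3)) = 0 :=
      fun η => image_eq_zero_of_notMem_tsupport (hx η)
    simp [Q, this]
  have hcomp : ∀ {Y : Type} [TopologicalSpace Y] [CompactSpace Y] [MeasurableSpace Y]
      [OpensMeasurableSpace Y] [SecondCountableTopology Y] [T2Space Y] (μ : Measure Y) [IsFiniteMeasure μ]
      (F : E3 × Y → ℝ), Continuous F → ∀ K : Set E3, IsCompact K → (∀ p, p.1 ∉ K → F p = 0) →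
      Integrable F (volume.prod μ) := by
    intro Y _ _ _ _ _ _ μ _ F hF K hK h0
    refine hF.integrable_of_hasCompactSupport (HasCompactSupport.intro (hK.prod isCompact_univ)
      fun p hp => h0 p fun h => hp ⟨h, trivial⟩)
  have hwn : HasCompactSupport fun x : E3 => w ‖x‖ := by
    obtain ⟨M, hM⟩ := hwc.isCompact.isBounded.subset_closedBall (0 : ℝ)
    refine HasCompactSupport.intro (isCompact_closedBall (0 : E3) M) fun x hx => ?_
    refine image_eq_zero_of_notMem_tsupport fun h => hx ?_
    simpa using hM h
  have hwloc : LocallyIntegrable (rad w) (volume : Measure E3) :=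
    (hw.comp continuous_norm).locallyIntegrable
  have hd : ∀ r, dblInt φ r t = sphInt Q r := by
    intro r
    unfold dblInt sphInt
    rw [integral_prod]
    have : Continuous fun p : Metric.sphere (0 : E3) 1 × Metric.sphere (0 : E3) 1 =>
        φ (r • (p.1 : E3) + t • (p.2 : E3)) := by fun_prop
    exact this.integrable_of_hasCompactSupport (HasCompactSupport.of_compactSpace _)
  let V : E3 → ℝ := fun x => ∫ η : Metric.sphere (0 : E3) 1, w ‖x - t • (η : E3)‖ ∂sph
  have hV : Continuous V := by
    have := continuous_parametric_integral_of_continuous (μ := sph)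
      (f := fun (x : E3) (η : Metric.sphere (0 : E3) 1) => w ‖x - t • (η : E3)‖)
      (by unfold Function.uncurry; fun_prop) isCompact_univ
    simpa [V] using! this
  let W : ℝ → ℝ := fun r => 2 * Real.pi / (r * t) * ∫ ρ in |r - t|..(r + t), ρ * w ρ
  have hVW : V =ᵐ[volume] rad W := by
    have : ∀ᵐ x : E3, x ≠ 0 := by simp [ae_iff]
    filter_upwards [this] with x hx
    have := integral_sph_radial hw (neg_ne_zero.2 hx) ht
    simp only [V, rad, W]
    rw [norm_neg] at this
    rw [← this]
    refine integral_congr_ae (Eventually.of_forall fun η => ?_)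
    simp only
    rw [← norm_neg]; congr 2; abel
  have hWloc : LocallyIntegrable (rad W) volume := hV.locallyIntegrable.congr hVW
  have e1 : ∫ r in Ioi (0 : ℝ), r ^ 2 * w r * dblInt φ r t = ∫ x, Q x • rad w x := by
    rw [integral_mul_rad hwloc hQ hQc]
    refine integral_congr_ae (Eventually.of_forall fun r => ?_)
    simp only [hd, smul_eq_mul]; ring
  have e2 : ∫ x, Q x • rad w x = ∫ x, φ x • V x := by
    have i1 : Integrable (fun p : E3 × Metric.sphere (0 : E3) 1 =>
        φ (p.1 + t • (p.2 : E3)) * w ‖p.1‖) (volume.prod sph) := by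
      refine hcomp _ _ (by fun_prop) _ hwn.isCompact fun p hp => ?_
      have : w ‖p.1‖ = 0 := image_eq_zero_of_notMem_tsupport (f := fun x : E3 => w ‖x‖) hp
      rw [this, mul_zero]
    have i2 : Integrable (fun p : E3 × Metric.sphere (0 : E3) 1 =>
        φ p.1 * w ‖p.1 - t • (p.2 : E3)‖) (volume.prod sph) := by
      refine hcomp _ _ (by fun_prop) _ hφc.isCompact fun p hp => ?_
      rw [image_eq_zero_of_notMem_tsupport hp, zero_mul]
    have s1 := integral_integral_swap (f := fun (x : E3) (η : Metric.sphere (0 : E3) 1) =>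
      φ (x + t • (η : E3)) * w ‖x‖) i1
    have s2 := integral_integral_swap (f := fun (x : E3) (η : Metric.sphere (0 : E3) 1) =>
      φ x * w ‖x - t • (η : E3)‖) i2
    simp only [integral_mul_const] at s1
    simp only [integral_const_mul] at s2
    simp only [smul_eq_mul, Q, V, rad]
    rw [s1, s2]
    refine integral_congr_ae (Eventually.of_forall fun η => ?_)
    simp only
    rw [← integral_sub_right_eq_self _ (t • (η : E3))]
    simp
  have e3 : ∫ x, φ x • V x = ∫ r in Ioi (0 : ℝ), (r ^ 2 * sphInt φ r) • W r := by
    rw [← integral_mul_rad hWloc hφ hφc]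
    refine integral_congr_ae ?_
    filter_upwards [hVW] with x hx
    rw [hx]
  obtain ⟨A, hA0, hA⟩ := sphInt_eq_zero_of_large hφc
  obtain ⟨B, hB⟩ := hwc.isCompact.isBounded.subset_closedBall (0 : ℝ)
  have hw0' : ∀ r, |B| + 1 ≤ r → w r = 0 := fun r hr =>
    image_eq_zero_of_notMem_tsupport fun h => by
      have := hB h
      rw [mem_closedBall_zero_iff, Real.norm_eq_abs] at this
      linarith [le_abs_self B, le_abs_self r]
  have e4 := integral_triangle_swap (a := fun r => r * sphInt φ r) (b := fun r => r * w r)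
    (continuous_id.mul (continuous_sphInt hφ)) (by fun_prop) (A := A) (B := |B| + 1)
    (fun r hr => by rw [hA r hr, mul_zero])
    (fun r hr => by rw [hw0' r hr, mul_zero]) ht
  rw [e1, e2, e3]
  have e5 : ∫ r in Ioi (0 : ℝ), (r ^ 2 * sphInt φ r) • W r = 2 * Real.pi / t *
      ∫ r in Ioi (0 : ℝ), r * sphInt φ r * ∫ ρ in |r - t|..(r + t), ρ * w ρ := by
    rw [← integral_const_mul]
    refine setIntegral_congr_fun measurableSet_Ioi fun r hr => ?_
    have : (0:ℝ) < r := hr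
    simp only [W, smul_eq_mul]
    field_simp
  rw [e5, e4, ← integral_const_mul]
  refine integral_congr_ae (Eventually.of_forall fun r => ?_)
  simp only
  ring

/-- Both sides are continuous in `r > 0`, and `dblInt_test` shows that they agree when integrated
against any smooth weight supported in `(0, ∞)`. -/
lemma mul_dblInt {φ : E3 → ℝ} (hφ : Continuous φ) (hφc : HasCompactSupport φ)
    {t r : ℝ} (ht : 0 < t) (hr : 0 < r) :
    r * t * dblInt φ r t = 2 * Real.pi * ∫ ρ in |r - t|..(r + t), ρ * sphInt φ ρ := by
  have hM := continuous_sphInt hφ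
  have hM' : Continuous fun ρ => ρ * sphInt φ ρ := continuous_id.mul hM
  let P : ℝ → ℝ := fun r => ∫ ρ in (0:ℝ)..r, ρ * sphInt φ ρ
  have hP : Continuous P := intervalIntegral.continuous_primitive
    (fun a b => hM'.intervalIntegrable a b) 0
  have hPe : ∀ a b, ∫ ρ in a..b, ρ * sphInt φ ρ = P b - P a := fun a b =>
    (intervalIntegral.integral_interval_sub_left (hM'.intervalIntegrable _ _)
      (hM'.intervalIntegrable _ _)).symm
  let f : ℝ → ℝ := fun r => r ^ 2 * dblInt φ r t - 2 * Real.pi * r / t * (P (r + t) - P |r - t|)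
  have hf : Continuous f := by
    have := continuous_dblInt hφ t
    fun_prop
  have hz : ∀ᵐ r, r ∈ Ioi (0 : ℝ) → f r = 0 := by
    refine isOpen_Ioi.ae_eq_zero_of_integral_contDiff_smul_eq_zero
      (hf.locallyIntegrable.locallyIntegrableOn _) fun w hw hwc hws => ?_
    have h := dblInt_test hφ hφc ht hw.continuous hwc
    have hint : ∀ g : ℝ → ℝ, Continuous g → IntegrableOn (fun r => w r * g r) (Ioi 0) := fun g hg =>
      ((hw.continuous.mul hg).integrable_of_hasCompactSupport hwc.mul_right).integrableOn
    have h0 : ∫ r, w r • f r = ∫ r in Ioi (0 : ℝ), w r • f r := by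
      refine (setIntegral_eq_integral_of_forall_compl_eq_zero fun r hr => ?_).symm
      rw [image_eq_zero_of_notMem_tsupport (fun h => hr (hws h)), zero_smul]
    rw [h0]
    have h1 : ∀ r, w r • f r = w r * (r ^ 2 * dblInt φ r t) -
      w r * (2 * Real.pi * r / t * (P (r + t) - P |r - t|)) := fun r => by
        simp only [f, smul_eq_mul]; ring
    simp only [h1]
    rw [integral_sub (hint _ (by have := continuous_dblInt hφ t; fun_prop))
      (hint _ (by fun_prop)), sub_eq_zero]
    simp only [hPe] at h
    rw [← h]
    refine integral_congr_ae (Eventually.of_forall fun r => ?_)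
    simp only; ring
  have h2 : EqOn f 0 (Ioi 0) := by
    refine Measure.eqOn_open_of_ae_eq (μ := volume) ?_ isOpen_Ioi hf.continuousOn continuousOn_const
    exact (ae_restrict_iff' measurableSet_Ioi).2 hz
  have h3 := h2 (show r ∈ Ioi (0:ℝ) from hr)
  simp only [f, Pi.zero_apply, sub_eq_zero] at h3
  rw [hPe]
  have : r * t * dblInt φ r t = t / r * (r ^ 2 * dblInt φ r t) := by field_simp
  rw [this, h3]; field_simp

/-- The derivative of `dblInt` along the direction `(1, 1)`. -/
lemma dblInt_deriv {φ : E3 → ℝ} (hφ : ContDiff ℝ 1 φ) (hφc : HasCompactSupport φ)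
    {t r : ℝ} (ht : 0 < t) (hr : 0 < r) :
    (r + t) * dblInt φ r t + r * t * ∫ p : Metric.sphere (0 : E3) 1 × Metric.sphere (0 : E3) 1,
      fderiv ℝ φ (r • (p.1 : E3) + t • (p.2 : E3)) ((p.1 : E3) + p.2) ∂(sph.prod sph)
    = 4 * Real.pi * ((r + t) * sphInt φ (r + t)) := by
  have hφ0 := hφ.continuous
  have hM' : Continuous fun ρ => ρ * sphInt φ ρ := continuous_id.mul (continuous_sphInt hφ0)
  have hfd : Continuous (fderiv ℝ φ) := hφ.continuous_fderiv one_ne_zero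
  have hdd : Differentiable ℝ φ := hφ.differentiable one_ne_zero
  have h1 : HasDerivAt (fun s => dblInt φ (r + s) (t + s))
      (∫ p : Metric.sphere (0 : E3) 1 × Metric.sphere (0 : E3) 1,
        fderiv ℝ φ ((r + 0) • (p.1 : E3) + (t + 0) • (p.2 : E3)) ((p.1 : E3) + p.2)
          ∂(sph.prod sph)) 0 := by
    refine hasDerivAt_integral_compact
      (f := fun s (p : Metric.sphere (0 : E3) 1 × Metric.sphere (0 : E3) 1) =>
        φ ((r + s) • (p.1 : E3) + (t + s) • (p.2 : E3)))
      (f' := fun s (p : Metric.sphere (0 : E3) 1 × Metric.sphere (0 : E3) 1) =>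
        fderiv ℝ φ ((r + s) • (p.1 : E3) + (t + s) • (p.2 : E3)) ((p.1 : E3) + p.2))
      (fun s => by fun_prop) (by unfold Function.uncurry; fun_prop) (fun s p => ?_) 0
    have hl : HasDerivAt (fun s : ℝ => (r + s) • (p.1 : E3) + (t + s) • (p.2 : E3))
        ((p.1 : E3) + p.2) s := by
      have h1 := ((hasDerivAt_id s).const_add r).smul_const (p.1 : E3)
      have h2 := ((hasDerivAt_id s).const_add t).smul_const (p.2 : E3)
      simpa using! h1.add h2
    exact (hdd _).hasFDerivAt.comp_hasDerivAt s hl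
  have h2 : HasDerivAt (fun s => (r + s) * (t + s)) (r + t) 0 := by
    have := ((hasDerivAt_id (0:ℝ)).const_add r).mul ((hasDerivAt_id (0:ℝ)).const_add t)
    convert! this using 1
    simp; ring
  have h3 := h2.mul h1
  -- Along the direction `(1, 1)` the difference `r - t` does not change. The lower endpoint stays
  -- fixed, the upper one moves with speed `2`, and only the outgoing value at `r + t` survives.
  have h4 : HasDerivAt (fun s => 2 * Real.pi * ∫ ρ in |r - t|..(r + s + (t + s)), ρ * sphInt φ ρ)
      (2 * Real.pi * ((r + t) * sphInt φ (r + t) * 2)) 0 := by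
    refine HasDerivAt.const_mul _ ?_
    have hl : HasDerivAt (fun s : ℝ => r + s + (t + s)) 2 0 := by
      have := ((hasDerivAt_id (0:ℝ)).const_add r).add ((hasDerivAt_id (0:ℝ)).const_add t)
      convert! this using 1
      norm_num
    have h5 := intervalIntegral.integral_hasDerivAt_right
      (hM'.intervalIntegrable |r - t| (r + t)) (hM'.stronglyMeasurableAtFilter _ _) hM'.continuousAt
    have h6 : HasDerivAt (fun u => ∫ ρ in |r - t|..u, ρ * sphInt φ ρ)
      ((r + t) * sphInt φ (r + t)) (r + 0 + (t + 0)) := by simpa using h5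
    exact h6.comp 0 hl
  have h5 : (fun s => (r + s) * (t + s) * dblInt φ (r + s) (t + s)) =ᶠ[𝓝 0]
      fun s => 2 * Real.pi * ∫ ρ in |r - t|..(r + s + (t + s)), ρ * sphInt φ ρ := by
    have hp : ∀ᶠ s in 𝓝 (0:ℝ), -r < s ∧ -t < s :=
      (lt_mem_nhds (by linarith)).and (lt_mem_nhds (by linarith))
    filter_upwards [hp] with s hs
    rw [mul_dblInt hφ0 hφc (by linarith [hs.2]) (by linarith [hs.1])]
    congr 3
    ring
  have h6 := (h4.congr_of_eventuallyEq h5).unique h3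
  simp only [add_zero] at h6
  linarith

end double

/-! ### The outgoing flow on spherical means -/

section kirchhoff

lemma sph_real_univ : sph.real univ = 4 * Real.pi := by
  rw [measureReal_def, sph_univ, ENNReal.toReal_ofReal (by positivity)]

lemma sph_average (g : Metric.sphere (0 : E3) 1 → ℝ) :
    ⨍ ω, g ω ∂sph = (4 * Real.pi)⁻¹ * ∫ ω, g ω ∂sph := by
  rw [average_eq, sph_real_univ, smul_eq_mul]

lemma fderiv_waveSinFun (t : ℝ) (φ : TestFn) (x v : E3) :
    fderiv ℝ (waveSinFun t φ) x v = t * ((4 * Real.pi)⁻¹ *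
      ∫ η : Metric.sphere (0 : E3) 1, fderiv ℝ φ (x + t • (η : E3)) v ∂sph) := by
  have hφ : ContDiff ℝ 1 φ := φ.contDiff.of_le (by simp)
  have hfd : Continuous (fderiv ℝ φ) := hφ.continuous_fderiv one_ne_zero
  have hdd : Differentiable ℝ φ := hφ.differentiable one_ne_zero
  have h1 : HasDerivAt (fun s : ℝ => waveSinFun t φ (x + s • v))
      (fderiv ℝ (waveSinFun t φ) x v) 0 := by
    have hd : DifferentiableAt ℝ (waveSinFun t φ) (x + (0:ℝ) • v) :=
      ((contDiff_waveSinFun t φ).differentiable (by simp)) _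
    have hl : HasDerivAt (fun s : ℝ => x + s • v) v 0 := by
      simpa using ((hasDerivAt_id (0:ℝ)).smul_const v).const_add x
    have := hd.hasFDerivAt.comp_hasDerivAt (0:ℝ) hl
    simpa using! this
  refine h1.unique ?_
  simp only [waveSinFun, sph_average]
  refine HasDerivAt.const_mul _ (HasDerivAt.const_mul _ ?_)
  have := hasDerivAt_integral_compact (μ := sph)
      (f := fun s (η : Metric.sphere (0 : E3) 1) => φ (x + s • v + t • (η : E3)))
      (f' := fun s (η : Metric.sphere (0 : E3) 1) => fderiv ℝ φ (x + s • v + t • (η : E3)) v)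
      (fun s => by fun_prop) (by unfold Function.uncurry; fun_prop) (fun s η => ?_) 0
  · simpa using this
  · have hl : HasDerivAt (fun s : ℝ => x + s • v + t • (η : E3)) v s := by
      simpa using (((hasDerivAt_id s).smul_const v).const_add x).add_const (t • (η : E3))
    exact (hdd _).hasFDerivAt.comp_hasDerivAt s hl

lemma integrable_sph_prod {f : Metric.sphere (0 : E3) 1 × Metric.sphere (0 : E3) 1 → ℝ}
    (hf : Continuous f) : Integrable f (sph.prod sph) :=
  hf.integrable_of_hasCompactSupport (HasCompactSupport.of_compactSpace _)

lemma integrable_sph {f : Metric.sphere (0 : E3) 1 → ℝ}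
    (hf : Continuous f) : Integrable f sph :=
  hf.integrable_of_hasCompactSupport (HasCompactSupport.of_compactSpace _)

/-- The adjoint of the outgoing linear flow on spherical means. -/
lemma kirchhoff_outgoing (φ : TestFn) {t r : ℝ} (ht : 0 ≤ t) (hr : 0 < r) :
    r ^ 2 * sphInt (waveCosFun t φ) r +
      r * sphInt (fun x => fderiv ℝ (waveSinFun t φ) x x + waveSinFun t φ x) r
      = r * ((r + t) * sphInt φ (r + t)) := by
  have hφ : ContDiff ℝ 1 φ := φ.contDiff.of_le (by simp)
  have hφ0 := hφ.continuous
  have hfd : Continuous (fderiv ℝ φ) := hφ.continuous_fderiv one_ne_zero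
  have hpi : (4 * Real.pi) ≠ 0 := by positivity
  -- Time zero is separate because `dblInt_deriv` is available only for `t > 0`.
  rcases ht.eq_or_lt with rfl | ht
  · have h1 : sphInt (waveCosFun 0 φ) r = sphInt φ r := by
      refine integral_congr_ae (Eventually.of_forall fun ω => ?_)
      simp only [waveCosFun, zero_smul, add_zero, zero_mul]
      rw [sph_average, integral_const, sph_real_univ, smul_eq_mul]
      field_simp
    have h2 : sphInt (fun x => fderiv ℝ (waveSinFun 0 φ) x x + waveSinFun 0 φ x) r = 0 := by
      refine integral_eq_zero_of_ae (Eventually.of_forall fun ω => ?_)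
      simp only [fderiv_waveSinFun, waveSinFun, zero_mul, add_zero, Pi.zero_apply]
    rw [h1, h2]; simp; ring
  have hprod : ∀ f : Metric.sphere (0 : E3) 1 × Metric.sphere (0 : E3) 1 → ℝ, Continuous f →
      ∫ p, f p ∂(sph.prod sph) = ∫ ω, ∫ η, f (ω, η) ∂sph ∂sph := fun f hf =>
    integral_prod _ (integrable_sph_prod hf)
  -- `D1` and `D2` are the derivatives of the double mean in `r` and in `t`. The radial derivative
  -- of the sine part contributes `D1`, the cosine part contributes `D2`, and together they form the
  -- derivative along `(1, 1)`.
  let D1 := ∫ p : Metric.sphere (0 : E3) 1 × Metric.sphere (0 : E3) 1,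
      fderiv ℝ φ (r • (p.1 : E3) + t • (p.2 : E3)) (p.1 : E3) ∂(sph.prod sph)
  let D2 := ∫ p : Metric.sphere (0 : E3) 1 × Metric.sphere (0 : E3) 1,
      fderiv ℝ φ (r • (p.1 : E3) + t • (p.2 : E3)) (p.2 : E3) ∂(sph.prod sph)
  have key := dblInt_deriv hφ φ.hasCompactSupport ht hr
  have hD : ∫ p : Metric.sphere (0 : E3) 1 × Metric.sphere (0 : E3) 1,
      fderiv ℝ φ (r • (p.1 : E3) + t • (p.2 : E3)) ((p.1 : E3) + p.2) ∂(sph.prod sph)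
      = D1 + D2 := by
    simp only [map_add, D1, D2]
    exact integral_add (integrable_sph_prod (by fun_prop)) (integrable_sph_prod (by fun_prop))
  rw [hD] at key
  have e1 : sphInt (waveCosFun t φ) r = (4 * Real.pi)⁻¹ * (dblInt φ r t + t * D2) := by
    have : t * D2 = ∫ p : Metric.sphere (0 : E3) 1 × Metric.sphere (0 : E3) 1,
      t * fderiv ℝ φ (r • (p.1 : E3) + t • (p.2 : E3)) (p.2 : E3) ∂(sph.prod sph) :=
      (integral_const_mul _ _).symm
    rw [this]
    unfold dblInt
    rw [← integral_add (integrable_sph_prod (by fun_prop)) (integrable_sph_prod (by fun_prop)),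
      hprod _ (by fun_prop), ← integral_const_mul]
    refine integral_congr_ae (Eventually.of_forall fun ω => ?_)
    simp only [waveCosFun, sph_average]
  have e2 : sphInt (fun x => fderiv ℝ (waveSinFun t φ) x x + waveSinFun t φ x) r
      = (4 * Real.pi)⁻¹ * (t * r * D1 + t * dblInt φ r t) := by
    have h1 : t * r * D1 = ∫ p : Metric.sphere (0 : E3) 1 × Metric.sphere (0 : E3) 1,
      t * r * fderiv ℝ φ (r • (p.1 : E3) + t • (p.2 : E3)) (p.1 : E3) ∂(sph.prod sph) :=
      (integral_const_mul _ _).symm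
    have h2 : t * dblInt φ r t = ∫ p : Metric.sphere (0 : E3) 1 × Metric.sphere (0 : E3) 1,
      t * φ (r • (p.1 : E3) + t • (p.2 : E3)) ∂(sph.prod sph) :=
      (integral_const_mul _ _).symm
    rw [h1, h2, ← integral_add (integrable_sph_prod (by fun_prop))
      (integrable_sph_prod (by fun_prop)), hprod _ (by fun_prop), ← integral_const_mul]
    refine integral_congr_ae (Eventually.of_forall fun ω => ?_)
    simp only [fderiv_waveSinFun]
    simp only [waveSinFun, sph_average, map_smul, smul_eq_mul]
    rw [integral_add (integrable_sph (by fun_prop)) (integrable_sph (by fun_prop)),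
      integral_const_mul, integral_const_mul, integral_const_mul]
    ring
  rw [e1, e2]
  have : r ^ 2 * ((4 * Real.pi)⁻¹ * (dblInt φ r t + t * D2)) +
      r * ((4 * Real.pi)⁻¹ * (t * r * D1 + t * dblInt φ r t)) =
      r * ((4 * Real.pi)⁻¹ * ((r + t) * dblInt φ r t + r * t * (D1 + D2))) := by ring
  rw [this, key]
  field_simp

end kirchhoff
end OutgoingWave
end

/-! ### Outgoing data are translated by the linear flow -/

noncomputable section

namespace OutgoingWave

variable {𝕜 : Type*} [RCLike 𝕜]

/-- The profile at time `t` of the outgoing linear wave with initial profile `w`. -/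
def outShift (t : ℝ) (w : ℝ → 𝕜) (r : ℝ) : 𝕜 :=
  if t < r then r⁻¹ • ((r - t) • w (r - t)) else 0

lemma integral_Ioi_shift {F : Type*} [NormedAddCommGroup F] [NormedSpace ℝ F] (f : ℝ → F) (t : ℝ) :
    ∫ r in Ioi t, f r = ∫ q in Ioi (0 : ℝ), f (q + t) := by
  rw [← integral_indicator measurableSet_Ioi, ← integral_indicator measurableSet_Ioi,
    ← integral_add_right_eq_self _ t]
  refine integral_congr_ae (Eventually.of_forall fun q => ?_)
  simp [indicator]

lemma intervalIntegrable_shift {k : ℝ → 𝕜}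
    (hk : ∀ M : ℝ, 0 < M → IntervalIntegrable k volume 0 M) {t : ℝ} (ht : 0 ≤ t)
    (M : ℝ) (hM : 0 < M) :
    IntervalIntegrable (fun r => if t < r then k (r - t) else 0) volume 0 M := by
  have h1 : IntegrableOn k (Ioc 0 M) := (hk M hM).1
  have h2 : Integrable ((Ioc 0 M).indicator k) := h1.integrable_indicator measurableSet_Ioc
  have h3 := h2.comp_sub_right t
  rw [intervalIntegrable_iff_integrableOn_Ioc_of_le hM.le]
  refine h3.integrableOn.congr_fun (fun r hr => ?_) measurableSet_Ioc
  simp only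
  by_cases h : t < r
  · rw [if_pos h, indicator_of_mem (show r - t ∈ Ioc 0 M from ⟨by linarith, by linarith [hr.2]⟩)]
  · rw [if_neg h, indicator_of_notMem]
    exact fun h' => h (by linarith [h'.1])

lemma intervalIntegrable_mul_outShift {w : ℝ → 𝕜}
    (hw : ∀ M : ℝ, 0 < M → IntervalIntegrable (fun ρ => ρ • w ρ) volume 0 M) {t : ℝ} (ht : 0 ≤ t)
    (M : ℝ) (hM : 0 < M) :
    IntervalIntegrable (fun r => r • outShift t w r) volume 0 M := by
  refine (intervalIntegrable_shift hw ht M hM).congr fun r hr => ?_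
  rw [uIoc_of_le hM.le] at hr
  simp only [outShift]
  split_ifs with h
  · rw [smul_inv_smul₀ hr.1.ne']
  · rw [smul_zero]

lemma locallyIntegrable_rad_inv {w : ℝ → 𝕜}
    (hw : ∀ M : ℝ, 0 < M → IntervalIntegrable (fun ρ => ρ • w ρ) volume 0 M) :
    LocallyIntegrable (rad fun r => r⁻¹ • w r) (volume : Measure E3) := by
  refine locallyIntegrable_rad fun M hM => (hw M hM).congr fun r hr => ?_
  rw [uIoc_of_le hM.le] at hr
  rw [smul_smul, sq, mul_assoc, mul_inv_cancel₀ hr.1.ne', mul_one]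

/-- `∂_r(rψ)` as a function on `ℝ³`. -/
def radialDeriv (ψ : E3 → ℝ) (x : E3) : ℝ := fderiv ℝ ψ x x + ψ x

lemma continuous_radialDeriv (ψ : TestFn) : Continuous (radialDeriv ψ) := by
  have hφ : ContDiff ℝ 1 ψ := ψ.contDiff.of_le (by simp)
  have hfd : Continuous (fderiv ℝ ψ) := hφ.continuous_fderiv one_ne_zero
  unfold radialDeriv
  fun_prop

lemma hasCompactSupport_radialDeriv (ψ : TestFn) : HasCompactSupport (radialDeriv ψ) := by
  refine HasCompactSupport.intro ψ.hasCompactSupport.isCompact fun x hx => ?_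
  have h1 : fderiv ℝ ψ x = 0 :=
    image_eq_zero_of_notMem_tsupport (fun h => hx (tsupport_fderiv_subset ℝ h))
  simp [radialDeriv, h1, image_eq_zero_of_notMem_tsupport hx]

lemma integral_radial_transpose {w : ℝ → 𝕜}
    (hw : ∀ M : ℝ, 0 < M → IntervalIntegrable (fun ρ => ρ • w ρ) volume 0 M) (ψ : TestFn) :
    IntegrableOn (fun r => (r * sphInt (radialDeriv ψ) r) • w r) (Ioi (0 : ℝ)) ∧
    ∫ x : E3, (fderiv ℝ ψ x (‖x‖⁻¹ • x) + ‖x‖⁻¹ * ψ x) • rad w x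
      = ∫ r in Ioi (0 : ℝ), (r * sphInt (radialDeriv ψ) r) • w r := by
  have hl := locallyIntegrable_rad_inv hw
  have hc := continuous_radialDeriv ψ
  have hs := hasCompactSupport_radialDeriv ψ
  have heq : EqOn (fun r => (r ^ 2 * sphInt (radialDeriv ψ) r) • (r⁻¹ • w r))
      (fun r => (r * sphInt (radialDeriv ψ) r) • w r) (Ioi 0) := by
    intro r hr
    have : (0:ℝ) < r := hr
    simp only [smul_smul]
    congr 1
    field_simp
  refine ⟨(integrableOn_mul_rad hl hc hs).congr_fun heq measurableSet_Ioi, ?_⟩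
  rw [← setIntegral_congr_fun measurableSet_Ioi heq, ← integral_mul_rad hl hc hs]
  refine integral_congr_ae (Eventually.of_forall fun x => ?_)
  simp only [rad, radialDeriv, map_smul, smul_eq_mul, smul_smul]
  congr 1
  ring

/-- Outgoing data are translated by the linear flow. -/
lemma Phi0_outgoing {w : ℝ → 𝕜}
    (hw : ∀ M : ℝ, 0 < M → IntervalIntegrable (fun ρ => ρ • w ρ) volume 0 M) {w₁ : TestFn → 𝕜}
    (hw₁ : ∀ ψ : TestFn, w₁ ψ =
      ∫ x : E3, (fderiv ℝ ψ x (‖x‖⁻¹ • x) + ‖x‖⁻¹ * ψ x) • rad w x) {t : ℝ} (ht : 0 ≤ t)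
    (φ : TestFn) :
    Phi0 t (radFunctional w) w₁ φ = radFunctional (outShift t w) φ := by
  have hl := locallyIntegrable_rad_of_mul hw
  have hl' := locallyIntegrable_rad_of_mul (intervalIntegrable_mul_outShift hw ht)
  have hcos : Continuous (waveCosFun t φ) := (contDiff_waveCosFun t φ).continuous
  have hcoss : HasCompactSupport (waveCosFun t φ) := (waveCos t φ).hasCompactSupport
  have h1 := integral_mul_rad hl hcos hcoss
  have h2 := integral_radial_transpose hw (waveSin t φ)
  have h3 := integral_mul_rad hl' φ.contDiff.continuous φ.hasCompactSupport
  unfold Phi0 radFunctional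
  rw [hw₁, h2.2, h3]
  have h1' : ∫ x, (waveCos t φ) x • rad w x = ∫ x, waveCosFun t φ x • rad w x := rfl
  rw [h1', h1, ← integral_add (integrableOn_mul_rad hl hcos hcoss) h2.1]
  have h4 : ∫ r in Ioi (0 : ℝ), (r ^ 2 * sphInt φ r) • outShift t w r =
      ∫ r in Ioi t, (r * sphInt φ r) • ((r - t) • w (r - t)) := by
    rw [← integral_indicator measurableSet_Ioi, ← integral_indicator measurableSet_Ioi]
    refine integral_congr_ae (Eventually.of_forall fun r => ?_)
    simp only [indicator, mem_Ioi, outShift]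
    by_cases h : t < r
    · have : 0 < r := ht.trans_lt h
      rw [if_pos h, if_pos h, if_pos this]
      simp only [smul_smul]
      congr 1
      field_simp
    · simp [h]
  -- After shifting by `t`, both sides integrate the same profile `w` over the half line, so it
  -- suffices to match the weights; this is `kirchhoff_outgoing`.
  rw [h4, integral_Ioi_shift _ t]
  refine setIntegral_congr_fun measurableSet_Ioi fun r hr => ?_
  simp only [add_sub_cancel_right]
  rw [← add_smul, smul_smul]
  congr 1
  have := kirchhoff_outgoing φ ht hr
  change r ^ 2 * sphInt (waveCosFun t φ) r +
      r * sphInt (fun x => fderiv ℝ (waveSinFun t φ) x x + waveSinFun t φ x) r = _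
  rw [this]; ring

/-- Integration by parts against a primitive of an integrable function. -/
lemma integral_deriv_smul_primitive {B b : ℝ → ℝ} {A : ℝ}
    (hB : ∀ r, HasDerivAt B (b r) r) (hb : Continuous b) (hB0 : ∀ r, A ≤ r → B r = 0)
    (hb0 : ∀ r, A ≤ r → b r = 0)
    {k : ℝ → 𝕜} (hk : IntegrableOn k (Ioc 0 A)) :
    ∫ r in Ioi (0 : ℝ), b r • ∫ ρ in Ioc 0 r, k ρ = -∫ r in Ioi (0 : ℝ), B r • k r := by
  have hcut : ∀ (c : ℝ → ℝ) (g : ℝ → 𝕜), (∀ r, A ≤ r → c r = 0) →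
      ∫ r in Ioi (0 : ℝ), c r • g r = ∫ r in Ioc 0 A, c r • g r := by
    intro c g hc
    refine (setIntegral_eq_of_subset_of_forall_sdiff_eq_zero measurableSet_Ioi
      Ioc_subset_Ioi_self fun r hr => ?_)
    rw [hc r, zero_smul]
    by_contra h
    exact hr.2 ⟨hr.1, (not_le.1 h).le⟩
  rw [hcut _ _ hb0, hcut _ _ hB0]
  have hE : MeasurableSet {p : ℝ × ℝ | p.2 ≤ p.1} := measurableSet_le measurable_snd measurable_fst
  have e1 : ∫ r in Ioc 0 A, b r • ∫ ρ in Ioc 0 r, k ρ =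
      ∫ r in Ioc 0 A, ∫ ρ in Ioc 0 A, (if ρ ≤ r then b r • k ρ else 0) := by
    refine setIntegral_congr_fun measurableSet_Ioc fun r hr => ?_
    rw [← integral_smul, ← integral_indicator measurableSet_Ioc,
      ← integral_indicator measurableSet_Ioc]
    refine integral_congr_ae (Eventually.of_forall fun ρ => ?_)
    simp only [indicator, mem_Ioc]
    by_cases h1 : ρ ≤ r
    · have := h1.trans hr.2
      simp [h1, this]
    · simp [h1]
  -- Fubini on the triangle `ρ ≤ r ≤ A`: the integral of `b` over `[ρ, A]` is `-B ρ` because `B A =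
  -- 0`. Only `B` is differentiated, so `k` may be merely integrable.
  rw [e1, integral_integral_swap, ← integral_neg]
  · refine setIntegral_congr_fun measurableSet_Ioc fun ρ hρ => ?_
    have e2 : ∀ r, (if ρ ≤ r then b r • k ρ else 0) = (Ici ρ).indicator b r • k ρ := by
      intro r
      by_cases h : ρ ≤ r <;> simp [h]
    simp only [e2]
    rw [integral_smul_const, integral_indicator measurableSet_Ici,
      Measure.restrict_restrict measurableSet_Ici]
    have e3 : Ici ρ ∩ Ioc 0 A = Icc ρ A := by
      ext r; simp only [mem_inter_iff, mem_Ici, mem_Ioc, mem_Icc]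
      exact ⟨fun h => ⟨h.1, h.2.2⟩, fun h => ⟨h.1, hρ.1.trans_le h.1, h.2⟩⟩
    rw [e3, integral_Icc_eq_integral_Ioc, ← intervalIntegral.integral_of_le hρ.2,
      intervalIntegral.integral_eq_sub_of_hasDerivAt (fun r _ => hB r) (hb.intervalIntegrable _ _),
      hB0 A le_rfl, zero_sub, neg_smul]
  · have := ((hb.integrableOn_Ioc (μ := volume) (a := 0) (b := A)).smul_prod hk).indicator hE
    refine this.congr (Eventually.of_forall fun p => ?_)
    simp [Function.uncurry, indicator]

lemma hasDerivAt_mul_sphInt (φ : TestFn) (r : ℝ) :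
    HasDerivAt (fun r => r * sphInt φ r) (sphInt (radialDeriv φ) r) r := by
  have hφ : ContDiff ℝ 1 φ := φ.contDiff.of_le (by simp)
  have hφ0 := hφ.continuous
  have hfd : Continuous (fderiv ℝ φ) := hφ.continuous_fderiv one_ne_zero
  have hdd : Differentiable ℝ φ := hφ.differentiable one_ne_zero
  have h1 : HasDerivAt (sphInt φ)
      (∫ ω : Metric.sphere (0 : E3) 1, fderiv ℝ φ (r • (ω : E3)) (ω : E3) ∂sph) r := by
    refine hasDerivAt_integral_compact
      (f := fun s (η : Metric.sphere (0 : E3) 1) => φ (s • (η : E3)))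
      (f' := fun s (η : Metric.sphere (0 : E3) 1) => fderiv ℝ φ (s • (η : E3)) η)
      (fun s => by fun_prop) (by unfold Function.uncurry; fun_prop) (fun s η => ?_) r
    have hl : HasDerivAt (fun s : ℝ => s • (η : E3)) (η : E3) s := by
      simpa using! (hasDerivAt_id s).smul_const (η : E3)
    exact (hdd _).hasFDerivAt.comp_hasDerivAt s hl
  have h2 := (hasDerivAt_id r).mul h1
  convert! h2 using 1
  simp only [sphInt, radialDeriv, map_smul, smul_eq_mul, id]
  rw [integral_add (integrable_sph (by fun_prop)) (integrable_sph (by fun_prop)),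
    integral_const_mul]
  ring

section force

lemma force0_eq (N : ℝ) (f : ℝ → 𝕜) (r : ℝ) :
    force0 N f r = -((2⁻¹ * r⁻¹ : ℝ) • ∫ ρ in (0 : ℝ)..r, ρ • nonlin N f ρ) := by
  simp [force0, P0plus, radialAvg, smul_smul]

lemma force1_eq (N : ℝ) (f : ℝ → 𝕜) (r : ℝ) : force1 N f r = (2⁻¹ : ℝ) • nonlin N f r := by
  simp [force1, P1plus]

lemma intervalIntegrable_force0 {N : ℝ} {f : ℝ → 𝕜}
    (hf : ∀ M : ℝ, 0 < M → IntervalIntegrable (fun ρ => ρ • nonlin N f ρ) volume 0 M)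
    (M : ℝ) (hM : 0 < M) :
    IntervalIntegrable (fun ρ => ρ • force0 N f ρ) volume 0 M := by
  have h1 : ContinuousOn (fun r => -((2⁻¹ : ℝ) • ∫ ρ in (0 : ℝ)..r, ρ • nonlin N f ρ)) (uIcc 0 M) :=
    ((intervalIntegral.continuousOn_primitive_interval ((intervalIntegrable_iff' (by simp)).1 (hf M hM))).const_smul _).neg
  refine h1.intervalIntegrable.congr fun r hr => ?_
  rw [uIoc_of_le hM.le] at hr
  simp only [force0_eq, smul_neg, smul_smul]
  congr 2
  have := hr.1.ne'
  field_simp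

/-- The forcing term is outgoing. -/
lemma radFunctional_force1 {N : ℝ} {f : ℝ → 𝕜}
    (hf : ∀ M : ℝ, 0 < M → IntervalIntegrable (fun ρ => ρ • nonlin N f ρ) volume 0 M)
    (ψ : TestFn) :
    radFunctional (force1 N f) ψ =
      ∫ x : E3, (fderiv ℝ ψ x (‖x‖⁻¹ • x) + ‖x‖⁻¹ * ψ x) • rad (force0 N f) x := by
  rw [(integral_radial_transpose (intervalIntegrable_force0 hf) ψ).2]
  have hl : LocallyIntegrable (rad (force1 N f)) (volume : Measure E3) := by
    refine locallyIntegrable_rad_of_mul fun M hM => ?_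
    simp only [force1_eq]
    have := (hf M hM).smul (2⁻¹ : ℝ)
    refine this.congr fun r _ => ?_
    simp only [Pi.smul_apply]
    rw [smul_comm]
  have h1 := integral_mul_rad hl ψ.contDiff.continuous ψ.hasCompactSupport
  unfold radFunctional
  rw [h1]
  obtain ⟨A, hA0, hA⟩ := sphInt_eq_zero_of_large ψ.hasCompactSupport
  obtain ⟨A', hA0', hA'⟩ := sphInt_eq_zero_of_large (hasCompactSupport_radialDeriv ψ)
  have key := integral_deriv_smul_primitive (A := max A A')
    (hasDerivAt_mul_sphInt ψ) (continuous_sphInt (continuous_radialDeriv ψ))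
    (fun r hr => by rw [hA r ((le_max_left _ _).trans hr), mul_zero])
    (fun r hr => hA' r ((le_max_right _ _).trans hr)) (hf _ (lt_max_of_lt_left hA0)).1
  have e1 : ∫ r in Ioi (0 : ℝ), (r ^ 2 * sphInt ψ r) • force1 N f r =
      (2⁻¹ : ℝ) • ∫ r in Ioi (0 : ℝ), (r * sphInt ψ r) • (r • nonlin N f r) := by
    rw [← integral_smul]
    refine integral_congr_ae (Eventually.of_forall fun r => ?_)
    simp only [force1_eq, smul_smul]
    congr 1; ring
  have e2 : ∫ r in Ioi (0 : ℝ), (r * sphInt (radialDeriv ψ) r) • force0 N f r =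
      -((2⁻¹ : ℝ) • ∫ r in Ioi (0 : ℝ), sphInt (radialDeriv ψ) r •
        ∫ ρ in Ioc 0 r, ρ • nonlin N f ρ) := by
    rw [← integral_smul, ← integral_neg]
    refine setIntegral_congr_fun measurableSet_Ioi fun r hr => ?_
    have hr' : (0:ℝ) < r := hr
    simp only [force0_eq, smul_neg, smul_smul, intervalIntegral.integral_of_le hr'.le]
    congr 2
    field_simp
  rw [e1, e2, key, smul_neg, neg_neg]

lemma Phi0_force {N : ℝ} {f : ℝ → 𝕜}
    (hf : ∀ M : ℝ, 0 < M → IntervalIntegrable (fun ρ => ρ • nonlin N f ρ) volume 0 M)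
    {t : ℝ} (ht : 0 ≤ t) (φ : TestFn) :
    Phi0 t (radFunctional (force0 N f)) (radFunctional (force1 N f)) φ =
      radFunctional (outShift t (force0 N f)) φ :=
  Phi0_outgoing (intervalIntegrable_force0 hf) (radFunctional_force1 hf) ht φ

lemma Phi0_data {u₀ : ℝ → 𝕜} {u₁ : Distr 𝕜} (h : HasRadialDeriv u₀ (-u₁)) {t : ℝ} (ht : 0 ≤ t)
    (φ : TestFn) :
    Phi0 t (radFunctional u₀) u₁ φ = radFunctional (outShift t u₀) φ := by
  refine Phi0_outgoing h.1 (fun ψ => ?_) ht φ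
  have := h.2 ψ
  have h2 : (-u₁) ψ = -(u₁ ψ) := rfl
  rw [h2] at this
  exact neg_injective this

end force

end OutgoingWave
end

/-! ### The power nonlinearity and Hölder's inequality -/

noncomputable section

namespace OutgoingWave

variable {𝕜 : Type*} [RCLike 𝕜]

/-- The map `z ↦ |z|^N z`. -/
def powMap (N : ℝ) (z : 𝕜) : 𝕜 := (‖z‖ ^ N : ℝ) • z

lemma continuous_powMap {N : ℝ} (hN : 0 ≤ N) : Continuous (powMap N : 𝕜 → 𝕜) := by
  unfold powMap
  exact (continuous_norm.rpow_const fun _ => Or.inr hN).smul continuous_id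

lemma powMap_zero (N : ℝ) : powMap N (0 : 𝕜) = 0 := by simp [powMap]

lemma norm_powMap {N : ℝ} (hN : 0 ≤ N) (z : 𝕜) : ‖powMap N z‖ = ‖z‖ ^ (N + 1) := by
  rw [powMap, norm_smul, Real.norm_eq_abs, abs_of_nonneg (by positivity),
    Real.rpow_add_one' (norm_nonneg _) (by linarith)]

/-- The difference splits as `|a|^N (a - b) + (|a|^N - |b|^N) b`. With `x = |b|/|a| ≤ 1`,
Bernoulli's inequality `1 - x^N ≤ N (1 - x)` bounds the second term by `N |a|^N |a - b|`. -/
lemma norm_powMap_sub_le_aux {N : ℝ} (hN : 1 ≤ N) {a b : 𝕜} (hab : ‖b‖ ≤ ‖a‖) :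
    ‖powMap N a - powMap N b‖ ≤ (N + 1) * ‖a‖ ^ N * ‖a - b‖ := by
  rcases (norm_nonneg a).eq_or_lt with ha | ha
  · have ha' : a = 0 := norm_eq_zero.1 ha.symm
    have hb' : b = 0 := norm_le_zero_iff.1 (by rw [ha]; exact hab)
    simp [ha', hb', powMap]
  have h1 : powMap N a - powMap N b = (‖a‖ ^ N : ℝ) • (a - b) + (‖a‖ ^ N - ‖b‖ ^ N : ℝ) • b := by
    unfold powMap
    rw [smul_sub, sub_smul]; abel
  have hb0 := norm_nonneg b
  have h2 : ‖b‖ ^ N ≤ ‖a‖ ^ N := Real.rpow_le_rpow hb0 hab (by linarith)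
  have hbern := one_add_mul_self_le_rpow_one_add (s := ‖b‖ / ‖a‖ - 1)
    (by have := div_nonneg hb0 ha.le; linarith) hN
  have h3 : (1 + (‖b‖ / ‖a‖ - 1)) ^ N * ‖a‖ ^ N = ‖b‖ ^ N := by
    rw [← Real.mul_rpow (by rw [add_sub_cancel]; positivity) ha.le]
    congr 1; field_simp; ring
  have h4 : ‖a‖ ^ N - ‖b‖ ^ N ≤ N * ‖a‖ ^ N * (1 - ‖b‖ / ‖a‖) := by
    have := mul_le_mul_of_nonneg_right hbern (Real.rpow_nonneg ha.le N)
    rw [h3] at this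
    linarith
  have h5 : (1 - ‖b‖ / ‖a‖) * ‖b‖ ≤ ‖a - b‖ := by
    have h6 : (1 - ‖b‖ / ‖a‖) * ‖b‖ ≤ (1 - ‖b‖ / ‖a‖) * ‖a‖ :=
      mul_le_mul_of_nonneg_left hab (by rw [sub_nonneg]; exact (div_le_one ha).2 hab)
    have h7 : (1 - ‖b‖ / ‖a‖) * ‖a‖ = ‖a‖ - ‖b‖ := by field_simp
    linarith [norm_sub_norm_le a b]
  calc ‖powMap N a - powMap N b‖ ≤ ‖(‖a‖ ^ N : ℝ) • (a - b)‖ + ‖(‖a‖ ^ N - ‖b‖ ^ N : ℝ) • b‖ := by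
        rw [h1]; exact norm_add_le _ _
    _ = ‖a‖ ^ N * ‖a - b‖ + (‖a‖ ^ N - ‖b‖ ^ N) * ‖b‖ := by
        rw [norm_smul, norm_smul, Real.norm_eq_abs, Real.norm_eq_abs,
          abs_of_nonneg (by positivity), abs_of_nonneg (by linarith)]
    _ ≤ ‖a‖ ^ N * ‖a - b‖ + N * ‖a‖ ^ N * (1 - ‖b‖ / ‖a‖) * ‖b‖ := by gcongr
    _ = ‖a‖ ^ N * ‖a - b‖ + N * ‖a‖ ^ N * ((1 - ‖b‖ / ‖a‖) * ‖b‖) := by ring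
    _ ≤ ‖a‖ ^ N * ‖a - b‖ + N * ‖a‖ ^ N * ‖a - b‖ := by gcongr
    _ = _ := by ring

lemma norm_powMap_sub_le {N : ℝ} (hN : 1 ≤ N) (a b : 𝕜) :
    ‖powMap N a - powMap N b‖ ≤ (N + 1) * ((‖a‖ ^ N + ‖b‖ ^ N) * ‖a - b‖) := by
  have h1 : 0 ≤ (N + 1) * (‖a‖ ^ N * ‖a - b‖) := by positivity
  have h2 : 0 ≤ (N + 1) * (‖b‖ ^ N * ‖a - b‖) := by positivity
  rcases le_total ‖b‖ ‖a‖ with h | h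
  · linarith [norm_powMap_sub_le_aux hN h]
  · have := norm_powMap_sub_le_aux hN h
    rw [norm_sub_rev, norm_sub_rev b a] at this
    linarith

section holder

variable {α : Type*} [MeasurableSpace α] {μ : Measure α}

/-- Hölder with the three weights `N/(N+2)`, `1/(N+2)`, `1/(N+2)`; the last factor is the constant
`1` and yields the mass of the measure. -/
lemma lintegral_rpow_mul_le {N : ℝ} (hN : 0 < N) {V W : α → 𝕜} (hV : AEStronglyMeasurable V μ)
    (hW : AEStronglyMeasurable W μ) :
    ∫⁻ x, ‖V x‖ₑ ^ N * ‖W x‖ₑ ∂μ ≤ eLpNorm V (ENNReal.ofReal (N + 2)) μ ^ N *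
      eLpNorm W (ENNReal.ofReal (N + 2)) μ * μ univ ^ (N + 2)⁻¹ := by
  have hp : 0 < N + 2 := by linarith
  have h := ENNReal.lintegral_prod_norm_pow_le (μ := μ) (Finset.univ : Finset (Fin 3))
    (f := ![fun x => ‖V x‖ₑ ^ (N + 2), fun x => ‖W x‖ₑ ^ (N + 2), fun _ => 1])
    (p := ![N / (N + 2), (N + 2)⁻¹, (N + 2)⁻¹]) ?_ ?_ ?_
  · simp only [Fin.prod_univ_three, Matrix.cons_val_zero, Matrix.cons_val_one, Matrix.cons_val,
      ← ENNReal.rpow_mul, ENNReal.one_rpow, mul_one, lintegral_one] at h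
    rw [mul_div_cancel₀ _ hp.ne', mul_inv_cancel₀ hp.ne'] at h
    simp only [ENNReal.rpow_one] at h
    refine h.trans (le_of_eq ?_)
    have hne : ENNReal.ofReal (N + 2) ≠ 0 := by simpa using hp
    rw [eLpNorm_eq_lintegral_rpow_enorm_toReal hne ENNReal.ofReal_ne_top,
      eLpNorm_eq_lintegral_rpow_enorm_toReal hne ENNReal.ofReal_ne_top,
      ENNReal.toReal_ofReal hp.le, ← ENNReal.rpow_mul]
    congr 3
    · ring
    · rw [one_div]
  · intro i _
    fin_cases i
    · exact hV.enorm.pow_const _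
    · exact hW.enorm.pow_const _
    · exact aemeasurable_const
  · simp only [Fin.sum_univ_three, Matrix.cons_val_zero, Matrix.cons_val_one, Matrix.cons_val]
    field_simp
    ring
  · intro i _
    fin_cases i
    · exact div_nonneg hN.le hp.le
    · exact inv_nonneg.2 hp.le
    · exact inv_nonneg.2 hp.le

lemma lintegral_powMap_sub_le {N : ℝ} (hN : 1 ≤ N) {V W : α → 𝕜} (hV : AEStronglyMeasurable V μ)
    (hW : AEStronglyMeasurable W μ) {A B g : ℝ} (hA : 0 ≤ A) (hB : 0 ≤ B)
    (hVA : eLpNorm V (ENNReal.ofReal (N + 2)) μ ≤ ENNReal.ofReal A)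
    (hWA : eLpNorm W (ENNReal.ofReal (N + 2)) μ ≤ ENNReal.ofReal A)
    (hVW : eLpNorm (V - W) (ENNReal.ofReal (N + 2)) μ ≤ ENNReal.ofReal B)
    (hμ : μ univ ^ (N + 2)⁻¹ ≤ ENNReal.ofReal g) :
    ∫⁻ x, ‖powMap N (V x) - powMap N (W x)‖ₑ ∂μ
      ≤ ENNReal.ofReal ((N + 1) * (2 * A ^ N * B * g)) := by
  have hN0 : 0 < N := by linarith
  have h1 : ∀ Z : α → 𝕜, AEStronglyMeasurable Z μ →
      eLpNorm Z (ENNReal.ofReal (N + 2)) μ ≤ ENNReal.ofReal A →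
      ∫⁻ x, ‖Z x‖ₑ ^ N * ‖(V - W) x‖ₑ ∂μ ≤ ENNReal.ofReal (A ^ N * B * g) := by
    intro Z hZ hZA
    refine (lintegral_rpow_mul_le hN0 hZ (hV.sub hW)).trans ?_
    rw [ENNReal.ofReal_mul (by positivity), ENNReal.ofReal_mul (by positivity),
      ← ENNReal.ofReal_rpow_of_nonneg hA hN0.le]
    gcongr
  calc ∫⁻ x, ‖powMap N (V x) - powMap N (W x)‖ₑ ∂μ
      ≤ ∫⁻ x, ENNReal.ofReal (N + 1) *
          (‖V x‖ₑ ^ N * ‖(V - W) x‖ₑ + ‖W x‖ₑ ^ N * ‖(V - W) x‖ₑ) ∂μ := by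
        refine lintegral_mono fun x => ?_
        have := norm_powMap_sub_le hN (V x) (W x)
        rw [← ofReal_norm]
        refine (ENNReal.ofReal_le_ofReal this).trans (le_of_eq ?_)
        rw [ENNReal.ofReal_mul (by linarith), ENNReal.ofReal_mul (by positivity),
          ENNReal.ofReal_add (p := ‖V x‖ ^ N) (by positivity) (by positivity), ← add_mul,
          ← ENNReal.ofReal_rpow_of_nonneg (norm_nonneg _) hN0.le,
          ← ENNReal.ofReal_rpow_of_nonneg (norm_nonneg _) hN0.le]
        simp only [ofReal_norm, Pi.sub_apply]
    _ = ENNReal.ofReal (N + 1) * (∫⁻ x, ‖V x‖ₑ ^ N * ‖(V - W) x‖ₑ ∂μ +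
          ∫⁻ x, ‖W x‖ₑ ^ N * ‖(V - W) x‖ₑ ∂μ) := by
        rw [lintegral_const_mul' _ _ ENNReal.ofReal_ne_top, lintegral_add_left']
        exact (hV.enorm.pow_const _).mul (hV.sub hW).enorm
    _ ≤ ENNReal.ofReal (N + 1) * (ENNReal.ofReal (A ^ N * B * g) + ENNReal.ofReal (A ^ N * B * g)) := by
        gcongr
        · exact h1 V hV hVA
        · exact h1 W hW hWA
    _ = _ := by
        rw [← two_mul, ENNReal.ofReal_mul (p := N + 1) (by linarith)]
        congr 1
        rw [← ENNReal.ofReal_ofNat 2, ← ENNReal.ofReal_mul (by norm_num)]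
        congr 1; ring

end holder

/-! ### The weight `gr` and the time integral `theta` -/

section weights

/-- The measure `(p + s)^{-N} dp` on `(R, ∞)`. -/
def nuMeas (N R s : ℝ) : Measure ℝ :=
  (volume.restrict (Ioi R)).withDensity fun p => ENNReal.ofReal ((p + s) ^ (-N))

/-- The weight `(R + t)^{(N-1)/(N+2)}`. -/
def gr (N R t : ℝ) : ℝ := (R + t) ^ ((N - 1) / (N + 2))

/-- The integral of the square of the inverse weight. -/
def theta (N R t : ℝ) : ℝ := ∫ s in Ioc 0 t, ((gr N R s)⁻¹) ^ 2

lemma gr_pos {N R t : ℝ} (hR : 0 < R) (ht : 0 ≤ t) : 0 < gr N R t :=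
  Real.rpow_pos_of_pos (by linarith) _

lemma gr_mono {N R s t : ℝ} (hN : 2 < N) (hR : 0 < R) (hs : 0 ≤ s) (hst : s ≤ t) :
    gr N R s ≤ gr N R t :=
  Real.rpow_le_rpow (by linarith) (by linarith) (div_nonneg (by linarith) (by linarith))

lemma measurable_gr (N R : ℝ) : Measurable (gr N R) := by
  unfold gr; fun_prop

lemma gr_inv_le {N R s : ℝ} (hN : 2 < N) (hR : 0 < R) (hs : 0 ≤ s) :
    (gr N R s)⁻¹ ≤ (gr N R 0)⁻¹ :=
  inv_anti₀ (gr_pos hR le_rfl) (gr_mono hN hR le_rfl hs)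

lemma integrableOn_gr_inv {N R : ℝ} (hN : 2 < N) (hR : 0 < R) (t : ℝ) :
    IntegrableOn (fun s => (gr N R s)⁻¹) (Ioc 0 t) := by
  refine Measure.integrableOn_of_bounded (M := (gr N R 0)⁻¹) (by simp)
    (measurable_gr N R).inv.aestronglyMeasurable ?_
  filter_upwards [ae_restrict_mem measurableSet_Ioc] with s hs
  rw [Real.norm_eq_abs, abs_of_pos (inv_pos.2 (gr_pos hR hs.1.le))]
  exact gr_inv_le hN hR hs.1.le

lemma integrableOn_gr_inv_sq {N R : ℝ} (hN : 2 < N) (hR : 0 < R) (t : ℝ) :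
    IntegrableOn (fun s => ((gr N R s)⁻¹) ^ 2) (Ioc 0 t) := by
  refine Measure.integrableOn_of_bounded (M := ((gr N R 0)⁻¹) ^ 2) (by simp)
    ((measurable_gr N R).inv.pow_const 2).aestronglyMeasurable ?_
  filter_upwards [ae_restrict_mem measurableSet_Ioc] with s hs
  have := inv_pos.2 (gr_pos (N := N) hR hs.1.le)
  rw [Real.norm_eq_abs, abs_of_pos (by positivity)]
  exact pow_le_pow_left₀ this.le (gr_inv_le hN hR hs.1.le) 2

lemma theta_nonneg (N R t : ℝ) : 0 ≤ theta N R t :=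
  integral_nonneg fun _ => sq_nonneg _

lemma theta_mono {N R s t : ℝ} (hN : 2 < N) (hR : 0 < R) (hst : s ≤ t) :
    theta N R s ≤ theta N R t :=
  setIntegral_mono_set (integrableOn_gr_inv_sq hN hR t)
    (Eventually.of_forall fun _ => sq_nonneg _) (Ioc_subset_Ioc_right hst).eventuallyLE

/-- For `s ≤ t`, monotonicity gives `1/g(s) = g(s) g(s)^(-2) ≤ g(t) g(s)^(-2)`. This is what lets
the time integral reproduce the growth `gr N R t` allowed to corrections. -/
lemma integral_gr_inv_le {N R t : ℝ} (hN : 2 < N) (hR : 0 < R) :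
    ∫ s in Ioc 0 t, (gr N R s)⁻¹ ≤ gr N R t * theta N R t := by
  unfold theta
  rw [← integral_const_mul]
  refine setIntegral_mono_on (integrableOn_gr_inv hN hR t)
    ((integrableOn_gr_inv_sq hN hR t).const_mul _) measurableSet_Ioc fun s hs => ?_
  have h1 := gr_pos (N := N) hR hs.1.le
  have h2 := gr_mono hN hR hs.1.le hs.2
  rw [sq, ← mul_assoc]
  refine le_mul_of_one_le_left (inv_pos.2 h1).le ?_
  rw [← div_eq_mul_inv]
  exact (one_le_div h1).2 h2

lemma theta_le_linear {N R t : ℝ} (hN : 2 < N) (hR : 0 < R) (ht : 0 ≤ t) :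
    theta N R t ≤ t * R ^ (-((2 * N - 2) / (N + 2))) := by
  have h : ∀ s ∈ Ioc 0 t, ((gr N R s)⁻¹) ^ 2 ≤ R ^ (-((2 * N - 2) / (N + 2))) := by
    intro s hs
    have h0 := inv_pos.2 (gr_pos (N := N) hR hs.1.le)
    refine (pow_le_pow_left₀ h0.le (gr_inv_le hN hR hs.1.le) 2).trans (le_of_eq ?_)
    unfold gr
    rw [add_zero, ← Real.rpow_neg hR.le, ← Real.rpow_natCast, ← Real.rpow_mul hR.le]
    congr 1
    push_cast; ring
  calc theta N R t ≤ ∫ s in Ioc 0 t, R ^ (-((2 * N - 2) / (N + 2))) :=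
        setIntegral_mono_on (integrableOn_gr_inv_sq hN hR t) (by simp) measurableSet_Ioc h
    _ = _ := by simp [ht]

/-- The integrand is a power with exponent `-(2N - 2)/(N + 2)`, which is below `-1` exactly when `N
> 4`; the integral over the whole half line is then finite. -/
lemma theta_le_global {N R t : ℝ} (hN : 4 < N) (hR : 0 < R) :
    theta N R t ≤ (N + 2) / (N - 4) * R ^ ((4 - N) / (N + 2)) := by
  have hlt : -((2 * N - 2) / (N + 2)) < -1 := by
    rw [neg_lt_neg_iff, one_lt_div (by linarith)]; linarith
  have he : ∀ s, 0 ≤ s → ((gr N R s)⁻¹) ^ 2 = (s + R) ^ (-((2 * N - 2) / (N + 2))) := by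
    intro s hs
    have hRs : 0 ≤ R + s := by linarith
    unfold gr
    rw [← Real.rpow_neg hRs, ← Real.rpow_natCast, ← Real.rpow_mul hRs, add_comm]
    congr 1
    push_cast; ring
  have hint := integrableOn_add_rpow_Ioi_of_lt hlt (show -R < 0 by linarith)
  calc theta N R t = ∫ s in Ioc 0 t, (s + R) ^ (-((2 * N - 2) / (N + 2))) :=
        setIntegral_congr_fun measurableSet_Ioc fun s hs => he s hs.1.le
    _ ≤ ∫ s in Ioi 0, (s + R) ^ (-((2 * N - 2) / (N + 2))) := by
        refine setIntegral_mono_set hint ?_ Ioc_subset_Ioi_self.eventuallyLE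
        filter_upwards [ae_restrict_mem measurableSet_Ioi] with s hs
        have : (0:ℝ) < s := hs
        exact Real.rpow_nonneg (by linarith) _
    _ = ∫ s in Ioi R, s ^ (-((2 * N - 2) / (N + 2))) :=
        (integral_Ioi_shift (fun s : ℝ => s ^ (-((2 * N - 2) / (N + 2)))) R).symm
    _ = _ := by
        rw [integral_Ioi_rpow_of_lt hlt hR]
        have h1 : N + 2 ≠ 0 := by linarith
        have h2 : N - 4 ≠ 0 := by linarith
        have h3 : -((2 * N - 2) / (N + 2)) + 1 = (4 - N) / (N + 2) := by field_simp; ring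
        have h4 : (4 - N) ≠ 0 := by linarith
        rw [h3]
        field_simp
        ring

/-- The mass is `(R + s)^(1 - N) / (N - 1)`, and the denominator exceeds `1`. The exponent in `gr`
is chosen so that its inverse is the `(N+2)`-nd root of `(R + s)^(1 - N)`. -/
lemma nuMeas_univ_le {N R s : ℝ} (hN : 2 < N) (hR : 0 < R) (hs : 0 ≤ s) :
    nuMeas N R s univ ^ (N + 2)⁻¹ ≤ ENNReal.ofReal (gr N R s)⁻¹ := by
  have hRs : 0 < R + s := by linarith
  have hlt : -N < -1 := by linarith
  have h1 : nuMeas N R s univ = ENNReal.ofReal ((R + s) ^ (1 - N) / (N - 1)) := by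
    unfold nuMeas
    rw [withDensity_apply _ MeasurableSet.univ, Measure.restrict_univ,
      ← ofReal_integral_eq_lintegral_ofReal
        (integrableOn_add_rpow_Ioi_of_lt hlt (show -s < R by linarith))]
    · congr 1
      have h2 : ∫ x in Ioi R, (x + s) ^ (-N) = ∫ x in Ioi (R + s), x ^ (-N) := by
        rw [integral_Ioi_shift _ (R + s), integral_Ioi_shift _ R]
        simp only [add_assoc]
      rw [h2, integral_Ioi_rpow_of_lt hlt hRs]
      have : -N + 1 = -(N - 1) := by ring
      rw [this, neg_div_neg_eq, neg_sub]
    · filter_upwards [ae_restrict_mem measurableSet_Ioi] with p hp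
      have : R < p := hp
      exact Real.rpow_nonneg (by linarith) _
  rw [h1, ENNReal.ofReal_rpow_of_nonneg (by
    have : 0 < N - 1 := by linarith
    positivity) (by
    have : 0 < N + 2 := by linarith
    positivity)]
  refine ENNReal.ofReal_le_ofReal ?_
  have h3 : (R + s) ^ (1 - N) / (N - 1) ≤ (R + s) ^ (1 - N) :=
    div_le_self (by positivity) (by linarith)
  have h5 : 0 ≤ (R + s) ^ (1 - N) / (N - 1) := by
    have : 0 < N - 1 := by linarith
    positivity
  refine (Real.rpow_le_rpow h5 h3 (inv_nonneg.2 (by linarith))).trans (le_of_eq ?_)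
  unfold gr
  rw [← Real.rpow_mul hRs.le, ← Real.rpow_neg hRs.le]
  congr 1
  field_simp
  ring

/-- The density decreases in `s`, so the norm of the free part `v` at any time is bounded by its
initial norm. -/
lemma nuMeas_le {N R s : ℝ} (hN : 2 < N) (hR : 0 < R) (hs : 0 ≤ s) :
    nuMeas N R s ≤ nuMeas N R 0 := by
  refine withDensity_mono ?_
  filter_upwards [ae_restrict_mem measurableSet_Ioi] with p hp
  have : R < p := hp
  refine ENNReal.ofReal_le_ofReal ?_
  exact Real.rpow_le_rpow_of_nonpos (by linarith) (by linarith) (by linarith)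

end weights

end OutgoingWave
end

/-! ### The fixed point in characteristic coordinates -/

noncomputable section

namespace OutgoingWave

variable {𝕜 : Type*} [RCLike 𝕜]

/-- Admissible initial values `v = r u₀`. -/
structure Adm (N R A : ℝ) (v : ℝ → 𝕜) : Prop where
  meas : StronglyMeasurable v
  zero : ∀ q ≤ R, v q = 0
  norm : eLpNorm v (ENNReal.ofReal (N + 2)) (nuMeas N R 0) ≤ ENNReal.ofReal A

/-- Admissible corrections `D(q, t)` to the free evolution, in characteristic coordinates. -/
structure Corr (N R T A : ℝ) (D : ℝ → ℝ → 𝕜) : Prop where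
  meas : StronglyMeasurable (Function.uncurry D)
  zero : ∀ q ≤ R, ∀ t, D q t = 0
  bound : ∀ q, ∀ t ∈ Icc 0 T, ‖D q t‖ ≤ A * gr N R t

/-- The integrand `(p + s)^{-N} |V|^N V`, for `V = v + D`. -/
def kern (N : ℝ) (v : ℝ → 𝕜) (D : ℝ → ℝ → 𝕜) (p s : ℝ) : 𝕜 :=
  ((p + s) ^ (-N) : ℝ) • powMap N (v p + D p s)

/-- The right hand side of the integral equation in characteristic coordinates. -/
def picOp (N : ℝ) (v : ℝ → 𝕜) (D : ℝ → ℝ → 𝕜) (q t : ℝ) : 𝕜 :=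
  -((2⁻¹ : ℝ) • ∫ s in Ioc 0 t, ∫ p in Ioc 0 q, kern N v D p s)

section measurability

lemma stronglyMeasurable_kern {N : ℝ} (hN : 0 ≤ N) {v : ℝ → 𝕜} (hv : StronglyMeasurable v)
    {D : ℝ → ℝ → 𝕜} (hD : StronglyMeasurable (Function.uncurry D)) :
    StronglyMeasurable (Function.uncurry (kern N v D)) := by
  have h1 : StronglyMeasurable fun z : ℝ × ℝ => v z.1 + D z.1 z.2 :=
    (hv.comp_measurable measurable_fst).add hD
  have h2 : StronglyMeasurable fun z : ℝ × ℝ => ((z.1 + z.2) ^ (-N) : ℝ) :=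
    (by fun_prop : Measurable fun z : ℝ × ℝ => ((z.1 + z.2) ^ (-N) : ℝ)).stronglyMeasurable
  exact h2.smul ((continuous_powMap hN).comp_stronglyMeasurable h1)

lemma stronglyMeasurable_setIntegral_Ioc {X : Type*} [MeasurableSpace X] {F : X → ℝ → 𝕜}
    (hF : StronglyMeasurable (Function.uncurry F)) {a : X → ℝ} (ha : Measurable a) :
    StronglyMeasurable fun x => ∫ s in Ioc 0 (a x), F x s := by
  have h : ∀ x, ∫ s in Ioc 0 (a x), F x s = ∫ s, (Ioc 0 (a x)).indicator (F x) s := fun x =>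
    (integral_indicator measurableSet_Ioc).symm
  simp only [h]
  refine StronglyMeasurable.integral_prod_right ?_
  have : (Function.uncurry fun x s => (Ioc 0 (a x)).indicator (F x) s) =
      {z : X × ℝ | z.2 ∈ Ioc 0 (a z.1)}.indicator (Function.uncurry F) := by
    ext z
    by_cases hz : z.2 ∈ Ioc 0 (a z.1)
    · simp only [Function.uncurry]
      rw [indicator_of_mem hz, indicator_of_mem (by exact hz)]
      rfl
    · simp only [Function.uncurry]
      rw [indicator_of_notMem hz, indicator_of_notMem (by exact hz)]
  rw [this]
  refine hF.indicator (MeasurableSet.inter ?_ ?_)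
  · exact measurableSet_lt measurable_const measurable_snd
  · exact measurableSet_le measurable_snd (ha.comp measurable_fst)

lemma stronglyMeasurable_inner {N : ℝ} (hN : 0 ≤ N) {v : ℝ → 𝕜} (hv : StronglyMeasurable v)
    {D : ℝ → ℝ → 𝕜} (hD : StronglyMeasurable (Function.uncurry D)) :
    StronglyMeasurable fun z : ℝ × ℝ => ∫ p in Ioc 0 z.1, kern N v D p z.2 := by
  refine stronglyMeasurable_setIntegral_Ioc (F := fun (z : ℝ × ℝ) p => kern N v D p z.2) ?_
    measurable_fst
  exact (stronglyMeasurable_kern hN hv hD).comp_measurable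
    (by fun_prop : Measurable fun z : (ℝ × ℝ) × ℝ => (z.2, z.1.2))

lemma stronglyMeasurable_picOp {N : ℝ} (hN : 0 ≤ N) {v : ℝ → 𝕜} (hv : StronglyMeasurable v)
    {D : ℝ → ℝ → 𝕜} (hD : StronglyMeasurable (Function.uncurry D)) :
    StronglyMeasurable (Function.uncurry (picOp N v D)) := by
  unfold picOp
  refine StronglyMeasurable.neg (StronglyMeasurable.const_smul ?_ _)
  refine stronglyMeasurable_setIntegral_Ioc
    (F := fun (z : ℝ × ℝ) s => ∫ p in Ioc 0 z.1, kern N v D p s) ?_ measurable_snd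
  exact (stronglyMeasurable_inner hN hv hD).comp_measurable
    (by fun_prop : Measurable fun z : (ℝ × ℝ) × ℝ => (z.1.1, z.2))

end measurability

section estimates

/-- The factor `gr N R s` in the pointwise bound is paid for by the root of the mass of `nuMeas N R
s`, so the constant `a` is unchanged. -/
lemma eLpNorm_le_of_norm_le {N R s a : ℝ} (hN : 2 < N) (hR : 0 < R) (hs : 0 ≤ s)
    {E : ℝ → 𝕜} (hE : ∀ q, ‖E q‖ ≤ a * gr N R s) :
    eLpNorm E (ENNReal.ofReal (N + 2)) (nuMeas N R s) ≤ ENNReal.ofReal a := by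
  refine (eLpNorm_le_of_ae_bound (Eventually.of_forall hE)).trans ?_
  rw [ENNReal.toReal_ofReal (by linarith)]
  calc nuMeas N R s univ ^ (N + 2)⁻¹ * ENNReal.ofReal (a * gr N R s)
      ≤ ENNReal.ofReal (gr N R s)⁻¹ * ENNReal.ofReal (a * gr N R s) := by
        gcongr; exact nuMeas_univ_le hN hR hs
    _ = ENNReal.ofReal a := by
        have := gr_pos (N := N) hR hs
        rw [← ENNReal.ofReal_mul (inv_pos.2 this).le]
        congr 1; field_simp

variable {N R T A : ℝ} {v w : ℝ → 𝕜} {D E : ℝ → ℝ → 𝕜}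

lemma Corr.meas_slice (hD : Corr N R T A D) (s : ℝ) : StronglyMeasurable fun q => D q s :=
  hD.meas.comp_measurable (by fun_prop : Measurable fun q : ℝ => (q, s))

lemma one_le_ofReal {N : ℝ} (hN : 2 < N) : 1 ≤ ENNReal.ofReal (N + 2) := by
  rw [← ENNReal.ofReal_one]; exact ENNReal.ofReal_le_ofReal (by linarith)

lemma eLpNorm_add_corr_le (hN : 2 < N) (hR : 0 < R) (hA : 0 ≤ A) (hv : Adm N R A v)
    (hD : Corr N R T A D) {s : ℝ} (hs : s ∈ Icc 0 T) :
    eLpNorm (fun q => v q + D q s) (ENNReal.ofReal (N + 2)) (nuMeas N R s)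
      ≤ ENNReal.ofReal (2 * A) := by
  refine (eLpNorm_add_le (g := fun q => D q s) hv.meas.aestronglyMeasurable
    (hD.meas_slice s).aestronglyMeasurable (one_le_ofReal hN)).trans ?_
  rw [two_mul, ENNReal.ofReal_add hA hA]
  gcongr
  · exact (eLpNorm_mono_measure _ (nuMeas_le hN hR hs.1)).trans hv.norm
  · exact eLpNorm_le_of_norm_le hN hR hs.1 fun q => hD.bound q s hs

lemma eLpNorm_corr_sub_le (hN : 2 < N) (hR : 0 < R) (hv : StronglyMeasurable v)
    (hw : StronglyMeasurable w) (hD : StronglyMeasurable (Function.uncurry D))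
    (hE : StronglyMeasurable (Function.uncurry E))
    {B₁ B₂ : ℝ} (hB₁ : 0 ≤ B₁) (hB₂ : 0 ≤ B₂)
    (hvw : eLpNorm (v - w) (ENNReal.ofReal (N + 2)) (nuMeas N R 0) ≤ ENNReal.ofReal B₁)
    {s : ℝ} (hs : 0 ≤ s) (hDE : ∀ q, ‖D q s - E q s‖ ≤ B₂ * gr N R s) :
    eLpNorm ((fun q => v q + D q s) - fun q => w q + E q s) (ENNReal.ofReal (N + 2))
      (nuMeas N R s) ≤ ENNReal.ofReal (B₁ + B₂) := by
  have h : ((fun q => v q + D q s) - fun q => w q + E q s) = (v - w) + fun q => D q s - E q s := by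
    ext q; simp only [Pi.sub_apply, Pi.add_apply]; ring
  have hm : Measurable fun q : ℝ => (q, s) := by fun_prop
  rw [h]
  refine (eLpNorm_add_le (hv.sub hw).aestronglyMeasurable
    ((hD.comp_measurable hm).sub (hE.comp_measurable hm)).aestronglyMeasurable
    (one_le_ofReal hN)).trans ?_
  rw [ENNReal.ofReal_add hB₁ hB₂]
  gcongr
  · exact (eLpNorm_mono_measure _ (nuMeas_le hN hR hs)).trans hvw
  · exact eLpNorm_le_of_norm_le hN hR hs hDE

/-- The weight `(p + s)^(-N)` in the kernel is the density of `nuMeas`, and both kernels vanish for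
`p ≤ R`. Hence the left side is an `L¹` norm for that measure, to which the Hölder estimate applies
with both functions of norm at most `2A`. -/
lemma lintegral_kern_sub_le (hN : 2 < N) (hR : 0 < R) (hA : 0 ≤ A) (hv : Adm N R A v)
    (hw : Adm N R A w) (hD : Corr N R T A D) (hE : Corr N R T A E) {B₁ B₂ : ℝ} (hB₁ : 0 ≤ B₁)
    (hB₂ : 0 ≤ B₂)
    (hvw : eLpNorm (v - w) (ENNReal.ofReal (N + 2)) (nuMeas N R 0) ≤ ENNReal.ofReal B₁)
    {s : ℝ} (hs : s ∈ Icc 0 T) (hDE : ∀ q, ‖D q s - E q s‖ ≤ B₂ * gr N R s) :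
    ∫⁻ p in Ioi 0, ‖kern N v D p s - kern N w E p s‖ₑ
      ≤ ENNReal.ofReal ((N + 1) * (2 * (2 * A) ^ N * (B₁ + B₂) * (gr N R s)⁻¹)) := by
  have hN0 : 0 ≤ N := by linarith
  have hmD : Measurable fun q : ℝ => (q, s) := by fun_prop
  have hmV : StronglyMeasurable fun q => v q + D q s := hv.meas.add (hD.meas_slice s)
  have hmW : StronglyMeasurable fun q => w q + E q s := hw.meas.add (hE.meas_slice s)
  have h1 := lintegral_powMap_sub_le (μ := nuMeas N R s) (by linarith : 1 ≤ N)
    hmV.aestronglyMeasurable hmW.aestronglyMeasurable (by positivity : 0 ≤ 2 * A)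
    (by positivity : 0 ≤ B₁ + B₂) (eLpNorm_add_corr_le hN hR hA hv hD hs)
    (eLpNorm_add_corr_le hN hR hA hw hE hs)
    (eLpNorm_corr_sub_le hN hR hv.meas hw.meas hD.meas hE.meas hB₁ hB₂ hvw hs.1 hDE)
    (nuMeas_univ_le hN hR hs.1)
  refine le_trans (le_of_eq ?_) h1
  have hmd : StronglyMeasurable fun q => powMap N (v q + D q s) - powMap N (w q + E q s) :=
    ((continuous_powMap hN0).comp_stronglyMeasurable hmV).sub
      ((continuous_powMap hN0).comp_stronglyMeasurable hmW)
  unfold nuMeas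
  rw [lintegral_withDensity_eq_lintegral_mul₀ (by fun_prop) hmd.enorm.aemeasurable,
    ← lintegral_indicator measurableSet_Ioi, ← lintegral_indicator measurableSet_Ioi]
  refine lintegral_congr fun p => ?_
  by_cases hp : R < p
  · have hp0 : 0 < p := hR.trans hp
    have : 0 ≤ (p + s) ^ (-N) := Real.rpow_nonneg (by linarith [hs.1]) _
    rw [indicator_of_mem (show p ∈ Ioi 0 from hp0), indicator_of_mem (show p ∈ Ioi R from hp)]
    simp only [kern, ← smul_sub, enorm_smul, Pi.mul_apply, Real.enorm_of_nonneg this]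
  · have hp' : p ≤ R := not_lt.1 hp
    rw [indicator_of_notMem (show p ∉ Ioi R from hp)]
    by_cases hp0 : 0 < p
    · rw [indicator_of_mem (show p ∈ Ioi 0 from hp0)]
      simp [kern, hv.zero p hp', hw.zero p hp', hD.zero p hp', hE.zero p hp']
    · rw [indicator_of_notMem (show p ∉ Ioi 0 from hp0)]

lemma adm_zero : Adm N R A (0 : ℝ → 𝕜) :=
  ⟨stronglyMeasurable_zero, fun _ _ => rfl, by simp⟩

lemma corr_zero (hR : 0 < R) (hA : 0 ≤ A) : Corr N R T A (fun _ _ => (0 : 𝕜)) :=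
  ⟨stronglyMeasurable_const, fun _ _ _ => rfl, fun q t ht => by
    simpa using mul_nonneg hA (gr_pos hR ht.1).le⟩

lemma kern_zero (p s : ℝ) : kern N (0 : ℝ → 𝕜) (fun _ _ => 0) p s = 0 := by
  simp [kern, powMap_zero]

lemma lintegral_kern_le (hN : 2 < N) (hR : 0 < R) (hA : 0 ≤ A) (hv : Adm N R A v)
    (hD : Corr N R T A D) {s : ℝ} (hs : s ∈ Icc 0 T) :
    ∫⁻ p in Ioi 0, ‖kern N v D p s‖ₑ
      ≤ ENNReal.ofReal ((N + 1) * (2 * (2 * A) ^ N * (A + A) * (gr N R s)⁻¹)) := by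
  have := lintegral_kern_sub_le hN hR hA hv adm_zero hD (corr_zero hR hA) hA hA
    (by rw [sub_zero]; exact hv.norm) hs (fun q => by
      rw [sub_zero]; exact hD.bound q s hs)
  simpa only [kern_zero, sub_zero] using this

lemma integrableOn_kern (hN : 2 < N) (hR : 0 < R) (hA : 0 ≤ A) (hv : Adm N R A v)
    (hD : Corr N R T A D) {s : ℝ} (hs : s ∈ Icc 0 T) :
    IntegrableOn (fun p => kern N v D p s) (Ioi 0) := by
  refine ⟨((stronglyMeasurable_kern (by linarith) hv.meas hD.meas).comp_measurable
    (by fun_prop : Measurable fun p : ℝ => (p, s))).aestronglyMeasurable, ?_⟩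
  exact (lintegral_kern_le hN hR hA hv hD hs).trans_lt ENNReal.ofReal_lt_top

lemma norm_inner_sub_le (hN : 2 < N) (hR : 0 < R) (hA : 0 ≤ A) (hv : Adm N R A v)
    (hw : Adm N R A w) (hD : Corr N R T A D) (hE : Corr N R T A E) {B₁ B₂ : ℝ} (hB₁ : 0 ≤ B₁)
    (hB₂ : 0 ≤ B₂)
    (hvw : eLpNorm (v - w) (ENNReal.ofReal (N + 2)) (nuMeas N R 0) ≤ ENNReal.ofReal B₁)
    {s : ℝ} (hs : s ∈ Icc 0 T) (hDE : ∀ q, ‖D q s - E q s‖ ≤ B₂ * gr N R s) (q : ℝ) :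
    ‖(∫ p in Ioc 0 q, kern N v D p s) - ∫ p in Ioc 0 q, kern N w E p s‖
      ≤ (N + 1) * (2 * (2 * A) ^ N * (B₁ + B₂)) * (gr N R s)⁻¹ := by
  have i1 := (integrableOn_kern hN hR hA hv hD hs).mono_set
    (show Ioc 0 q ⊆ Ioi 0 from Ioc_subset_Ioi_self)
  have i2 := (integrableOn_kern hN hR hA hw hE hs).mono_set
    (show Ioc 0 q ⊆ Ioi 0 from Ioc_subset_Ioi_self)
  rw [← integral_sub i1 i2]
  have hg := inv_pos.2 (gr_pos (N := N) hR hs.1)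
  have h0 : 0 ≤ (N + 1) * (2 * (2 * A) ^ N * (B₁ + B₂) * (gr N R s)⁻¹) := by
    have : 0 ≤ N + 1 := by linarith
    positivity
  have h1 := (lintegral_mono_set (μ := volume) (f := fun p => ‖kern N v D p s - kern N w E p s‖ₑ)
    (show Ioc 0 q ⊆ Ioi 0 from Ioc_subset_Ioi_self)).trans
    (lintegral_kern_sub_le hN hR hA hv hw hD hE hB₁ hB₂ hvw hs hDE)
  have h2 := (enorm_integral_le_lintegral_enorm _).trans h1
  rw [← ofReal_norm, ENNReal.ofReal_le_ofReal_iff h0] at h2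
  linarith

lemma integrableOn_inner (hN : 2 < N) (hR : 0 < R) (hA : 0 ≤ A) (hv : Adm N R A v)
    (hD : Corr N R T A D) (q : ℝ) {t : ℝ} (ht : t ≤ T) :
    IntegrableOn (fun s => ∫ p in Ioc 0 q, kern N v D p s) (Ioc 0 t) := by
  have hm := ((stronglyMeasurable_inner (by linarith : 0 ≤ N) hv.meas hD.meas).comp_measurable
    (by fun_prop : Measurable fun s : ℝ => (q, s)))
  refine Integrable.mono' ((integrableOn_gr_inv hN hR t).const_mul
    ((N + 1) * (2 * (2 * A) ^ N * (A + A)))) hm.aestronglyMeasurable ?_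
  filter_upwards [ae_restrict_mem measurableSet_Ioc] with s hs
  have hs' : s ∈ Icc 0 T := ⟨hs.1.le, hs.2.trans ht⟩
  have := norm_inner_sub_le hN hR hA hv adm_zero hD (corr_zero hR hA) hA hA
    (by rw [sub_zero]; exact hv.norm) hs' (fun q => by
      rw [sub_zero]; exact hD.bound q s hs') q
  simpa only [kern_zero, integral_zero, sub_zero, Function.comp] using this

/-- The smallness constant. -/
def kap (N : ℝ) : ℝ := ((N + 1) * (2 * 2 ^ N))⁻¹

lemma kap_pos (hN : 2 < N) : 0 < kap N := by
  have : 0 < N + 1 := by linarith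
  unfold kap; positivity

/-- The central estimate, used with three choices of `B₁` and `B₂`. Comparison with zero and `B₁ =
B₂ = A` shows that the ball of corrections is preserved; `B₁ = 0` gives a contraction by `1/2`; `B₁
= B₂` is preserved by the mean `(B₁ + B₂)/2` and gives Lipschitz dependence on the data. -/
lemma norm_picOp_sub_le (hN : 2 < N) (hR : 0 < R) (hA : 0 ≤ A) (hsm : A ^ N * theta N R T ≤ kap N)
    (hv : Adm N R A v)
    (hw : Adm N R A w) (hD : Corr N R T A D) (hE : Corr N R T A E) {B₁ B₂ : ℝ} (hB₁ : 0 ≤ B₁)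
    (hB₂ : 0 ≤ B₂)
    (hvw : eLpNorm (v - w) (ENNReal.ofReal (N + 2)) (nuMeas N R 0) ≤ ENNReal.ofReal B₁)
    (hDE : ∀ q, ∀ s ∈ Icc 0 T, ‖D q s - E q s‖ ≤ B₂ * gr N R s) (q : ℝ) {t : ℝ}
    (ht : t ∈ Icc 0 T) :
    ‖picOp N v D q t - picOp N w E q t‖ ≤ (B₁ + B₂) / 2 * gr N R t := by
  have hN1 : 0 < N + 1 := by linarith
  have hg := gr_pos (N := N) hR ht.1
  have hth := theta_mono hN hR ht.2
  have h1 : ‖∫ s in Ioc 0 t, ((∫ p in Ioc 0 q, kern N v D p s) - ∫ p in Ioc 0 q, kern N w E p s)‖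
      ≤ ∫ s in Ioc 0 t, (N + 1) * (2 * (2 * A) ^ N * (B₁ + B₂)) * (gr N R s)⁻¹ := by
    refine norm_integral_le_of_norm_le ((integrableOn_gr_inv hN hR t).const_mul _) ?_
    filter_upwards [ae_restrict_mem measurableSet_Ioc] with s hs
    have hs' : s ∈ Icc 0 T := ⟨hs.1.le, hs.2.trans ht.2⟩
    exact norm_inner_sub_le hN hR hA hv hw hD hE hB₁ hB₂ hvw hs' (fun q => hDE q s hs') q
  have h2 : picOp N v D q t - picOp N w E q t = -((2⁻¹ : ℝ) •
      ∫ s in Ioc 0 t, ((∫ p in Ioc 0 q, kern N v D p s) - ∫ p in Ioc 0 q, kern N w E p s)) := by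
    rw [integral_sub (integrableOn_inner hN hR hA hv hD q ht.2)
      (integrableOn_inner hN hR hA hw hE q ht.2), smul_sub]
    unfold picOp
    abel
  rw [h2, norm_neg, norm_smul]
  rw [integral_const_mul] at h1
  have h3 := integral_gr_inv_le (t := t) hN hR
  -- The constant `kap` is chosen for this bound: after the factor `2⁻¹` in `picOp` cancels the `2`
  -- in the Lipschitz estimate, there remains `N + 1` times this quantity, that is `1/2`.
  have h4 : (2 * A) ^ N * theta N R t ≤ ((N + 1) * 2)⁻¹ := by
    rw [Real.mul_rpow (by norm_num) hA]
    have h5 : A ^ N * theta N R t ≤ kap N := le_trans (by gcongr) hsm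
    calc 2 ^ N * A ^ N * theta N R t = 2 ^ N * (A ^ N * theta N R t) := by ring
      _ ≤ 2 ^ N * kap N := by gcongr
      _ = _ := by
        have : (2:ℝ) ^ N ≠ 0 := (Real.rpow_pos_of_pos (by norm_num) N).ne'
        unfold kap; field_simp
  have hnorm : ‖(2⁻¹ : ℝ)‖ = 2⁻¹ := by norm_num
  rw [hnorm]
  calc 2⁻¹ * ‖∫ s in Ioc 0 t, ((∫ p in Ioc 0 q, kern N v D p s) - ∫ p in Ioc 0 q, kern N w E p s)‖
      ≤ 2⁻¹ * ((N + 1) * (2 * (2 * A) ^ N * (B₁ + B₂)) * (gr N R t * theta N R t)) := by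
        refine mul_le_mul_of_nonneg_left (h1.trans ?_) (by norm_num)
        exact mul_le_mul_of_nonneg_left h3 (by positivity)
    _ = (N + 1) * (B₁ + B₂) * gr N R t * ((2 * A) ^ N * theta N R t) := by ring
    _ ≤ (N + 1) * (B₁ + B₂) * gr N R t * ((N + 1) * 2)⁻¹ := by gcongr
    _ = _ := by field_simp

lemma picOp_zero (q t : ℝ) : picOp N (0 : ℝ → 𝕜) (fun _ _ => 0) q t = 0 := by
  simp [picOp, kern_zero]

lemma corr_picOp (hN : 2 < N) (hR : 0 < R) (hA : 0 ≤ A) (hsm : A ^ N * theta N R T ≤ kap N)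
    (hv : Adm N R A v) (hD : Corr N R T A D) : Corr N R T A (picOp N v D) := by
  refine ⟨stronglyMeasurable_picOp (by linarith) hv.meas hD.meas, fun q hq t => ?_, fun q t ht => ?_⟩
  · unfold picOp
    have : ∀ s, ∫ p in Ioc 0 q, kern N v D p s = 0 := by
      intro s
      refine setIntegral_eq_zero_of_forall_eq_zero fun p hp => ?_
      simp [kern, hv.zero p (hp.2.trans hq), hD.zero p (hp.2.trans hq), powMap_zero]
    simp [this]
  · have := norm_picOp_sub_le hN hR hA hsm hv adm_zero hD (corr_zero hR hA) hA hA
      (by rw [sub_zero]; exact hv.norm) (fun q s hs => by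
        rw [sub_zero]; exact hD.bound q s hs) q ht
    rw [picOp_zero, sub_zero] at this
    linarith

end estimates

section iteration

/-- Picard iterates. -/
def pic (N : ℝ) (v : ℝ → 𝕜) : ℕ → ℝ → ℝ → 𝕜
  | 0 => fun _ _ => 0
  | n + 1 => picOp N v (pic N v n)

/-- The limit of the Picard iterates. -/
def picLim (N : ℝ) (v : ℝ → 𝕜) (q t : ℝ) : 𝕜 := limUnder atTop fun n => pic N v n q t

variable {N R T A : ℝ} {v w : ℝ → 𝕜}

lemma corr_pic (hN : 2 < N) (hR : 0 < R) (hA : 0 ≤ A) (hsm : A ^ N * theta N R T ≤ kap N)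
    (hv : Adm N R A v) (n : ℕ) : Corr N R T A (pic N v n) := by
  induction n with
  | zero => exact corr_zero hR hA
  | succ n ih => exact corr_picOp hN hR hA hsm hv ih

/-- The zeroth difference is the first iterate, bounded by the radius `A`; with equal data each
further application of `picOp` halves the difference. -/
lemma norm_pic_succ_sub_le (hN : 2 < N) (hR : 0 < R) (hA : 0 ≤ A)
    (hsm : A ^ N * theta N R T ≤ kap N) (hv : Adm N R A v) (n : ℕ) :
    ∀ q, ∀ t ∈ Icc 0 T, ‖pic N v n q t - pic N v (n + 1) q t‖ ≤ A / 2 ^ n * gr N R t := by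
  induction n with
  | zero =>
    intro q t ht
    have := (corr_pic hN hR hA hsm hv 1).bound q t ht
    have h0 : pic N v 0 q t = 0 := rfl
    rw [h0, zero_sub, norm_neg, pow_zero, div_one]
    exact this
  | succ n ih =>
    intro q t ht
    have := norm_picOp_sub_le hN hR hA hsm hv hv (corr_pic hN hR hA hsm hv n)
      (corr_pic hN hR hA hsm hv (n + 1)) le_rfl (by positivity : 0 ≤ A / 2 ^ n) (by simp) ih q ht
    refine this.trans (le_of_eq ?_)
    rw [zero_add, pow_succ]
    field_simp

lemma pic_tendsto (hN : 2 < N) (hR : 0 < R) (hA : 0 ≤ A)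
    (hsm : A ^ N * theta N R T ≤ kap N) (hv : Adm N R A v) (q : ℝ) {t : ℝ} (ht : t ∈ Icc 0 T) :
    Tendsto (fun n => pic N v n q t) atTop (𝓝 (picLim N v q t)) ∧
      ∀ n, ‖pic N v n q t - picLim N v q t‖ ≤ 2 * A * gr N R t / 2 ^ n := by
  have hu : ∀ n, dist (pic N v n q t) (pic N v (n + 1) q t) ≤ (2 * A * gr N R t) / 2 / 2 ^ n := by
    intro n
    rw [dist_eq_norm]
    refine (norm_pic_succ_sub_le hN hR hA hsm hv n q t ht).trans (le_of_eq ?_)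
    field_simp
  have hc := cauchySeq_of_le_geometric_two hu
  have ht := hc.tendsto_limUnder
  refine ⟨ht, fun n => ?_⟩
  rw [← dist_eq_norm]
  exact dist_le_of_le_geometric_two_of_tendsto hu ht n

lemma corr_picLim (hN : 2 < N) (hR : 0 < R) (hA : 0 ≤ A)
    (hsm : A ^ N * theta N R T ≤ kap N) (hv : Adm N R A v) : Corr N R T A (picLim N v) := by
  refine ⟨?_, fun q hq t => ?_, fun q t ht => ?_⟩
  -- The limit is measurable on the whole plane, including times outside `[0, T]` at which the
  -- iterates are not known to converge.
  · exact StronglyMeasurable.limUnder (f := fun n => Function.uncurry (pic N v n))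
      fun n => (corr_pic hN hR hA hsm hv n).meas
  · have h : (fun n => pic N v n q t) = fun _ => 0 :=
      funext fun n => (corr_pic hN hR hA hsm hv n).zero q hq t
    unfold picLim
    rw [h]
    exact tendsto_const_nhds.limUnder_eq
  · exact le_of_tendsto (pic_tendsto hN hR hA hsm hv q ht).1.norm
      (Eventually.of_forall fun n => (corr_pic hN hR hA hsm hv n).bound q t ht)

/-- By the contraction estimate `picOp` is continuous along the iterates, so the shifted sequence
has both sides as limits. -/
lemma picLim_eq (hN : 2 < N) (hR : 0 < R) (hA : 0 ≤ A)
    (hsm : A ^ N * theta N R T ≤ kap N) (hv : Adm N R A v) (q : ℝ) {t : ℝ} (ht : t ∈ Icc 0 T) :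
    picLim N v q t = picOp N v (picLim N v) q t := by
  have h1 := ((pic_tendsto hN hR hA hsm hv q ht).1.comp (tendsto_add_atTop_nat 1))
  refine tendsto_nhds_unique h1 ?_
  rw [tendsto_iff_norm_sub_tendsto_zero]
  have hz : Tendsto (fun n : ℕ => (2 * A / 2 ^ n) / 2 * gr N R t) atTop (𝓝 0) := by
    have := tendsto_pow_atTop_nhds_zero_of_lt_one (r := (2⁻¹ : ℝ)) (by norm_num) (by norm_num)
    have h2 := (this.const_mul (A * gr N R t))
    rw [mul_zero] at h2
    refine h2.congr fun n => ?_
    rw [inv_pow]; field_simp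
  refine squeeze_zero (fun _ => norm_nonneg _) (fun n => ?_) hz
  have := norm_picOp_sub_le hN hR hA hsm hv hv (corr_pic hN hR hA hsm hv n)
    (corr_picLim hN hR hA hsm hv) le_rfl (by positivity : 0 ≤ 2 * A / 2 ^ n) (by simp)
    (fun q s hs => ((pic_tendsto hN hR hA hsm hv q hs).2 n).trans (le_of_eq (by ring))) q ht
  rw [zero_add] at this
  exact this

/-- The bound `B` holds for all iterates by induction, since the mean of the data difference `B` and
the previous difference `B` is again `B`. -/
lemma norm_picLim_sub_le (hN : 2 < N) (hR : 0 < R) (hA : 0 ≤ A)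
    (hsm : A ^ N * theta N R T ≤ kap N) (hv : Adm N R A v) (hw : Adm N R A w)
    {B : ℝ} (hB : 0 ≤ B)
    (hvw : eLpNorm (v - w) (ENNReal.ofReal (N + 2)) (nuMeas N R 0) ≤ ENNReal.ofReal B)
    (q : ℝ) {t : ℝ} (ht : t ∈ Icc 0 T) :
    ‖picLim N v q t - picLim N w q t‖ ≤ B * gr N R t := by
  have h : ∀ n, ∀ q, ∀ t ∈ Icc 0 T, ‖pic N v n q t - pic N w n q t‖ ≤ B * gr N R t := by
    intro n
    induction n with
    | zero =>
      intro q t ht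
      simpa [pic] using mul_nonneg hB (gr_pos (N := N) hR ht.1).le
    | succ n ih =>
      intro q t ht
      have := norm_picOp_sub_le hN hR hA hsm hv hw (corr_pic hN hR hA hsm hv n)
        (corr_pic hN hR hA hsm hw n) hB hB hvw ih q ht
      refine this.trans (le_of_eq ?_)
      ring
  exact le_of_tendsto ((pic_tendsto hN hR hA hsm hv q ht).1.sub
    (pic_tendsto hN hR hA hsm hw q ht).1).norm (Eventually.of_forall fun n => h n q t ht)

end iteration

end OutgoingWave
end

/-! ### From the fixed point to a solution on `ℝ³` -/

noncomputable section

namespace OutgoingWave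

variable {𝕜 : Type*} [RCLike 𝕜]

/-- The profile `r ↦ V(r - t) / r` for `r > t`. -/
def prof (t : ℝ) (V : ℝ → 𝕜) (r : ℝ) : 𝕜 := if t < r then r⁻¹ • V (r - t) else 0

/-- The function `r u₀`. -/
def mulId (u₀ : ℝ → 𝕜) (q : ℝ) : 𝕜 := q • u₀ q

/-- The solution with initial profile `u₀`. -/
def sol (N : ℝ) (u₀ : ℝ → 𝕜) (t : ℝ) : ℝ → 𝕜 :=
  prof t fun q => mulId u₀ q + picLim N (mulId u₀) q t

lemma outShift_eq (t : ℝ) (w : ℝ → 𝕜) : outShift t w = prof t (mulId w) := rfl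

lemma stronglyMeasurable_prof {V : ℝ → ℝ → 𝕜} (hV : StronglyMeasurable (Function.uncurry V)) :
    StronglyMeasurable fun z : ℝ × ℝ => prof z.1 (fun q => V q z.1) z.2 := by
  refine StronglyMeasurable.ite (measurableSet_lt measurable_fst measurable_snd) ?_
    stronglyMeasurable_const
  refine (by fun_prop : Measurable fun z : ℝ × ℝ => z.2⁻¹).stronglyMeasurable.smul ?_
  exact hV.comp_measurable (by fun_prop : Measurable fun z : ℝ × ℝ => (z.2 - z.1, z.1))

lemma stronglyMeasurable_prof_slice {V : ℝ → 𝕜} (hV : StronglyMeasurable V) (t : ℝ) :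
    StronglyMeasurable (prof t V) := by
  have := stronglyMeasurable_prof (V := fun q _ => V q)
    (hV.comp_measurable measurable_fst)
  exact this.comp_measurable (by fun_prop : Measurable fun r : ℝ => (t, r))

/-- The constant `|S²|^{1/(N+2)}`. -/
def sphConst (N : ℝ) : ℝ≥0∞ := ENNReal.ofReal (4 * Real.pi) ^ (N + 2)⁻¹

/-- The polar factor `r²` meets `r^(-(N+2))` from `u = V/r`, and `r^(-N)` with `r = q + t` is the
density of `nuMeas N R t`. Integration over the sphere leaves the constant `sphConst N`. -/
lemma LpNorm_prof {N R t : ℝ} (hN : 2 < N) (hR : 0 < R) (ht : 0 ≤ t) {V : ℝ → 𝕜}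
    (hV : StronglyMeasurable V) (hV0 : ∀ q ≤ R, V q = 0) :
    LpNorm (ENNReal.ofReal (N + 2)) (prof t V)
      = sphConst N * eLpNorm V (ENNReal.ofReal (N + 2)) (nuMeas N R t) := by
  have hp : 0 < N + 2 := by linarith
  have hne : ENNReal.ofReal (N + 2) ≠ 0 := by simpa using hp
  have hmp := stronglyMeasurable_prof_slice hV t
  unfold LpNorm sphConst
  rw [eLpNorm_eq_lintegral_rpow_enorm_toReal hne ENNReal.ofReal_ne_top,
      eLpNorm_eq_lintegral_rpow_enorm_toReal hne ENNReal.ofReal_ne_top,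
      ENNReal.toReal_ofReal hp.le, one_div, ← ENNReal.mul_rpow_of_nonneg _ _ (inv_nonneg.2 hp.le)]
  congr 1
  have h1 := lintegral_norm (F := fun r => ‖prof t V r‖ₑ ^ (N + 2))
    (hmp.enorm.pow_const _).aemeasurable
  simp only [rad]
  rw [h1]
  congr 1
  unfold nuMeas
  rw [lintegral_withDensity_eq_lintegral_mul₀ (by fun_prop) (hV.enorm.pow_const _).aemeasurable,
    ← lintegral_indicator measurableSet_Ioi, ← lintegral_indicator measurableSet_Ioi,
    ← lintegral_add_right_eq_self _ t]
  refine lintegral_congr fun q => ?_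
  by_cases hq : R < q
  · have hq0 : 0 < q := hR.trans hq
    have hqt : 0 < q + t := by linarith
    rw [indicator_of_mem (show q + t ∈ Ioi 0 from hqt), indicator_of_mem (show q ∈ Ioi R from hq)]
    simp only [prof, Pi.mul_apply]
    rw [if_pos (by linarith), add_sub_cancel_right, enorm_smul,
      ENNReal.mul_rpow_of_nonneg _ _ hp.le, ← mul_assoc,
      Real.enorm_of_nonneg (inv_pos.2 hqt).le, ENNReal.ofReal_rpow_of_pos (inv_pos.2 hqt),
      ← ENNReal.ofReal_mul (sq_nonneg _)]
    congr 2
    rw [Real.inv_rpow hqt.le, ← Real.rpow_neg hqt.le, ← Real.rpow_natCast, ← Real.rpow_add hqt]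
    congr 1
    push_cast; ring
  · have hq' : q ≤ R := not_lt.1 hq
    rw [indicator_of_notMem (show q ∉ Ioi R from hq)]
    by_cases hqt : 0 < q + t
    · rw [indicator_of_mem (show q + t ∈ Ioi 0 from hqt)]
      have : prof t V (q + t) = 0 := by
        unfold prof
        rw [add_sub_cancel_right, hV0 q hq', smul_zero, ite_self]
      simp [this, hp]
    · rw [indicator_of_notMem (show q + t ∉ Ioi 0 from hqt)]

lemma prof_zero_mulId {u₀ : ℝ → 𝕜} {r : ℝ} (hr : 0 < r) : prof 0 (mulId u₀) r = u₀ r := by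
  unfold prof mulId
  rw [if_pos hr, sub_zero, inv_smul_smul₀ hr.ne']

lemma LpNorm_congr {f g : ℝ → 𝕜} (h : ∀ᵐ r ∂(volume.restrict (Ioi (0 : ℝ))), f r = g r)
    (p : ℝ≥0∞) : LpNorm p f = LpNorm p g :=
  eLpNorm_congr_ae (ae_norm_iff.2 h)

lemma LpNorm_mulId {N R : ℝ} (hN : 2 < N) (hR : 0 < R) {u₀ : ℝ → 𝕜}
    (hu : StronglyMeasurable u₀) (hu0 : ∀ q ≤ R, u₀ q = 0) :
    LpNorm (ENNReal.ofReal (N + 2)) u₀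
      = sphConst N * eLpNorm (mulId u₀) (ENNReal.ofReal (N + 2)) (nuMeas N R 0) := by
  have hm : StronglyMeasurable (mulId u₀) := stronglyMeasurable_id.smul hu
  rw [← LpNorm_prof hN hR le_rfl hm fun q hq => by rw [mulId, hu0 q hq, smul_zero]]
  refine LpNorm_congr ?_ _
  filter_upwards [ae_restrict_mem measurableSet_Ioi] with r hr
  exact (prof_zero_mulId hr).symm

section nonlinear

variable {N : ℝ}

/-- Inserting `u = V/r` gives `r |u|^N u = r^(-N) |V|^N V`, and `r = p + t` in the characteristic
coordinate `p = r - t`. -/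
lemma smul_nonlin_prof {t r : ℝ} (ht : 0 ≤ t) (v : ℝ → 𝕜) (D : ℝ → ℝ → 𝕜) :
    r • nonlin N (prof t fun q => v q + D q t) r = if t < r then kern N v D (r - t) t else 0 := by
  unfold nonlin prof kern powMap
  split_ifs with h
  · have hr : 0 < r := ht.trans_lt h
    rw [sub_add_cancel, norm_smul, Real.mul_rpow (norm_nonneg _) (norm_nonneg _), smul_smul,
      smul_smul, smul_smul]
    congr 1
    rw [Real.norm_eq_abs, abs_of_pos (inv_pos.2 hr), Real.inv_rpow hr.le, Real.rpow_neg hr.le]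
    field_simp
  · simp

/-- The primitive of `kern`. -/
def kernPrim (N : ℝ) (v : ℝ → 𝕜) (D : ℝ → ℝ → 𝕜) (q s : ℝ) : 𝕜 :=
  ∫ p in Ioc 0 q, kern N v D p s

lemma integral_smul_nonlin_prof {t r : ℝ} (ht : 0 ≤ t) (hr : 0 ≤ r) (v : ℝ → 𝕜)
    (D : ℝ → ℝ → 𝕜) :
    ∫ ρ in (0 : ℝ)..r, ρ • nonlin N (prof t fun q => v q + D q t) ρ = kernPrim N v D (r - t) t := by
  simp only [smul_nonlin_prof ht]
  rw [intervalIntegral.integral_of_le hr, kernPrim, ← integral_indicator measurableSet_Ioc,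
    ← integral_indicator measurableSet_Ioc, ← integral_add_right_eq_self _ t]
  refine integral_congr_ae (Eventually.of_forall fun q => ?_)
  simp only [indicator, mem_Ioc, add_sub_cancel_right]
  by_cases h : 0 < q
  · have h1 : 0 < q + t := by linarith
    have h2 : t < q + t := by linarith
    simp only [h, h1, h2, if_true, true_and]
    simp only [le_sub_iff_add_le]
  · have h2 : ¬ t < q + t := by linarith
    simp [h, h2]

lemma force0_prof {t r : ℝ} (ht : 0 ≤ t) (hr : 0 ≤ r) (v : ℝ → 𝕜)
    (D : ℝ → ℝ → 𝕜) :
    force0 N (prof t fun q => v q + D q t) r = -((2⁻¹ * r⁻¹ : ℝ) • kernPrim N v D (r - t) t) := by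
  rw [force0_eq, integral_smul_nonlin_prof ht hr]

lemma kernPrim_of_nonpos (v : ℝ → 𝕜) (D : ℝ → ℝ → 𝕜) {q : ℝ} (hq : q ≤ 0) (s : ℝ) :
    kernPrim N v D q s = 0 := by
  unfold kernPrim
  rw [Ioc_eq_empty (by linarith)]
  simp

/-- A source at time `s` is carried outward for the time `t - s`. It comes from radius `r - (t -
s)`, whose characteristic coordinate at time `s` is `r - t`, the same for all `s`. Thus the integral
over `s` runs along a fixed characteristic. -/
lemma outShift_force0_prof {t s r : ℝ} (hs : 0 ≤ s)
    (v : ℝ → 𝕜) (D : ℝ → ℝ → 𝕜) :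
    outShift (t - s) (force0 N (prof s fun q => v q + D q s)) r
      = r⁻¹ • (-((2⁻¹ : ℝ) • kernPrim N v D (r - t) s)) := by
  unfold outShift
  split_ifs with h
  · have h0 : 0 < r - (t - s) := by linarith
    rw [force0_prof hs h0.le, smul_neg, smul_smul]
    congr 3
    · field_simp
    · ring_nf
  · rw [kernPrim_of_nonpos _ _ (by linarith)]
    simp

end nonlinear

section solution

variable {N R T A : ℝ} {v : ℝ → 𝕜} {D : ℝ → ℝ → 𝕜}

lemma kernPrim_eq_zero (hv : Adm N R A v) (hD : Corr N R T A D) {q : ℝ} (hq : q ≤ R) (s : ℝ) :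
    kernPrim N v D q s = 0 := by
  unfold kernPrim
  refine setIntegral_eq_zero_of_forall_eq_zero fun p hp => ?_
  simp [kern, hv.zero p (hp.2.trans hq), hD.zero p (hp.2.trans hq), powMap_zero]

/-- A uniform bound for `kernPrim`. -/
def kernBound (N R A : ℝ) : ℝ := (N + 1) * (2 * (2 * A) ^ N * (A + A) * (gr N R 0)⁻¹)

lemma kernBound_nonneg (hN : 2 < N) (hR : 0 < R) (hA : 0 ≤ A) : 0 ≤ kernBound N R A := by
  have := gr_pos (N := N) hR le_rfl
  have : 0 ≤ N + 1 := by linarith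
  unfold kernBound; positivity

lemma lintegral_kern_le_kernBound (hN : 2 < N) (hR : 0 < R) (hA : 0 ≤ A) (hv : Adm N R A v)
    (hD : Corr N R T A D) {s : ℝ} (hs : s ∈ Icc 0 T) :
    ∫⁻ p in Ioi 0, ‖kern N v D p s‖ₑ ≤ ENNReal.ofReal (kernBound N R A) := by
  refine (lintegral_kern_le hN hR hA hv hD hs).trans (ENNReal.ofReal_le_ofReal ?_)
  have := gr_inv_le hN hR hs.1
  have : 0 ≤ N + 1 := by linarith
  unfold kernBound
  gcongr

lemma norm_kernPrim_le (hN : 2 < N) (hR : 0 < R) (hA : 0 ≤ A) (hv : Adm N R A v)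
    (hD : Corr N R T A D) {s : ℝ} (hs : s ∈ Icc 0 T) (q : ℝ) :
    ‖kernPrim N v D q s‖ ≤ kernBound N R A := by
  have h1 := (lintegral_mono_set (μ := volume) (f := fun p => ‖kern N v D p s‖ₑ)
    (show Ioc 0 q ⊆ Ioi 0 from Ioc_subset_Ioi_self)).trans
    (lintegral_kern_le_kernBound hN hR hA hv hD hs)
  have h2 := (enorm_integral_le_lintegral_enorm _).trans h1
  rwa [← ofReal_norm, ENNReal.ofReal_le_ofReal_iff (kernBound_nonneg hN hR hA)] at h2

/-- The primitive vanishes unless `r - t > R`; there `r > R`, so the factor `1/r` is bounded. -/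
lemma norm_inv_smul_kernPrim_le (hN : 2 < N) (hR : 0 < R) (hA : 0 ≤ A) (hv : Adm N R A v)
    (hD : Corr N R T A D) {s : ℝ} (hs : s ∈ Icc 0 T) {r t : ℝ} (ht : 0 ≤ t) :
    ‖r⁻¹ • kernPrim N v D (r - t) s‖ ≤ R⁻¹ * kernBound N R A := by
  by_cases h : r - t ≤ R
  · rw [kernPrim_eq_zero hv hD h, smul_zero, norm_zero]
    exact mul_nonneg (inv_pos.2 hR).le (kernBound_nonneg hN hR hA)
  · have hr : R < r := by linarith
    rw [norm_smul, Real.norm_eq_abs, abs_of_pos (inv_pos.2 (hR.trans hr))]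
    exact mul_le_mul (inv_anti₀ hR hr.le) (norm_kernPrim_le hN hR hA hv hD hs _) (norm_nonneg _)
      (inv_pos.2 hR).le

lemma intervalIntegrable_add_corr
    (hD : Corr N R T A D) {t : ℝ} (ht : t ∈ Icc 0 T)
    (hvi : ∀ M : ℝ, 0 < M → IntervalIntegrable v volume 0 M) (M : ℝ) (hM : 0 < M) :
    IntervalIntegrable (fun q => v q + D q t) volume 0 M := by
  refine (hvi M hM).add ?_
  rw [intervalIntegrable_iff_integrableOn_Ioc_of_le hM.le]
  exact Measure.integrableOn_of_bounded (M := A * gr N R t) (by simp)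
    (hD.meas_slice t).aestronglyMeasurable (Eventually.of_forall fun q => hD.bound q t ht)

lemma locallyIntegrable_prof {V : ℝ → 𝕜}
    (hV : ∀ M : ℝ, 0 < M → IntervalIntegrable V volume 0 M) {t : ℝ} (ht : 0 ≤ t) :
    LocallyIntegrable (rad (prof t V)) (volume : Measure E3) := by
  refine locallyIntegrable_rad_of_mul fun M hM => ?_
  refine (intervalIntegrable_shift hV ht M hM).congr fun r hr => ?_
  rw [uIoc_of_le hM.le] at hr
  simp only [prof]
  split_ifs with h
  · rw [smul_inv_smul₀ hr.1.ne']
  · rw [smul_zero]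

lemma integrable_smul_nonlin_prof (hN : 2 < N) (hR : 0 < R) (hA : 0 ≤ A) (hv : Adm N R A v)
    (hD : Corr N R T A D) {t : ℝ} (ht : t ∈ Icc 0 T) (M : ℝ) (hM : 0 < M) :
    IntervalIntegrable (fun ρ => ρ • nonlin N (prof t fun q => v q + D q t) ρ) volume 0 M := by
  simp only [smul_nonlin_prof ht.1]
  refine intervalIntegrable_shift (k := fun p => kern N v D p t) (fun M hM => ?_) ht.1 M hM
  rw [intervalIntegrable_iff_integrableOn_Ioc_of_le hM.le]
  exact (integrableOn_kern hN hR hA hv hD ht).mono_set Ioc_subset_Ioi_self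

lemma stronglyMeasurable_kernPrim (hN : 2 < N) (hv : Adm N R A v) (hD : Corr N R T A D) :
    StronglyMeasurable fun z : ℝ × ℝ => kernPrim N v D z.1 z.2 :=
  stronglyMeasurable_inner (by linarith) hv.meas hD.meas

lemma integrable_force0_prof (hN : 2 < N) (hR : 0 < R) (hA : 0 ≤ A) (hv : Adm N R A v)
    (hD : Corr N R T A D) (M : ℝ) :
    Integrable (fun p : ℝ × E3 => rad (force0 N (prof p.1 fun q => v q + D q p.1)) p.2)
      ((volume.restrict (Icc 0 T)).prod (volume.restrict (Metric.ball 0 M))) := by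
  have : IsFiniteMeasure (volume.restrict (Metric.ball (0 : E3) M)) :=
    ⟨by simpa using measure_ball_lt_top (μ := (volume : Measure E3)) (x := 0) (r := M)⟩
  have hm : StronglyMeasurable fun p : ℝ × E3 =>
      -((2⁻¹ : ℝ) • (‖p.2‖⁻¹ • kernPrim N v D (‖p.2‖ - p.1) p.1)) := by
    refine StronglyMeasurable.neg (StronglyMeasurable.const_smul ?_ _)
    refine (by fun_prop : Measurable fun p : ℝ × E3 => ‖p.2‖⁻¹).stronglyMeasurable.smul ?_
    exact (stronglyMeasurable_kernPrim hN hv hD).comp_measurable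
      (by fun_prop : Measurable fun p : ℝ × E3 => (‖p.2‖ - p.1, p.1))
  have hT : ∀ᵐ p : ℝ × E3 ∂((volume.restrict (Icc 0 T)).prod (volume.restrict (Metric.ball 0 M))),
      p.1 ∈ Icc 0 T :=
    Measure.quasiMeasurePreserving_fst.ae (ae_restrict_mem measurableSet_Icc)
  have hint := Integrable.of_bound (μ := (volume.restrict (Icc 0 T)).prod
    (volume.restrict (Metric.ball (0 : E3) M))) hm.aestronglyMeasurable
    (2⁻¹ * (R⁻¹ * kernBound N R A)) (by
      filter_upwards [hT] with p hp
      rw [norm_neg, norm_smul]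
      have := norm_inv_smul_kernPrim_le hN hR hA hv hD hp (r := ‖p.2‖) hp.1
      have h2 : ‖(2⁻¹ : ℝ)‖ = 2⁻¹ := by norm_num
      rw [h2]
      gcongr)
  refine hint.congr ?_
  filter_upwards [hT] with p hp
  rw [rad, force0_prof hp.1 (norm_nonneg _), mul_smul]

lemma integrable_force1_prof (hN : 2 < N) (hR : 0 < R) (hA : 0 ≤ A) (hv : Adm N R A v)
    (hD : Corr N R T A D) (M : ℝ) :
    Integrable (fun p : ℝ × E3 => rad (force1 N (prof p.1 fun q => v q + D q p.1)) p.2)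
      ((volume.restrict (Icc 0 T)).prod (volume.restrict (Metric.ball 0 M))) := by
  have hN0 : 0 ≤ N := by linarith
  have hV : StronglyMeasurable (Function.uncurry fun q t => v q + D q t) :=
    (hv.meas.comp_measurable measurable_fst).add hD.meas
  have hm0 : StronglyMeasurable fun z : ℝ × ℝ =>
      force1 N (prof z.1 fun q => v q + D q z.1) z.2 := by
    simp only [force1_eq]
    exact StronglyMeasurable.const_smul
      ((continuous_powMap hN0).comp_stronglyMeasurable (stronglyMeasurable_prof hV)) _
  have hm : StronglyMeasurable fun p : ℝ × E3 =>
      rad (force1 N (prof p.1 fun q => v q + D q p.1)) p.2 :=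
    hm0.comp_measurable (by fun_prop : Measurable fun p : ℝ × E3 => (p.1, ‖p.2‖))
  refine ⟨hm.aestronglyMeasurable, ?_⟩
  have hb : ∀ s ∈ Icc 0 T, ∫⁻ x in Metric.ball (0 : E3) M,
      ‖rad (force1 N (prof s fun q => v q + D q s)) x‖ₑ ≤
      ENNReal.ofReal (4 * Real.pi) * (ENNReal.ofReal M * ENNReal.ofReal (kernBound N R A)) := by
    intro s hs
    have hms : Measurable fun r => ‖force1 N (prof s fun q => v q + D q s) r‖ₑ :=
      (hm0.comp_measurable (by fun_prop : Measurable fun r : ℝ => (s, r))).enorm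
    have e1 : ∫⁻ x in Metric.ball (0 : E3) M, ‖rad (force1 N (prof s fun q => v q + D q s)) x‖ₑ =
        ∫⁻ x : E3, (Iio M).indicator
          (fun r => ‖force1 N (prof s fun q => v q + D q s) r‖ₑ) ‖x‖ := by
      rw [← lintegral_indicator measurableSet_ball]
      refine lintegral_congr fun x => ?_
      simp only [indicator, Metric.mem_ball, dist_zero_right, mem_Iio]
      rfl
    rw [e1, lintegral_norm (hms.indicator measurableSet_Iio).aemeasurable]
    gcongr
    -- The available bound is on the integral of `r |F|`, whereas polar coordinates ask for `r²
    -- |F|`. On the ball of radius `M` the missing factor `r` is at most `M`.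
    have e2 : ∫⁻ p in Ioi 0, ‖kern N v D p s‖ₑ =
        ∫⁻ r in Ioi 0, ‖r • nonlin N (prof s fun q => v q + D q s) r‖ₑ := by
      rw [← lintegral_indicator measurableSet_Ioi, ← lintegral_indicator measurableSet_Ioi,
        ← lintegral_sub_right_eq_self _ s]
      refine lintegral_congr fun r => ?_
      simp only [indicator, mem_Ioi, smul_nonlin_prof hs.1, sub_pos]
      by_cases h : s < r
      · simp [h, hs.1.trans_lt h]
      · simp [h]
    refine le_trans ?_ (mul_le_mul_right (lintegral_kern_le_kernBound hN hR hA hv hD hs) _)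
    rw [e2, ← lintegral_const_mul' _ _ ENNReal.ofReal_ne_top]
    refine setLIntegral_mono' measurableSet_Ioi fun r hr => ?_
    have hr' : 0 < r := hr
    by_cases h : r < M
    · rw [indicator_of_mem (show r ∈ Iio M from h), force1_eq, enorm_smul, enorm_smul,
        ← mul_assoc, ← mul_assoc, Real.enorm_of_nonneg hr'.le,
        Real.enorm_of_nonneg (by norm_num : (0:ℝ) ≤ 2⁻¹), ← ENNReal.ofReal_mul (sq_nonneg _),
        ← ENNReal.ofReal_mul (hr'.trans h).le]
      gcongr ?_ * _
      exact ENNReal.ofReal_le_ofReal (by nlinarith)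
    · rw [indicator_of_notMem (show r ∉ Iio M from h), mul_zero]
      exact zero_le
  have hme : Measurable fun p : ℝ × E3 =>
      ‖rad (force1 N (prof p.1 fun q => v q + D q p.1)) p.2‖ₑ := hm.enorm
  unfold HasFiniteIntegral
  rw [lintegral_prod _ hme.aemeasurable]
  refine (setLIntegral_mono' measurableSet_Icc hb).trans_lt ?_
  rw [setLIntegral_const]
  exact ENNReal.mul_lt_top (ENNReal.mul_lt_top ENNReal.ofReal_lt_top
    (ENNReal.mul_lt_top ENNReal.ofReal_lt_top ENNReal.ofReal_lt_top)) (by simp)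

/-- Each source is replaced by its translate, and Fubini brings the time integral inside the pairing
with `φ`. Absolute integrability comes from the uniform bound on `r⁻¹ kernPrim` and the compact
support of `φ`. -/
lemma duhamel_prof (hN : 2 < N) (hR : 0 < R) (hA : 0 ≤ A) (hv : Adm N R A v)
    (hD : Corr N R T A D) {t : ℝ} (ht : t ∈ Icc 0 T) (φ : TestFn) :
    ∫ s in (0 : ℝ)..t, Phi0 (t - s) (radFunctional (force0 N (prof s fun q => v q + D q s)))
      (radFunctional (force1 N (prof s fun q => v q + D q s))) φ
    = ∫ x : E3, φ x • (‖x‖⁻¹ • picOp N v D (‖x‖ - t) t) := by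
  have hN0 : 0 ≤ N := by linarith
  rw [intervalIntegral.integral_of_le ht.1]
  have e1 : ∀ s ∈ Ioc 0 t,
      Phi0 (t - s) (radFunctional (force0 N (prof s fun q => v q + D q s)))
        (radFunctional (force1 N (prof s fun q => v q + D q s))) φ
      = ∫ x : E3, φ x • (‖x‖⁻¹ • (-((2⁻¹ : ℝ) • kernPrim N v D (‖x‖ - t) s))) := by
    intro s hs
    have hs' : s ∈ Icc 0 T := ⟨hs.1.le, hs.2.trans ht.2⟩
    rw [Phi0_force (integrable_smul_nonlin_prof hN hR hA hv hD hs') (by linarith [hs.2])]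
    unfold radFunctional
    refine integral_congr_ae (Eventually.of_forall fun x => ?_)
    simp only [rad, outShift_force0_prof hs.1.le]
  rw [setIntegral_congr_fun measurableSet_Ioc e1, integral_integral_swap]
  · refine integral_congr_ae (Eventually.of_forall fun x => ?_)
    simp only [integral_smul, integral_neg, picOp]
    rfl
  · have hm : StronglyMeasurable fun p : ℝ × E3 =>
        (‖p.2‖⁻¹ • (-((2⁻¹ : ℝ) • kernPrim N v D (‖p.2‖ - t) p.1)) : 𝕜) := by
      refine (by fun_prop : Measurable fun p : ℝ × E3 => ‖p.2‖⁻¹).stronglyMeasurable.smul ?_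
      refine StronglyMeasurable.neg (StronglyMeasurable.const_smul ?_ _)
      exact (stronglyMeasurable_kernPrim hN hv hD).comp_measurable
        (by fun_prop : Measurable fun p : ℝ × E3 => (‖p.2‖ - t, p.1))
    have hφm : StronglyMeasurable fun p : ℝ × E3 => φ p.2 :=
      φ.contDiff.continuous.stronglyMeasurable.comp_measurable measurable_snd
    have hφi : Integrable (fun p : ℝ × E3 => (1:ℝ) * φ p.2)
        ((volume.restrict (Ioc 0 t)).prod volume) :=
      (integrable_const (1:ℝ)).mul_prod
        (φ.contDiff.continuous.integrable_of_hasCompactSupport φ.hasCompactSupport)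
    refine Integrable.mono' (hφi.norm.const_mul (R⁻¹ * kernBound N R A))
      (hφm.smul hm).aestronglyMeasurable ?_
    have hT : ∀ᵐ p : ℝ × E3 ∂((volume.restrict (Ioc 0 t)).prod volume), p.1 ∈ Ioc 0 t :=
      Measure.quasiMeasurePreserving_fst.ae (ae_restrict_mem measurableSet_Ioc)
    filter_upwards [hT] with p hp
    have hp' : p.1 ∈ Icc 0 T := ⟨hp.1.le, hp.2.trans ht.2⟩
    simp only [Function.uncurry]
    rw [norm_smul, one_mul, mul_comm]
    refine mul_le_mul_of_nonneg_right ?_ (norm_nonneg _)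
    rw [smul_neg, norm_neg, smul_comm, norm_smul]
    have := norm_inv_smul_kernPrim_le hN hR hA hv hD hp' (r := ‖p.2‖) ht.1
    have h2 : ‖(2⁻¹ : ℝ)‖ = 2⁻¹ := by norm_num
    rw [h2]
    have h3 := norm_nonneg (‖p.2‖⁻¹ • kernPrim N v D (‖p.2‖ - t) p.1)
    linarith

/-- The function built from the fixed point solves the equation. -/
lemma isSolutionOn_sol {u₀ : ℝ → 𝕜} {u₁ : Distr 𝕜} (hN : 2 < N) (hR : 0 < R) (hA : 0 ≤ A)
    (hsm : A ^ N * theta N R T ≤ kap N) (hv : Adm N R A (mulId u₀))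
    (hu : HasRadialDeriv u₀ (-u₁)) : IsSolutionOn N T u₀ u₁ (sol N u₀) := by
  have hD := corr_picLim hN hR hA hsm hv
  have hV : StronglyMeasurable (Function.uncurry fun q t => mulId u₀ q + picLim N (mulId u₀) q t) :=
    (hv.meas.comp_measurable measurable_fst).add hD.meas
  refine ⟨?_, fun t ht => ?_, fun t ht r hr => ?_, fun M => ?_, fun M => ?_, fun t ht φ => ?_⟩
  · exact ((stronglyMeasurable_prof hV).comp_measurable
      (by fun_prop : Measurable fun p : ℝ × E3 => (p.1, ‖p.2‖))).aestronglyMeasurable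
  · exact locallyIntegrable_prof (intervalIntegrable_add_corr hD ht hu.1) ht.1
  · exact integrable_smul_nonlin_prof hN hR hA hv hD ht r hr
  · exact integrable_force0_prof hN hR hA hv hD M
  · exact integrable_force1_prof hN hR hA hv hD M
  · have h1 := duhamel_prof hN hR hA hv hD ht φ
    unfold sol
    rw [h1, Phi0_data hu ht.1, outShift_eq]
    have hl1 : LocallyIntegrable (rad (prof t (mulId u₀))) (volume : Measure E3) :=
      locallyIntegrable_prof hu.1 ht.1
    have hl2 : LocallyIntegrable (rad (prof t fun q => picLim N (mulId u₀) q t))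
        (volume : Measure E3) := by
      refine locallyIntegrable_prof ?_ ht.1
      have := intervalIntegrable_add_corr (v := fun _ => (0 : 𝕜)) hD ht
        (fun M _ => by simp)
      simpa using this
    have hφ := φ.contDiff.continuous
    have hφs := φ.hasCompactSupport
    have h2 : ∀ x : E3, ‖x‖⁻¹ • picOp N (mulId u₀) (picLim N (mulId u₀)) (‖x‖ - t) t =
        rad (prof t fun q => picLim N (mulId u₀) q t) x := by
      intro x
      rw [← picLim_eq hN hR hA hsm hv _ ht, rad, prof]
      split_ifs with h
      · rfl
      · rw [hD.zero _ (by linarith), smul_zero]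
    simp only [h2]
    unfold radFunctional
    rw [← integral_add (integrable_mul_rad hl1 hφ hφs) (integrable_mul_rad hl2 hφ hφs)]
    refine integral_congr_ae (Eventually.of_forall fun x => ?_)
    simp only
    rw [← smul_add]
    congr 1
    simp only [rad, prof]
    split_ifs
    · rw [smul_add]
    · rw [add_zero]

end solution

end OutgoingWave
end

/-! ### Weak derivatives on the half line -/

noncomputable section

namespace OutgoingWave

variable {𝕜 : Type*} [RCLike 𝕜]

section weakDeriv

/-- Weak derivatives on the half line of functions vanishing near `0`, tested against functions of
class `C¹` with bounded support. -/
structure WeakDeriv (R : ℝ) (f h : ℝ → 𝕜) : Prop where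
  zero : ∀ r ≤ R, f r = 0
  zero' : ∀ r ≤ R, h r = 0
  int : ∀ A, IntegrableOn f (Ioc 0 A)
  int' : ∀ A, IntegrableOn h (Ioc 0 A)
  ibp : ∀ (B b : ℝ → ℝ) (A : ℝ), (∀ r, 0 < r → HasDerivAt B (b r) r) →
    ContinuousOn b (Ioi 0) → (∀ r, A ≤ r → B r = 0) → (∀ r, A ≤ r → b r = 0) →
    ∫ r in Ioi (0 : ℝ), b r • f r = -∫ r in Ioi (0 : ℝ), B r • h r

variable {R : ℝ}

lemma integrableOn_smul_of_zero (hR : 0 < R) {b : ℝ → ℝ} {f : ℝ → 𝕜}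
    (hb : ContinuousOn b (Ioi 0)) (hf : ∀ r ≤ R, f r = 0) (hi : ∀ A, IntegrableOn f (Ioc 0 A))
    (A : ℝ) : IntegrableOn (fun r => b r • f r) (Ioc 0 A) := by
  have h1 : IntegrableOn f (Icc R A) := (hi A).mono_set
    fun r hr => ⟨hR.trans_le hr.1, hr.2⟩
  have h2 : IntegrableOn (fun r => b r • f r) (Icc R A) :=
    h1.continuousOn_smul (hb.mono fun r hr => hR.trans_le hr.1) isCompact_Icc
  refine h2.of_forall_sdiff_eq_zero measurableSet_Ioc fun r hr => ?_
  have : r ≤ R := by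
    by_contra h
    exact hr.2 ⟨(not_le.1 h).le, hr.1.2⟩
  simp only [hf r this, smul_zero]

lemma integrableOn_Ioi_smul_of_zero (hR : 0 < R) {b : ℝ → ℝ} {f : ℝ → 𝕜} {A : ℝ}
    (hb : ContinuousOn b (Ioi 0)) (hb0 : ∀ r, A ≤ r → b r = 0)
    (hf : ∀ r ≤ R, f r = 0) (hi : ∀ A, IntegrableOn f (Ioc 0 A)) :
    IntegrableOn (fun r => b r • f r) (Ioi 0) := by
  refine (integrableOn_smul_of_zero hR hb hf hi A).of_forall_sdiff_eq_zero measurableSet_Ioi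
    fun r hr => ?_
  have : A ≤ r := by
    by_contra h
    exact hr.2 ⟨hr.1, (not_le.1 h).le⟩
  simp only [hb0 r this, zero_smul]

lemma WeakDeriv.add (hR : 0 < R) {f g h k : ℝ → 𝕜} (hf : WeakDeriv R f h) (hg : WeakDeriv R g k) :
    WeakDeriv R (fun r => f r + g r) (fun r => h r + k r) := by
  refine ⟨fun r hr => by rw [hf.zero r hr, hg.zero r hr, add_zero],
    fun r hr => by rw [hf.zero' r hr, hg.zero' r hr, add_zero],
    fun A => (hf.int A).add (hg.int A), fun A => (hf.int' A).add (hg.int' A), ?_⟩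
  intro B b A hB hb hB0 hb0
  have hBc : ContinuousOn B (Ioi 0) := fun r hr => (hB r hr).continuousAt.continuousWithinAt
  simp only [smul_add]
  rw [integral_add (integrableOn_Ioi_smul_of_zero hR hb hb0 hf.zero hf.int)
    (integrableOn_Ioi_smul_of_zero hR hb hb0 hg.zero hg.int),
    integral_add (integrableOn_Ioi_smul_of_zero hR hBc hB0 hf.zero' hf.int')
    (integrableOn_Ioi_smul_of_zero hR hBc hB0 hg.zero' hg.int'),
    hf.ibp B b A hB hb hB0 hb0, hg.ibp B b A hB hb hB0 hb0, neg_add]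

/-- The product rule is dual to testing `f` against `B a`, whose derivative is `b a + B a'`. The
coefficient `a` may be singular at `0`, since `f` vanishes up to `R`. -/
lemma WeakDeriv.smul (hR : 0 < R) {f h : ℝ → 𝕜} (hf : WeakDeriv R f h) {a a' : ℝ → ℝ}
    (ha : ∀ r, 0 < r → HasDerivAt a (a' r) r) (ha' : ContinuousOn a' (Ioi 0)) :
    WeakDeriv R (fun r => a r • f r) (fun r => a' r • f r + a r • h r) := by
  have hac : ContinuousOn a (Ioi 0) := fun r hr => (ha r hr).continuousAt.continuousWithinAt
  refine ⟨fun r hr => by rw [hf.zero r hr, smul_zero],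
    fun r hr => by rw [hf.zero r hr, hf.zero' r hr, smul_zero, smul_zero, add_zero],
    integrableOn_smul_of_zero hR hac hf.zero hf.int,
    fun A => (integrableOn_smul_of_zero hR ha' hf.zero hf.int A).add
      (integrableOn_smul_of_zero hR hac hf.zero' hf.int' A), ?_⟩
  intro B b A hB hb hB0 hb0
  have hBc : ContinuousOn B (Ioi 0) := fun r hr => (hB r hr).continuousAt.continuousWithinAt
  have h1 := hf.ibp (fun r => B r * a r) (fun r => b r * a r + B r * a' r) A
    (fun r hr => (hB r hr).mul (ha r hr)) ((hb.mul hac).add (hBc.mul ha'))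
    (fun r hr => by simp [hB0 r hr]) (fun r hr => by simp [hB0 r hr, hb0 r hr])
  have i1 : IntegrableOn (fun r => (b r * a r) • f r) (Ioi 0) :=
    integrableOn_Ioi_smul_of_zero hR (A := A) (hb.mul hac) (fun r hr => by simp [hb0 r hr])
      hf.zero hf.int
  have i2 : IntegrableOn (fun r => (B r * a' r) • f r) (Ioi 0) :=
    integrableOn_Ioi_smul_of_zero hR (A := A) (hBc.mul ha') (fun r hr => by simp [hB0 r hr])
      hf.zero hf.int
  have i3 : IntegrableOn (fun r => (B r * a r) • h r) (Ioi 0) :=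
    integrableOn_Ioi_smul_of_zero hR (A := A) (hBc.mul hac) (fun r hr => by simp [hB0 r hr])
      hf.zero' hf.int'
  simp only [add_smul] at h1
  rw [integral_add i1 i2] at h1
  simp only [smul_add, smul_smul]
  rw [integral_add i2 i3, neg_add, ← h1]
  abel

lemma setIntegral_Ioi_sub_right {f : ℝ → 𝕜} (hR : 0 < R) (hf : ∀ r ≤ R, f r = 0) {t : ℝ}
    (ht : 0 ≤ t) (b : ℝ → ℝ) :
    ∫ r in Ioi (0 : ℝ), b r • f (r - t) = ∫ q in Ioi (0 : ℝ), b (q + t) • f q := by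
  rw [← integral_indicator measurableSet_Ioi, ← integral_indicator measurableSet_Ioi,
    ← integral_add_right_eq_self _ t]
  refine integral_congr_ae (Eventually.of_forall fun q => ?_)
  simp only [indicator, mem_Ioi, add_sub_cancel_right]
  by_cases h : 0 < q
  · simp [h, show 0 < q + t by linarith]
  · simp [h, hf q (by linarith)]

lemma integrableOn_sub_right {f : ℝ → 𝕜} (hR : 0 < R) (hf : ∀ r ≤ R, f r = 0)
    (hi : ∀ A, IntegrableOn f (Ioc 0 A)) {t : ℝ} (ht : 0 ≤ t) (A : ℝ) :
    IntegrableOn (fun r => f (r - t)) (Ioc 0 A) := by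
  have h1 := (integrable_indicator_iff measurableSet_Ioc).2 (hi A)
  have h2 := h1.comp_sub_right t
  refine (h2.integrableOn (s := Ioc 0 A)).congr_fun (fun r hr => ?_) measurableSet_Ioc
  simp only [indicator, mem_Ioc]
  by_cases h : 0 < r - t
  · rw [if_pos ⟨h, by linarith [hr.2]⟩]
  · rw [if_neg (by tauto), hf _ (by linarith)]

lemma WeakDeriv.shift (hR : 0 < R) {f h : ℝ → 𝕜} (hf : WeakDeriv R f h) {t : ℝ} (ht : 0 ≤ t) :
    WeakDeriv R (fun r => f (r - t)) (fun r => h (r - t)) := by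
  refine ⟨fun r hr => hf.zero _ (by linarith), fun r hr => hf.zero' _ (by linarith),
    integrableOn_sub_right hR hf.zero hf.int ht, integrableOn_sub_right hR hf.zero' hf.int' ht, ?_⟩
  intro B b A hB hb hB0 hb0
  rw [setIntegral_Ioi_sub_right hR hf.zero ht, setIntegral_Ioi_sub_right hR hf.zero' ht]
  refine hf.ibp (fun q => B (q + t)) (fun q => b (q + t)) A (fun q hq => ?_) ?_
    (fun q hq => hB0 _ (by linarith)) (fun q hq => hb0 _ (by linarith))
  · simpa using (hB (q + t) (by linarith)).comp_add_const q t
  · refine hb.comp (by fun_prop) fun q hq => ?_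
    have : 0 < q := hq
    exact show 0 < q + t by linarith

/-- Integration by parts against the primitive applies once the test function has been made regular
near the origin; there `f` and `k` vanish, so the change is invisible. -/
lemma weakDeriv_of_primitive (hR : 0 < R) {f k : ℝ → 𝕜} (hf : ∀ r ≤ R, f r = 0)
    (hk : ∀ r ≤ R, k r = 0) (hi : ∀ A, IntegrableOn k (Ioc 0 A))
    (hfk : ∀ᵐ r ∂(volume.restrict (Ioi (0 : ℝ))), f r = ∫ ρ in Ioc 0 r, k ρ) :
    WeakDeriv R f k := by
  refine ⟨hf, hk, fun A => ?_, hi, ?_⟩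
  · have h1 : ContinuousOn (fun r => ∫ ρ in Ioc 0 r, k ρ) (Icc 0 A) :=
      intervalIntegral.continuousOn_primitive ((integrableOn_Icc_iff_integrableOn_Ioc).2 (hi A))
    have h2 : IntegrableOn (fun r => ∫ ρ in Ioc 0 r, k ρ) (Ioc 0 A) :=
      (h1.integrableOn_Icc).mono_set Ioc_subset_Icc_self
    refine h2.congr ?_
    filter_upwards [ae_restrict_of_ae_restrict_of_subset
      (show Ioc 0 A ⊆ Ioi 0 from Ioc_subset_Ioi_self) hfk] with r hr
    exact hr.symm
  · intro B b A hB hb hB0 hb0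
    -- As `b` is continuous only on `(0, ∞)`, it is frozen at `b R` below `R`. Its primitive based
    -- at `M` agrees with `B` on `[R, ∞)`, because `B` vanishes at `M ≥ A`.
    set M := max A R with hM
    have hc : Continuous fun s => b (max s R) := by
      refine hb.comp_continuous (by fun_prop) fun s => ?_
      exact hR.trans_le (le_max_right _ _)
    have key := integral_deriv_smul_primitive (𝕜 := 𝕜) (A := M) (k := k)
      (B := fun r => ∫ s in M..r, b (max s R)) (b := fun s => b (max s R))
      (fun r => hc.integral_hasStrictDerivAt M r |>.hasDerivAt) hc
      (fun r hr => by
        refine intervalIntegral.integral_zero_ae (Eventually.of_forall fun s hs => ?_)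
        rw [uIoc_of_le hr] at hs
        exact hb0 _ (((le_max_left _ _).trans hs.1.le).trans (le_max_left _ _)))
      (fun r hr => hb0 _ (((le_max_left _ _).trans hr).trans (le_max_left _ _))) (hi M)
    have hBe : ∀ r, R ≤ r → ∫ s in M..r, b (max s R) = B r := by
      intro r hr
      have e : ∀ s ∈ uIcc M r, R ≤ s := fun s hs =>
        (le_min (le_max_right _ _) hr).trans hs.1
      rw [intervalIntegral.integral_eq_sub_of_hasDerivAt (f := B) (fun s hs => ?_)
        (hc.intervalIntegrable _ _), hB0 M (le_max_left _ _), sub_zero]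
      rw [max_eq_left (e s hs)]
      exact hB s (hR.trans_le (e s hs))
    have hprim : ∀ r, r ≤ R → ∫ ρ in Ioc 0 r, k ρ = 0 := fun r hr =>
      setIntegral_eq_zero_of_forall_eq_zero fun ρ hρ => hk ρ (hρ.2.trans hr)
    have e1 : ∫ r in Ioi (0 : ℝ), b r • f r =
        ∫ r in Ioi (0 : ℝ), b (max r R) • ∫ ρ in Ioc 0 r, k ρ := by
      refine integral_congr_ae ?_
      filter_upwards [hfk] with r hr
      rw [hr]
      rcases le_total r R with h | h
      · rw [hprim r h, smul_zero, smul_zero]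
      · rw [max_eq_left h]
    rw [e1, key]
    congr 1
    refine integral_congr_ae (Eventually.of_forall fun r => ?_)
    rcases le_total r R with h | h
    · simp only [hk r h, smul_zero]
    · simp only [hBe r h]

end weakDeriv

end OutgoingWave
end

/-! ### Radial test functions and weak gradients on `ℝ³` -/

noncomputable section

namespace OutgoingWave

variable {𝕜 : Type*} [RCLike 𝕜]

section radialTest

variable {ψ : ℝ → ℝ}

lemma eventually_eq_zero_of_tsupport (hs : tsupport ψ ⊆ Ioi 0) : ∀ᶠ r in 𝓝 (0 : ℝ), ψ r = 0 :=
  notMem_tsupport_iff_eventuallyEq.1 fun h => lt_irrefl (0 : ℝ) (hs h)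

lemma rad_eventuallyEq_zero (hs : tsupport ψ ⊆ Ioi 0) : rad ψ =ᶠ[𝓝 (0 : E3)] 0 := by
  have h : Tendsto (fun x : E3 => ‖x‖) (𝓝 0) (𝓝 0) := by
    simpa using (continuous_norm (E := E3)).tendsto 0
  exact h.eventually (eventually_eq_zero_of_tsupport hs)

lemma contDiff_rad {n : WithTop ℕ∞} (hψ : ContDiff ℝ n ψ) (hs : tsupport ψ ⊆ Ioi 0) :
    ContDiff ℝ n (rad ψ) := by
  refine contDiff_iff_contDiffAt.2 fun x => ?_
  by_cases hx : x = 0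
  · rw [hx]
    exact contDiffAt_const.congr_of_eventuallyEq (rad_eventuallyEq_zero hs)
  · exact hψ.contDiffAt.comp x (contDiffAt_norm ℝ hx)

lemma hasCompactSupport_rad (hc : HasCompactSupport ψ) : HasCompactSupport (rad ψ) := by
  obtain ⟨M, hM⟩ := hc.isCompact.isBounded.subset_closedBall (0 : ℝ)
  refine HasCompactSupport.intro (isCompact_closedBall (0 : E3) M) fun x hx => ?_
  refine image_eq_zero_of_notMem_tsupport (f := ψ) fun h => hx ?_
  have := hM h
  rw [mem_closedBall_zero_iff] at this ⊢
  simpa using this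

lemma hasFDerivAt_rad (hψ : Differentiable ℝ ψ) {x : E3} (hx : x ≠ 0) :
    HasFDerivAt (rad ψ) ((deriv ψ ‖x‖ * ‖x‖⁻¹) • innerSL ℝ x) x := by
  have hn : 0 < ‖x‖ := norm_pos_iff.2 hx
  have h1 := (hasStrictFDerivAt_norm_sq x).hasFDerivAt
  have h2 := (Real.hasDerivAt_sqrt (pow_pos hn 2).ne').comp_hasFDerivAt x h1
  have h3 : HasDerivAt ψ (deriv ψ ‖x‖) (√(‖x‖ ^ 2)) := by
    rw [Real.sqrt_sq hn.le]; exact (hψ _).hasDerivAt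
  have h4 := h3.comp_hasFDerivAt x h2
  have e : (ψ ∘ (Real.sqrt ∘ fun x : E3 => ‖x‖ ^ 2)) = rad ψ := by
    funext y; simp [rad, Real.sqrt_sq (norm_nonneg y)]
  rw [e] at h4
  convert! h4 using 1
  rw [Real.sqrt_sq hn.le]
  ext v
  simp only [_root_.smul_apply, smul_eq_mul, nsmul_eq_mul]
  push_cast
  field_simp

lemma fderiv_rad (hψ : Differentiable ℝ ψ) (hs : tsupport ψ ⊆ Ioi 0) (x : E3) (i : Fin 3) :
    fderiv ℝ (rad ψ) x (EuclideanSpace.single i 1) = (deriv ψ ‖x‖ * ‖x‖⁻¹) * x i := by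
  by_cases hx : x = 0
  · rw [hx, (rad_eventuallyEq_zero hs).fderiv_eq]
    simp
  · rw [(hasFDerivAt_rad hψ hx).fderiv]
    simp [EuclideanSpace.inner_single_right]

lemma hasFDerivAt_coord (i : Fin 3) (x : E3) :
    HasFDerivAt (fun y : E3 => y i) (EuclideanSpace.proj i : E3 →L[ℝ] ℝ) x :=
  (EuclideanSpace.proj i : E3 →L[ℝ] ℝ).hasFDerivAt

lemma contDiff_coord {n : WithTop ℕ∞} (i : Fin 3) : ContDiff ℝ n (fun y : E3 => y i) :=
  (EuclideanSpace.proj i : E3 →L[ℝ] ℝ).contDiff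

/-- The product of a test function with a coordinate. -/
def coordMul (i : Fin 3) (φ : TestFn) : TestFn where
  toFun x := x i * φ x
  contDiff' := (contDiff_coord i).mul φ.contDiff
  hasCompactSupport' := φ.hasCompactSupport.mul_left
  tsupport_subset' := subset_univ _

lemma coordMul_apply (i : Fin 3) (φ : TestFn) (x : E3) : coordMul i φ x = x i * φ x := rfl

/-- The radial test function with a given smooth profile. -/
def radTest (hψ : ContDiff ℝ ((⊤ : ℕ∞) : WithTop ℕ∞) ψ) (hc : HasCompactSupport ψ)
    (hs : tsupport ψ ⊆ Ioi 0) : TestFn where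
  toFun := rad ψ
  contDiff' := contDiff_rad hψ hs
  hasCompactSupport' := hasCompactSupport_rad hc
  tsupport_subset' := subset_univ _

lemma sphInt_smul_rad {F : Type*} [NormedAddCommGroup F] [NormedSpace ℝ F] (a : ℝ → ℝ)
    (G : E3 → F) {r : ℝ} (hr : 0 < r) :
    sphInt (fun x => a ‖x‖ • G x) r = a r • sphInt G r := by
  unfold sphInt
  simp only [norm_smul_sphere hr]
  rw [integral_smul]

lemma sphInt_rad (a : ℝ → ℝ) {r : ℝ} (hr : 0 < r) : sphInt (rad a) r = 4 * Real.pi * a r := by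
  unfold sphInt rad
  simp only [norm_smul_sphere hr, integral_const, sph_real_univ, smul_eq_mul]

end radialTest

section divergence

lemma continuous_fderiv_single (φ : TestFn) (i : Fin 3) :
    Continuous fun x => fderiv ℝ φ x (EuclideanSpace.single i 1) := by
  have hφ : ContDiff ℝ 1 φ := φ.contDiff.of_le (by simp)
  have := hφ.continuous_fderiv one_ne_zero
  fun_prop

lemma hasCompactSupport_fderiv_single (φ : TestFn) (i : Fin 3) :
    HasCompactSupport fun x => fderiv ℝ φ x (EuclideanSpace.single i 1) :=
  φ.hasCompactSupport.fderiv_apply ℝ _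

lemma locallyIntegrable_rad_continuous {a : ℝ → ℝ} (ha : Continuous a) :
    LocallyIntegrable (rad a) (volume : Measure E3) :=
  (ha.comp continuous_norm).locallyIntegrable

/-- The radial derivative of the flux of a test function through spheres. -/
lemma sphInt_radialDeriv_coordMul (φ : TestFn) (i : Fin 3) {r : ℝ} (hr : 0 < r) :
    sphInt (radialDeriv (coordMul i φ)) r
      = r ^ 2 * sphInt (fun x => fderiv ℝ φ x (EuclideanSpace.single i 1)) r := by
  set p : ℝ → ℝ := fun r => r ^ 2 * sphInt (fun x => fderiv ℝ φ x (EuclideanSpace.single i 1)) r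
    with hp
  have hpc : Continuous p :=
    (continuous_id.pow 2).mul (continuous_sphInt (continuous_fderiv_single φ i))
  have hqc : Continuous (sphInt (radialDeriv (coordMul i φ))) :=
    continuous_sphInt (continuous_radialDeriv _)
  -- This is the divergence theorem for `φ` times a coordinate vector, in weak form: the difference
  -- is tested against radial weights `g`, and the integration by parts takes place on `ℝ³`.
  -- Continuity removes the exceptional null set at the end.
  have hae : ∀ᵐ r, r ∈ Ioi (0 : ℝ) → p r - sphInt (radialDeriv (coordMul i φ)) r = 0 := by
    refine isOpen_Ioi.ae_eq_zero_of_integral_contDiff_smul_eq_zero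
      ((hpc.sub hqc).locallyIntegrable.locallyIntegrableOn _) fun g hg hgc hgs => ?_
    have hg1 : ContDiff ℝ 1 g := hg.of_le (by simp)
    have hgd : Differentiable ℝ g := hg1.differentiable one_ne_zero
    have hg'c : Continuous (deriv g) := hg1.continuous_deriv le_rfl
    have h0 : ∀ r, r ≤ 0 → g r = 0 := fun r hr =>
      image_eq_zero_of_notMem_tsupport fun h => absurd (hgs h) (not_lt.2 hr)
    obtain ⟨M, hM⟩ := hgc.isCompact.isBounded.subset_closedBall (0 : ℝ)
    have hφ1 : ContDiff ℝ 1 φ := φ.contDiff.of_le (by simp)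
    have hφd : Differentiable ℝ φ := hφ1.differentiable one_ne_zero
    -- integration by parts on space
    have hrc : ContDiff ℝ 1 (rad g) := contDiff_rad hg1 hgs
    have hrs := hasCompactSupport_rad hgc
    have ibp : ∫ x, φ x * fderiv ℝ (rad g) x (EuclideanSpace.single i 1)
        = -∫ x, fderiv ℝ φ x (EuclideanSpace.single i 1) * rad g x := by
      refine integral_mul_fderiv_eq_neg_fderiv_mul_of_integrable ?_ ?_ ?_
        (fun x _ => hφd x) (fun x _ => hrc.differentiable one_ne_zero x)
      · exact ((continuous_fderiv_single φ i).mul hrc.continuous).integrable_of_hasCompactSupport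
          hrs.mul_left
      · have : Continuous fun x => fderiv ℝ (rad g) x (EuclideanSpace.single i 1) := by
          have := hrc.continuous_fderiv one_ne_zero
          fun_prop
        exact (hφ1.continuous.mul this).integrable_of_hasCompactSupport
          φ.hasCompactSupport.mul_right
      · exact (hφ1.continuous.mul hrc.continuous).integrable_of_hasCompactSupport hrs.mul_left
    have e1 : ∫ x, fderiv ℝ φ x (EuclideanSpace.single i 1) * rad g x
        = ∫ r in Ioi (0 : ℝ), p r * g r :=
      integral_mul_rad (𝕜 := ℝ) (locallyIntegrable_rad_continuous hg1.continuous)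
        (continuous_fderiv_single φ i) (hasCompactSupport_fderiv_single φ i)
    -- The singular factor is harmless because the support of `g` stays away from `0`.
    have hquot : Continuous fun r => deriv g r * r⁻¹ := by
      refine continuous_of_tsupport fun r hr => ?_
      have hr0 : r ∈ tsupport g := (tsupport_deriv_subset (𝕜 := ℝ) (f := g))
        (tsupport_mul_subset_left hr)
      have hr1 : (0:ℝ) < r := hgs hr0
      exact hg'c.continuousAt.mul (continuousAt_inv₀ hr1.ne')
    have e2 : ∫ x, φ x * fderiv ℝ (rad g) x (EuclideanSpace.single i 1)
        = ∫ r in Ioi (0 : ℝ), (r * sphInt (coordMul i φ) r) * deriv g r := by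
      have : ∀ x : E3, φ x * fderiv ℝ (rad g) x (EuclideanSpace.single i 1)
          = coordMul i φ x • rad (fun r => deriv g r * r⁻¹) x := by
        intro x
        rw [fderiv_rad hgd hgs, coordMul_apply, rad, smul_eq_mul]
        ring
      simp only [this]
      rw [integral_mul_rad (locallyIntegrable_rad_continuous hquot)
        (coordMul i φ).contDiff.continuous (coordMul i φ).hasCompactSupport]
      refine setIntegral_congr_fun measurableSet_Ioi fun r hr => ?_
      have : r ≠ 0 := ne_of_gt hr
      simp only [smul_eq_mul]
      field_simp
    obtain ⟨A, hA0, hA⟩ := sphInt_eq_zero_of_large (coordMul i φ).hasCompactSupport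
    obtain ⟨A', hA0', hA'⟩ := sphInt_eq_zero_of_large (hasCompactSupport_radialDeriv (coordMul i φ))
    have e3 := integral_deriv_smul_primitive (𝕜 := ℝ) (A := max A A') (k := deriv g)
      (hasDerivAt_mul_sphInt (coordMul i φ)) hqc
      (fun r hr => by rw [hA r ((le_max_left _ _).trans hr), mul_zero])
      (fun r hr => hA' r ((le_max_right _ _).trans hr)) hg'c.integrableOn_Ioc
    have e4 : ∫ r in Ioi (0 : ℝ), sphInt (radialDeriv (coordMul i φ)) r * g r
        = ∫ r in Ioi (0 : ℝ), sphInt (radialDeriv (coordMul i φ)) r • ∫ ρ in Ioc 0 r, deriv g ρ := by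
      refine setIntegral_congr_fun measurableSet_Ioi fun r hr => ?_
      simp only [smul_eq_mul]
      rw [← intervalIntegral.integral_of_le (le_of_lt hr),
        intervalIntegral.integral_deriv_eq_sub (fun x _ => hgd x) (hg'c.intervalIntegrable _ _),
        h0 0 le_rfl, sub_zero]
    have hgi : ∀ q : ℝ → ℝ, Continuous q → IntegrableOn (fun r => q r * g r) (Ioi 0) := fun q hq =>
      ((hq.mul hg1.continuous).integrable_of_hasCompactSupport hgc.mul_left).integrableOn
    have e5 : ∫ r, g r • (p r - sphInt (radialDeriv (coordMul i φ)) r)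
        = ∫ r in Ioi (0:ℝ), (p r * g r - sphInt (radialDeriv (coordMul i φ)) r * g r) := by
      rw [← integral_indicator measurableSet_Ioi]
      refine integral_congr_ae (Eventually.of_forall fun r => ?_)
      by_cases h : 0 < r
      · rw [indicator_of_mem (show r ∈ Ioi 0 from h)]
        simp only [smul_eq_mul]; ring
      · rw [indicator_of_notMem (show r ∉ Ioi 0 from h)]
        simp only [h0 r (not_lt.1 h), zero_smul]
    rw [e5, integral_sub (hgi _ hpc) (hgi _ hqc), e4, e3, ← e1]
    simp only [smul_eq_mul]
    rw [← e2, ibp]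
    ring
  have hcl := Measure.eqOn_open_of_ae_eq (μ := volume) (U := Ioi (0:ℝ))
    (f := p) (g := sphInt (radialDeriv (coordMul i φ))) (by
      rw [EventuallyEq, ae_restrict_iff' measurableSet_Ioi]
      filter_upwards [hae] with r hr h
      linarith [hr h]) isOpen_Ioi hpc.continuousOn hqc.continuousOn
  exact (hcl hr).symm

/-- A radial function with a weakly differentiable profile is weakly differentiable. -/
lemma WeakDeriv.integral_fderiv_smul_rad {R : ℝ} (hR : 0 < R) {f h : ℝ → 𝕜}
    (hf : WeakDeriv R f h) (φ : TestFn) (i : Fin 3) :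
    ∫ x, fderiv ℝ φ x (EuclideanSpace.single i 1) • rad f x
      = -∫ x, φ x • ((x i * ‖x‖⁻¹) • rad h x) := by
  have hloc : ∀ k : ℝ → 𝕜, (∀ A, IntegrableOn k (Ioc 0 A)) →
      LocallyIntegrable (rad k) (volume : Measure E3) := fun k hk =>
    locallyIntegrable_rad fun M hM => by
      rw [intervalIntegrable_iff_integrableOn_Icc_of_le hM.le]
      exact ((integrableOn_Icc_iff_integrableOn_Ioc).2 (hk M)).continuousOn_smul
        (f := fun r : ℝ => r ^ 2) (by fun_prop) isCompact_Icc
  have hwi : ∀ A, IntegrableOn (fun r => r⁻¹ • h r) (Ioc 0 A) :=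
    integrableOn_smul_of_zero hR (continuousOn_inv₀.mono fun r hr => ne_of_gt hr) hf.zero' hf.int'
  have e1 : ∫ x, φ x • ((x i * ‖x‖⁻¹) • rad h x) =
      ∫ x, coordMul i φ x • rad (fun r => r⁻¹ • h r) x := by
    refine integral_congr_ae (Eventually.of_forall fun x => ?_)
    simp only [coordMul_apply, rad, smul_smul]
    congr 1; ring
  rw [e1, integral_mul_rad (hloc _ hf.int) (continuous_fderiv_single φ i)
    (hasCompactSupport_fderiv_single φ i), integral_mul_rad (hloc _ hwi)
    (coordMul i φ).contDiff.continuous (coordMul i φ).hasCompactSupport]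
  obtain ⟨A, hA0, hA⟩ := sphInt_eq_zero_of_large (coordMul i φ).hasCompactSupport
  obtain ⟨A', hA0', hA'⟩ := sphInt_eq_zero_of_large (hasCompactSupport_radialDeriv (coordMul i φ))
  have key := hf.ibp _ _ (max A A') (fun r _ => hasDerivAt_mul_sphInt (coordMul i φ) r)
    (continuous_sphInt (continuous_radialDeriv _)).continuousOn
    (fun r hr => by rw [hA r ((le_max_left _ _).trans hr), mul_zero])
    (fun r hr => hA' r ((le_max_right _ _).trans hr))
  have e2 : ∫ r in Ioi (0:ℝ), (r ^ 2 * sphInt (coordMul i φ) r) • (r⁻¹ • h r) =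
      ∫ r in Ioi (0:ℝ), (r * sphInt (coordMul i φ) r) • h r := by
    refine setIntegral_congr_fun measurableSet_Ioi fun r hr => ?_
    have : r ≠ 0 := ne_of_gt hr
    simp only [smul_smul]
    congr 1
    field_simp
  rw [e2, ← key]
  refine setIntegral_congr_fun measurableSet_Ioi fun r hr => ?_
  simp only [sphInt_radialDeriv_coordMul φ i hr]

end divergence

end OutgoingWave
end

/-! ### The radial derivative recovered from a weak gradient -/

noncomputable section

namespace OutgoingWave

variable {𝕜 : Type*} [RCLike 𝕜]

section duBoisReymond

/-- A smooth function that vanishes for `r ≤ R / 2` and equals `1` for `r ≥ R`. -/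
def cutoff (R r : ℝ) : ℝ := Real.smoothTransition (2 * r / R - 1)

lemma contDiff_cutoff (R : ℝ) {n : ℕ∞} : ContDiff ℝ n (cutoff R) :=
  Real.smoothTransition.contDiff.comp (by fun_prop)

lemma cutoff_of_le {R r : ℝ} (hR : 0 < R) (hr : r ≤ R / 2) : cutoff R r = 0 := by
  refine Real.smoothTransition.zero_of_nonpos ?_
  rw [sub_nonpos, div_le_one hR]
  linarith

lemma cutoff_of_ge {R r : ℝ} (hR : 0 < R) (hr : R ≤ r) : cutoff R r = 1 := by
  refine Real.smoothTransition.one_of_one_le ?_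
  rw [le_sub_iff_add_le, le_div_iff₀ hR]
  linarith

/-- The lemma of du Bois-Reymond on the half line, for functions vanishing near `0`. -/
lemma ae_eq_zero_of_integral_deriv_smul {R : ℝ} (hR : 0 < R) {F : ℝ → 𝕜} (hF : ∀ r ≤ R, F r = 0)
    (hi : ∀ A, IntegrableOn F (Ioc 0 A))
    (h : ∀ ψ : ℝ → ℝ, ContDiff ℝ ((⊤ : ℕ∞) : WithTop ℕ∞) ψ → HasCompactSupport ψ →
      tsupport ψ ⊆ Ioi 0 → ∫ r in Ioi (0 : ℝ), deriv ψ r • F r = 0) :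
    ∀ᵐ r, F r = 0 := by
  have hl : LocallyIntegrable F := by
    rw [locallyIntegrable_iff]
    intro k hk
    obtain ⟨M, hM⟩ := hk.isBounded.subset_closedBall (0 : ℝ)
    refine (hi M).of_forall_sdiff_eq_zero hk.measurableSet fun r hr => ?_
    refine hF r (not_lt.1 fun hlt => hr.2 ⟨hR.trans hlt, ?_⟩)
    have := hM hr.1
    rw [mem_closedBall_zero_iff, Real.norm_eq_abs] at this
    exact (le_abs_self r).trans this
  refine ae_eq_zero_of_integral_contDiff_smul_eq_zero hl fun g hg hgc => ?_
  obtain ⟨M, hM⟩ := hgc.isCompact.isBounded.subset_closedBall (0 : ℝ)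
  have hg0 : ∀ r, M < r → g r = 0 := fun r hr =>
    image_eq_zero_of_notMem_tsupport fun h => by
      have := hM h
      rw [mem_closedBall_zero_iff, Real.norm_eq_abs] at this
      linarith [le_abs_self r]
  have hder : ∀ r, HasDerivAt (fun r => ∫ s in M..r, g s) (g r) r := fun r =>
    (hg.continuous.integral_hasStrictDerivAt M r).hasDerivAt
  have hGs : ContDiff ℝ ((⊤ : ℕ∞) : WithTop ℕ∞) (fun r => ∫ s in M..r, g s) := by
    rw [contDiff_infty_iff_deriv]
    refine ⟨fun r => (hder r).differentiableAt, ?_⟩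
    rw [show deriv (fun r => ∫ s in M..r, g s) = g from funext fun r => (hder r).deriv]
    exact hg
  have hG0 : ∀ r, M ≤ r → ∫ s in M..r, g s = 0 := fun r hr =>
    intervalIntegral.integral_zero_ae (Eventually.of_forall fun s hs => by
      rw [uIoc_of_le hr] at hs
      exact hg0 s hs.1)
  -- The primitive of `g` vanishes for large `r` but perhaps not near `0`. The cutoff makes it
  -- admissible and does not affect the integral, since `F` vanishes for `r ≤ R` and the cutoff is
  -- `1` beyond `R`.
  set ψ : ℝ → ℝ := fun r => cutoff R r * ∫ s in M..r, g s with hψ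
  have hsub : Function.support ψ ⊆ Icc (R / 2) M := by
    intro r hr
    constructor
    · by_contra hlt
      exact hr (by simp only [hψ, cutoff_of_le hR (not_le.1 hlt).le, zero_mul])
    · by_contra hlt
      exact hr (by simp only [hψ, hG0 r (not_le.1 hlt).le, mul_zero])
  have hts : tsupport ψ ⊆ Icc (R / 2) M := closure_minimal hsub isClosed_Icc
  have key := h ψ ((contDiff_cutoff R).mul hGs)
    (HasCompactSupport.intro isCompact_Icc fun r hr => by
      by_contra h'
      exact hr (hsub h'))
    fun r hr => (half_pos hR).trans_le (hts hr).1
  rw [← key, ← integral_indicator measurableSet_Ioi]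
  refine integral_congr_ae ?_
  have hne : ∀ᵐ r : ℝ, r ≠ R := by simp [ae_iff]
  filter_upwards [hne] with r hr
  rcases lt_or_gt_of_ne hr with h1 | h1
  · simp [indicator, hF r h1.le]
  · rw [indicator_of_mem (show r ∈ Ioi 0 from hR.trans h1)]
    congr 1
    refine (HasDerivAt.deriv ((hder r).congr_of_eventuallyEq ?_)).symm
    filter_upwards [lt_mem_nhds h1] with s hs
    simp only [hψ, cutoff_of_ge hR hs.le, one_mul]

end duBoisReymond

section gradient

lemma sq_lintegral_le {X : Type*} [MeasurableSpace X] {μ : Measure X} {F : X → ℝ≥0∞}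
    (hF : AEMeasurable F μ) : (∫⁻ x, F x ∂μ) ^ 2 ≤ μ univ * ∫⁻ x, F x ^ 2 ∂μ := by
  have h1 := ENNReal.lintegral_mul_le_Lp_mul_Lq μ (p := 2) (q := 2)
    (by constructor <;> norm_num) hF (aemeasurable_const (b := (1 : ℝ≥0∞)))
  simp only [Pi.mul_apply, mul_one, ENNReal.one_rpow, lintegral_const, one_mul] at h1
  refine (pow_le_pow_left₀ zero_le h1 2).trans (le_of_eq ?_)
  rw [mul_pow, ← ENNReal.rpow_natCast, ← ENNReal.rpow_natCast, ← ENNReal.rpow_mul,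
    ← ENNReal.rpow_mul, mul_comm]
  norm_num

lemma enorm_sphInt_sq_le (H : E3 → 𝕜) (hH : StronglyMeasurable H) (r : ℝ) :
    ‖sphInt H r‖ₑ ^ 2 ≤ ENNReal.ofReal (4 * Real.pi) *
      ∫⁻ ω : Metric.sphere (0 : E3) 1, ‖H (r • (ω : E3))‖ₑ ^ 2 ∂sph := by
  have hm : AEMeasurable (fun ω : Metric.sphere (0 : E3) 1 => ‖H (r • (ω : E3))‖ₑ) sph :=
    (hH.comp_measurable (by fun_prop : Measurable fun ω : Metric.sphere (0 : E3) 1 =>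
      r • (ω : E3))).enorm.aemeasurable
  rw [← sph_univ]
  exact (pow_le_pow_left₀ zero_le (enorm_integral_le_lintegral_enorm _) 2).trans
    (sq_lintegral_le hm)

lemma stronglyMeasurable_sphInt {H : E3 → 𝕜} (hH : StronglyMeasurable H) :
    StronglyMeasurable (sphInt H) := by
  have : StronglyMeasurable fun p : ℝ × Metric.sphere (0 : E3) 1 => H (p.1 • (p.2 : E3)) :=
    hH.comp_measurable (by fun_prop)
  exact this.integral_prod_right

/-- Cauchy-Schwarz on each sphere costs the factor `4π`; integrating against `r² dr` then gives the
squared `L²(ℝ³)` norm of `H`. -/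
lemma lintegral_sphInt_sq_lt_top {H : E3 → 𝕜} (hH : StronglyMeasurable H)
    (h2 : MemLp H 2 volume) :
    ∫⁻ r in Ioi (0 : ℝ), ‖r • sphInt H r‖ₑ ^ 2 < ⊤ := by
  have hfin : ∫⁻ x, ‖H x‖ₑ ^ 2 < ⊤ := by
    have := lintegral_rpow_enorm_lt_top_of_eLpNorm_lt_top (by norm_num) (by norm_num) h2.2
    simpa using this
  have hm : Measurable fun x => ‖H x‖ₑ ^ 2 := hH.enorm.pow_const 2
  rw [lintegral_polar hm] at hfin
  have hle : ∫⁻ r in Ioi (0 : ℝ), ‖r • sphInt H r‖ₑ ^ 2 ≤ ENNReal.ofReal (4 * Real.pi) *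
      ∫⁻ r in Ioi (0 : ℝ), ENNReal.ofReal (r ^ 2) *
        ∫⁻ ω : Metric.sphere (0 : E3) 1, ‖H (r • (ω : E3))‖ₑ ^ 2 ∂sph := by
    rw [← lintegral_const_mul' _ _ ENNReal.ofReal_ne_top]
    refine setLIntegral_mono' measurableSet_Ioi fun r hr => ?_
    have hr0 : 0 ≤ r := le_of_lt hr
    rw [enorm_smul, mul_pow, Real.enorm_of_nonneg hr0, ← ENNReal.ofReal_pow hr0, mul_left_comm]
    gcongr
    exact enorm_sphInt_sq_le H hH r
  exact hle.trans_lt (ENNReal.mul_lt_top ENNReal.ofReal_lt_top hfin)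

lemma integrableOn_of_sq {k : ℝ → 𝕜} (hk : StronglyMeasurable k)
    (h2 : ∫⁻ r in Ioi (0 : ℝ), ‖k r‖ₑ ^ 2 < ⊤) (A : ℝ) : IntegrableOn k (Ioc 0 A) := by
  have hm : MemLp k 2 (volume.restrict (Ioi 0)) := by
    refine ⟨hk.aestronglyMeasurable, ?_⟩
    rw [eLpNorm_lt_top_iff_lintegral_rpow_enorm_lt_top (by norm_num) (by norm_num)]
    simpa using h2
  have hm2 : MemLp k 2 (volume.restrict (Ioc 0 A)) :=
    hm.mono_measure (Measure.restrict_mono_set _ Ioc_subset_Ioi_self)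
  exact hm2.integrable (by norm_num)

/-- The radial derivative of a radial function with square integrable weak gradient. -/
lemma HdotOneLE.exists_weakDeriv {R : ℝ} (hR : 0 < R) {f : ℝ → 𝕜} {K : ℝ}
    (hf0 : ∀ r ≤ R, f r = 0) (hfi : ∀ A, IntegrableOn f (Ioc 0 A)) (hf : HdotOneLE (rad f) K) :
    ∃ h : ℝ → 𝕜, StronglyMeasurable h ∧ WeakDeriv R f h ∧
      ∫⁻ r in Ioi (0 : ℝ), ‖r • h r‖ₑ ^ 2 < ⊤ := by
  obtain ⟨-, g, hg2, hg, -⟩ := hf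
  have hfl : LocallyIntegrable (rad f) (volume : Measure E3) :=
    locallyIntegrable_rad fun M hM => by
      rw [intervalIntegrable_iff_integrableOn_Icc_of_le hM.le]
      exact ((integrableOn_Icc_iff_integrableOn_Ioc).2 (hfi M)).continuousOn_smul
        (f := fun r : ℝ => r ^ 2) (by fun_prop) isCompact_Icc
  choose G hGm hGe using fun i => (hg2 i).1
  have hG2 : ∀ i, MemLp (G i) 2 volume := fun i => (hg2 i).ae_eq (hGe i)
  have hHi : ∀ i, StronglyMeasurable fun x : E3 => (x i * ‖x‖⁻¹) • G i x := fun i =>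
    (by fun_prop : Measurable fun x : E3 => x i * ‖x‖⁻¹).stronglyMeasurable.smul (hGm i)
  have hxi : ∀ (x : E3) (i : Fin 3), ‖x i * ‖x‖⁻¹‖ ≤ 1 := fun x i => by
    rw [norm_mul, norm_inv, norm_norm, ← div_eq_mul_inv]
    exact div_le_one_of_le₀ (PiLp.norm_apply_le x i) (norm_nonneg _)
  -- `H` is the radial component of the weak gradient, and its mean over spheres is the candidate
  -- for the radial derivative of `f`.
  set H : E3 → 𝕜 := fun x => ∑ i, (x i * ‖x‖⁻¹) • G i x with hHdef
  have hHm : StronglyMeasurable H := Finset.stronglyMeasurable_fun_sum _ fun i _ => hHi i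
  have hH2 : MemLp H 2 volume := by
    refine memLp_finsetSum _ fun i _ => (hG2 i).of_le (hHi i).aestronglyMeasurable
      (Eventually.of_forall fun x => ?_)
    rw [norm_smul]
    exact mul_le_of_le_one_left (norm_nonneg _) (hxi x i)
  have hHl : LocallyIntegrable H volume := hH2.locallyIntegrable (by norm_num)
  set h : ℝ → 𝕜 := fun r => (4 * Real.pi)⁻¹ • sphInt H r with hhdef
  have hhm : StronglyMeasurable h := (stronglyMeasurable_sphInt hHm).const_smul _
  have hh2 : ∫⁻ r in Ioi (0 : ℝ), ‖r • h r‖ₑ ^ 2 < ⊤ := by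
    have e : ∀ r : ℝ, ‖r • h r‖ₑ ^ 2 = ‖((4 * Real.pi)⁻¹ : ℝ)‖ₑ ^ 2 * ‖r • sphInt H r‖ₑ ^ 2 := by
      intro r
      rw [hhdef]
      simp only
      rw [smul_comm, enorm_smul, mul_pow]
    simp only [e]
    rw [lintegral_const_mul' _ _ (ENNReal.pow_ne_top enorm_ne_top)]
    exact ENNReal.mul_lt_top (ENNReal.pow_lt_top enorm_lt_top) (lintegral_sphInt_sq_lt_top hHm hH2)
  have hpi : (4 * Real.pi) ≠ 0 := by positivity
  -- the weak derivative for smooth tests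
  have hweak : ∀ η : ℝ → ℝ, ContDiff ℝ ((⊤ : ℕ∞) : WithTop ℕ∞) η → HasCompactSupport η →
      tsupport η ⊆ Ioi 0 →
      ∫ r in Ioi (0 : ℝ), (r ^ 2 * (3 * η r + r * deriv η r)) • f r
        = -∫ r in Ioi (0 : ℝ), (r ^ 3 * η r) • h r := by
    intro η hη hηc hηs
    have hη1 : ContDiff ℝ 1 η := hη.of_le (by simp)
    have hηd : Differentiable ℝ η := hη1.differentiable one_ne_zero
    have hη'c : Continuous (deriv η) := hη1.continuous_deriv le_rfl
    set Φ : TestFn := radTest hη hηc hηs with hΦ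
    have hd : ∀ (x : E3) (i : Fin 3), fderiv ℝ (coordMul i Φ) x (EuclideanSpace.single i 1)
        = η ‖x‖ + x i * (deriv η ‖x‖ * ‖x‖⁻¹ * x i) := by
      intro x i
      have h1 := (hasFDerivAt_coord i x).mul
        ((contDiff_rad hη1 hηs).differentiable one_ne_zero x).hasFDerivAt
      have h2 : fderiv ℝ (coordMul i Φ) x = _ := h1.fderiv
      rw [h2]
      simp only [_root_.add_apply, _root_.smul_apply, smul_eq_mul, fderiv_rad hηd hηs]
      simp [rad]
      ring
    -- The weak gradient is tested against the vector field `x η(|x|)`, whose divergence is `3η + r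
    -- η'`.
    have hdiv : ∀ x : E3, ∑ i, fderiv ℝ (coordMul i Φ) x (EuclideanSpace.single i 1)
        = rad (fun r => 3 * η r + r * deriv η r) x := by
      intro x
      simp only [hd, rad, Finset.sum_add_distrib, Finset.sum_const, Finset.card_univ,
        Fintype.card_fin, nsmul_eq_mul]
      have e1 : ∑ i, x i * (deriv η ‖x‖ * ‖x‖⁻¹ * x i) = deriv η ‖x‖ * ‖x‖⁻¹ * ∑ i, x i ^ 2 := by
        rw [Finset.mul_sum]
        exact Finset.sum_congr rfl fun i _ => by ring
      rw [e1, ← EuclideanSpace.real_norm_sq_eq]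
      by_cases hx : ‖x‖ = 0
      · simp [hx]
      · push_cast; field_simp
    have hq : Continuous fun r => 3 * η r + r * deriv η r := by
      have := hη.continuous
      fun_prop
    have e1 : ∫ x, rad (fun r => 3 * η r + r * deriv η r) x • rad f x
        = -∫ x, (‖x‖ * η ‖x‖) • H x := by
      have i1 : ∀ i, Integrable fun x => fderiv ℝ (coordMul i Φ) x (EuclideanSpace.single i 1) •
          rad f x := fun i =>
        integrable_mul_rad hfl (continuous_fderiv_single _ i) (hasCompactSupport_fderiv_single _ i)
      have i2 : ∀ i, Integrable fun x => coordMul i Φ x • G i x := fun i =>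
        ((hG2 i).locallyIntegrable (by norm_num)).integrable_smul_left_of_hasCompactSupport
          (coordMul i Φ).contDiff.continuous (coordMul i Φ).hasCompactSupport
      have e2 : ∀ x, (‖x‖ * η ‖x‖) • H x = ∑ i, coordMul i Φ x • G i x := by
        intro x
        rw [hHdef, Finset.smul_sum]
        refine Finset.sum_congr rfl fun i _ => ?_
        rw [smul_smul, coordMul_apply]
        congr 1
        change _ = x i * η ‖x‖
        by_cases hx : ‖x‖ = 0
        · have : x = 0 := norm_eq_zero.1 hx
          simp [this]
        · field_simp
      simp only [← hdiv, e2, Finset.sum_smul]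
      rw [integral_finsetSum _ fun i _ => i1 i, integral_finsetSum _ fun i _ => i2 i,
        ← Finset.sum_neg_distrib]
      refine Finset.sum_congr rfl fun i _ => ?_
      rw [hg i]
      congr 1
      refine integral_congr_ae ?_
      filter_upwards [hGe i] with x hx
      rw [hx]
    have hqs : HasCompactSupport fun r => 3 * η r + r * deriv η r :=
      (hηc.mul_left (f := fun _ => (3 : ℝ))).add (hηc.deriv.mul_left)
    have hqn : Continuous (rad (fun r => 3 * η r + r * deriv η r) : E3 → ℝ) :=
      hq.comp continuous_norm
    rw [integral_mul_rad hfl hqn (hasCompactSupport_rad hqs)] at e1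
    have hηr : Continuous fun r => r * η r := by
      have := hη.continuous
      fun_prop
    have i3 : Integrable fun x => (‖x‖ * η ‖x‖) • H x :=
      hHl.integrable_smul_left_of_hasCompactSupport (hηr.comp continuous_norm)
        (hasCompactSupport_rad (ψ := fun r => r * η r) hηc.mul_left)
    rw [integral_polar i3] at e1
    have e3 : ∫ r in Ioi (0:ℝ), (r ^ 2 * sphInt (rad fun r => 3 * η r + r * deriv η r) r) • f r
        = (4 * Real.pi) • ∫ r in Ioi (0 : ℝ), (r ^ 2 * (3 * η r + r * deriv η r)) • f r := by
      rw [← integral_smul]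
      refine setIntegral_congr_fun measurableSet_Ioi fun r hr => ?_
      simp only [sphInt_rad _ hr, smul_smul]
      congr 1; ring
    have e4 : ∫ r in Ioi (0:ℝ), r ^ 2 • sphInt (fun x => (‖x‖ * η ‖x‖) • H x) r
        = (4 * Real.pi) • ∫ r in Ioi (0 : ℝ), (r ^ 3 * η r) • h r := by
      rw [← integral_smul]
      refine setIntegral_congr_fun measurableSet_Ioi fun r hr => ?_
      simp only [sphInt_smul_rad (fun r => r * η r) H hr, hhdef, smul_smul]
      congr 1; field_simp
    rw [e3, e4, ← smul_neg] at e1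
    exact smul_right_injective 𝕜 hpi e1
  have hki : ∀ A, IntegrableOn (fun r => r • h r) (Ioc 0 A) :=
    integrableOn_of_sq (stronglyMeasurable_id.smul hhm) hh2
  -- `h` vanishes near the origin
  have hzero : ∀ᵐ r, r ∈ Ioo 0 R → h r = 0 := by
    have hloc : LocallyIntegrableOn (fun r : ℝ => r ^ 3 • h r) (Ioo 0 R) := by
      have h1 : IntegrableOn (fun r : ℝ => r ^ 2 • (r • h r)) (Icc 0 R) :=
        ((integrableOn_Icc_iff_integrableOn_Ioc).2 (hki R)).continuousOn_smul
          (f := fun r : ℝ => r ^ 2) (by fun_prop) isCompact_Icc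
      refine IntegrableOn.locallyIntegrableOn ((h1.mono_set Ioo_subset_Icc_self).congr_fun
        (fun r _ => ?_) measurableSet_Ioo)
      simp only [smul_smul]
      congr 1
    have := isOpen_Ioo.ae_eq_zero_of_integral_contDiff_smul_eq_zero hloc fun η hη hηc hηs => by
      have h0 : ∀ r, r ∉ Ioo 0 R → η r = 0 := fun r hr =>
        image_eq_zero_of_notMem_tsupport fun h => hr (hηs h)
      have h1 := hweak η hη hηc (hηs.trans Ioo_subset_Ioi_self)
      have h2 : ∫ r in Ioi (0 : ℝ), (r ^ 2 * (3 * η r + r * deriv η r)) • f r = 0 := by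
        refine setIntegral_eq_zero_of_forall_eq_zero fun r hr => ?_
        rcases le_or_gt r R with hle | hlt
        · rw [hf0 r hle, smul_zero]
        · have hn : r ∉ tsupport η := fun h => absurd (hηs h).2 (not_lt.2 hlt.le)
          have h3 : η =ᶠ[𝓝 r] 0 := notMem_tsupport_iff_eventuallyEq.1 hn
          rw [h3.eq_of_nhds, h3.deriv_eq]
          simp
      rw [h2, eq_comm, neg_eq_zero] at h1
      rw [← h1, ← integral_indicator measurableSet_Ioi]
      refine integral_congr_ae (Eventually.of_forall fun r => ?_)
      by_cases hr : 0 < r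
      · rw [indicator_of_mem (show r ∈ Ioi 0 from hr)]
        simp only [smul_smul]
        congr 1; ring
      · rw [indicator_of_notMem (show r ∉ Ioi 0 from hr)]
        simp only [h0 r (fun h => hr h.1), zero_smul]
    filter_upwards [this] with r hr hr0
    have hr3 : r ^ 3 ≠ 0 := pow_ne_zero _ hr0.1.ne'
    exact (smul_eq_zero.1 (hr hr0)).resolve_left hr3
  set h' : ℝ → 𝕜 := (Ioi R).indicator h with hh'
  have hh'm : StronglyMeasurable h' := hhm.indicator measurableSet_Ioi
  have hh'0 : ∀ r ≤ R, h' r = 0 := fun r hr => indicator_of_notMem (not_lt.2 hr) _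
  have hh'e : ∀ᵐ r ∂(volume.restrict (Ioi (0 : ℝ))), h' r = h r := by
    rw [ae_restrict_iff' measurableSet_Ioi]
    have hne : ∀ᵐ r : ℝ, r ≠ R := by simp [ae_iff]
    filter_upwards [hzero, hne] with r hr hrR hr0
    rcases lt_or_gt_of_ne hrR with h1 | h1
    · rw [hh'0 r h1.le, hr ⟨hr0, h1⟩]
    · exact indicator_of_mem (show r ∈ Ioi R from h1) _
  have hh'i : ∀ A, IntegrableOn h' (Ioc 0 A) := fun A => by
    have h1 := integrableOn_smul_of_zero (f := fun r => r • h' r) hR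
      (continuousOn_inv₀.mono fun r (hr : r ∈ Ioi (0 : ℝ)) => ne_of_gt hr)
      (fun r hr => by rw [hh'0 r hr, smul_zero]) (fun A => (hki A).congr (by
        filter_upwards [ae_restrict_of_ae_restrict_of_subset
          (show Ioc 0 A ⊆ Ioi 0 from Ioc_subset_Ioi_self) hh'e] with r hr
        rw [hr])) A
    refine h1.congr_fun (fun r hr => ?_) measurableSet_Ioc
    exact inv_smul_smul₀ hr.1.ne' _
  -- The function `f - P` vanishes up to `R` and has zero derivative in the weak sense. The lemma of
  -- du Bois-Reymond therefore identifies `f` with the primitive `P` almost everywhere.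
  set P : ℝ → 𝕜 := fun r => ∫ ρ in Ioc 0 r, h' ρ with hPdef
  have hP0 : ∀ r ≤ R, P r = 0 := fun r hr =>
    setIntegral_eq_zero_of_forall_eq_zero fun ρ hρ => hh'0 ρ (hρ.2.trans hr)
  have hPw : WeakDeriv R P h' := weakDeriv_of_primitive hR hP0 hh'0 hh'i
    (Eventually.of_forall fun _ => rfl)
  have hfP : ∀ᵐ r, f r - P r = 0 := by
    refine ae_eq_zero_of_integral_deriv_smul hR (fun r hr => by rw [hf0 r hr, hP0 r hr, sub_zero])
      (fun A => (hfi A).sub (hPw.int A)) fun ψ hψ hψc hψs => ?_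
    have hψ1 : ContDiff ℝ 1 ψ := hψ.of_le (by simp)
    have hψd : Differentiable ℝ ψ := hψ1.differentiable one_ne_zero
    have hψ'c : Continuous (deriv ψ) := hψ1.continuous_deriv le_rfl
    obtain ⟨M, hM⟩ := hψc.isCompact.isBounded.subset_closedBall (0 : ℝ)
    have hM0 : ∀ r, M + 1 ≤ r → r ∉ tsupport ψ := fun r hr h => by
      have := hM h
      rw [mem_closedBall_zero_iff, Real.norm_eq_abs] at this
      linarith [le_abs_self r]
    have hψ0 : ∀ r, M + 1 ≤ r → ψ r = 0 := fun r hr =>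
      image_eq_zero_of_notMem_tsupport (hM0 r hr)
    have hψ'0 : ∀ r, M + 1 ≤ r → deriv ψ r = 0 := fun r hr =>
      image_eq_zero_of_notMem_tsupport fun h => hM0 r hr (tsupport_deriv_subset h)
    -- The choice `η = ψ / r³` turns `r² (3η + r η')` into `ψ'` and `r³ η` into `ψ`. It is smooth
    -- because `ψ` vanishes near `0`.
    have hsm : ContDiff ℝ ((⊤ : ℕ∞) : WithTop ℕ∞) fun r => ψ r * (r ^ 3)⁻¹ := by
      refine contDiff_iff_contDiffAt.2 fun r => ?_
      by_cases hr : r ∈ tsupport ψ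
      · have hr0 : (0 : ℝ) < r := hψs hr
        exact hψ.contDiffAt.mul ((contDiffAt_id.pow 3).inv (pow_pos hr0 3).ne')
      · have h3 : ψ =ᶠ[𝓝 r] 0 := notMem_tsupport_iff_eventuallyEq.1 hr
        refine (contDiffAt_const (c := (0 : ℝ))).congr_of_eventuallyEq ?_
        filter_upwards [h3] with s hs
        simp [hs]
    have h1 := hweak _ hsm hψc.mul_right ((tsupport_mul_subset_left).trans hψs)
    have h2 := hPw.ibp ψ (deriv ψ) (M + 1) (fun r _ => (hψd r).hasDerivAt) hψ'c.continuousOn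
      hψ0 hψ'0
    simp only [smul_sub]
    rw [integral_sub (integrableOn_Ioi_smul_of_zero hR hψ'c.continuousOn hψ'0 hf0 hfi)
      (integrableOn_Ioi_smul_of_zero hR hψ'c.continuousOn hψ'0 hPw.zero hPw.int), h2, sub_neg_eq_add]
    have e1 : ∫ r in Ioi (0 : ℝ), deriv ψ r • f r = ∫ r in Ioi (0 : ℝ),
        (r ^ 2 * (3 * (ψ r * (r ^ 3)⁻¹) + r * deriv (fun r => ψ r * (r ^ 3)⁻¹) r)) • f r := by
      refine setIntegral_congr_fun measurableSet_Ioi fun r hr => ?_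
      have hr0 : r ≠ 0 := ne_of_gt hr
      have hd := ((hψd r).hasDerivAt.mul ((hasDerivAt_pow 3 r).inv (pow_ne_zero 3 hr0))).deriv
      have hd' : deriv (fun r => ψ r * (r ^ 3)⁻¹) r = _ := hd
      simp only [hd']
      congr 1
      simp
      field_simp
      ring
    have e2 : ∫ r in Ioi (0 : ℝ), ψ r • h' r =
        ∫ r in Ioi (0 : ℝ), (r ^ 3 * (ψ r * (r ^ 3)⁻¹)) • h r := by
      refine integral_congr_ae ?_
      filter_upwards [hh'e, ae_restrict_mem measurableSet_Ioi] with r hr hr0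
      have hr0' : r ≠ 0 := ne_of_gt hr0
      rw [hr]
      congr 1
      field_simp
    rw [e1, h1, e2, neg_add_cancel]
  refine ⟨h', hh'm, weakDeriv_of_primitive hR hf0 hh'0 hh'i ?_, ?_⟩
  · refine ae_restrict_of_ae ?_
    filter_upwards [hfP] with r hr
    exact sub_eq_zero.1 hr
  · refine lt_of_le_of_lt (le_of_eq (lintegral_congr_ae ?_)) hh2
    filter_upwards [hh'e] with r hr
    rw [hr]

end gradient

end OutgoingWave
end

/-! ### Persistence of boundedness and decay -/

noncomputable section

namespace OutgoingWave

variable {𝕜 : Type*} [RCLike 𝕜]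

section pointwise

variable {N R T A K : ℝ} {u₀ : ℝ → 𝕜}

lemma ae_sub_right {P : ℝ → Prop} (h : ∀ᵐ q, P q) (t : ℝ) : ∀ᵐ r, P (r - t) :=
  (measurePreserving_sub_right volume t).quasiMeasurePreserving.ae h

/-- The weight grows at most linearly. -/
lemma gr_le_mul {t : ℝ} (hN : 2 < N) (hR : 0 < R) (ht : 0 ≤ t) :
    gr N R t ≤ gr N R 0 / R * (R + t) := by
  have hN2 : 0 < N + 2 := by linarith
  have hb : (N - 1) / (N + 2) ≤ 1 := by rw [div_le_one hN2]; linarith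
  have hle : 1 ≤ (R + t) / R := by rw [one_le_div hR]; linarith
  have h1 : gr N R t = gr N R 0 * ((R + t) / R) ^ ((N - 1) / (N + 2)) := by
    unfold gr
    rw [add_zero, ← Real.mul_rpow hR.le (by positivity)]
    congr 1; field_simp
  have h2 : ((R + t) / R) ^ ((N - 1) / (N + 2)) ≤ (R + t) / R := by
    simpa using Real.rpow_le_rpow_of_exponent_le hle hb
  calc gr N R t ≤ gr N R 0 * ((R + t) / R) := by
        rw [h1]
        exact mul_le_mul_of_nonneg_left h2 (gr_pos hR le_rfl).le
    _ = gr N R 0 / R * (R + t) := by ring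

lemma norm_sol_le (hR : 0 < R) (hu0 : ∀ q ≤ R, u₀ q = 0)
    (hD : Corr N R T A (picLim N (mulId u₀))) {t : ℝ} (ht : t ∈ Icc 0 T) {r : ℝ}
    (hm : ‖mulId u₀ (r - t)‖ ≤ K) :
    ‖sol N u₀ t r‖ ≤ if R + t < r then (K + A * gr N R t) / r else 0 := by
  have hg := gr_pos (N := N) hR ht.1
  unfold sol prof
  by_cases h : R + t < r
  · have hr : 0 < r := by linarith [ht.1]
    rw [if_pos (by linarith), if_pos h, norm_smul, Real.norm_eq_abs, abs_of_pos (inv_pos.2 hr),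
      inv_mul_eq_div]
    gcongr
    exact (norm_add_le _ _).trans (add_le_add hm (hD.bound _ t ht))
  · rw [if_neg h]
    split_ifs
    · have h1 : mulId u₀ (r - t) = 0 := by rw [mulId, hu0 _ (by linarith), smul_zero]
      simp [h1, hD.zero _ (show r - t ≤ R by linarith)]
    · simp

/-- On the support `r > R + t`, so the linear growth of the weight is absorbed by the division by
`r`, while `(r - t)/r ≤ 1` handles the free part. The bound contains neither `t` nor `T`, which is
what the global statement needs. -/
lemma LpNorm_top_sol_le (hN : 2 < N) (hR : 0 < R) (hA : 0 ≤ A) (hK : 0 ≤ K)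
    (hu0 : ∀ q ≤ R, u₀ q = 0) (hu : ∀ᵐ q, ‖u₀ q‖ ≤ K)
    (hD : Corr N R T A (picLim N (mulId u₀))) {t : ℝ} (ht : t ∈ Icc 0 T) :
    LpNorm ⊤ (sol N u₀ t) ≤ ENNReal.ofReal (K + A * (gr N R 0 / R)) := by
  have hg0 := gr_pos (N := N) hR le_rfl
  unfold LpNorm
  rw [eLpNorm_exponent_top]
  refine eLpNormEssSup_le_of_ae_bound (ae_norm_iff
    (P := fun r => ‖sol N u₀ t r‖ ≤ K + A * (gr N R 0 / R)).2 (ae_restrict_of_ae ?_))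
  filter_upwards [ae_sub_right hu t] with r hr
  have hmul : ‖mulId u₀ (r - t)‖ ≤ |r - t| * K := by
    rw [mulId, norm_smul, Real.norm_eq_abs]
    gcongr
  refine (norm_sol_le hR hu0 hD ht hmul).trans ?_
  split_ifs with h
  · have hr0 : 0 < r := by linarith [ht.1]
    rw [div_le_iff₀ hr0, abs_of_pos (by linarith)]
    have h1 : A * gr N R t ≤ A * (gr N R 0 / R * r) := by
      refine mul_le_mul_of_nonneg_left ((gr_le_mul hN hR ht.1).trans ?_) hA
      gcongr
    have h2 : (r - t) * K ≤ r * K := mul_le_mul_of_nonneg_right (by linarith [ht.1]) hK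
    nlinarith
  · positivity

/-- Here `r u` itself is to be bounded, and the correction grows like `gr N R t`; this is why the
constant depends on `T`. Since `r > R` on the support, `√(1 + r²)/r ≤ 1 + 1/R`. -/
lemma decayLE_sol (hN : 2 < N) (hR : 0 < R) (hA : 0 ≤ A) (hK : 0 ≤ K)
    (hum : StronglyMeasurable u₀)
    (hu0 : ∀ q ≤ R, u₀ q = 0) (hu : ∀ᵐ q, ‖mulId u₀ q‖ ≤ K)
    (hD : Corr N R T A (picLim N (mulId u₀))) {t : ℝ} (ht : t ∈ Icc 0 T) :
    DecayLE (rad (sol N u₀ t)) ((1 + R⁻¹) * (K + A * gr N R T)) := by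
  have hgT := gr_pos (N := N) hR (ht.1.trans ht.2)
  have hsm : StronglyMeasurable (sol N u₀ t) :=
    stronglyMeasurable_prof_slice ((stronglyMeasurable_id.smul hum).add (hD.meas_slice t)) t
  refine ⟨(hsm.comp_measurable measurable_norm).aestronglyMeasurable,
    ae_norm_iff (P := fun r => √(1 + r ^ 2) * ‖sol N u₀ t r‖ ≤ _).2 (ae_restrict_of_ae ?_)⟩
  filter_upwards [ae_sub_right hu t] with r hr
  have h1 := norm_sol_le hR hu0 hD ht hr
  have hg := gr_pos (N := N) hR ht.1
  split_ifs at h1 with h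
  · have hr0 : 0 < r := by linarith [ht.1]
    have hRr : R < r := by linarith [ht.1]
    have h2 : √(1 + r ^ 2) ≤ 1 + r := by
      rw [Real.sqrt_le_left (by linarith)]
      nlinarith
    calc √(1 + r ^ 2) * ‖sol N u₀ t r‖ ≤ (1 + r) * ((K + A * gr N R t) / r) := by gcongr
      _ = (r⁻¹ + 1) * (K + A * gr N R t) := by field_simp
      _ ≤ (R⁻¹ + 1) * (K + A * gr N R T) := by
        have := gr_mono hN hR ht.1 ht.2
        gcongr
      _ = _ := by ring
  · rw [le_antisymm h1 (norm_nonneg _), mul_zero]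
    positivity

end pointwise

/-! ### Square integrability of the derivative of the correction -/

section kernelL2

variable {N R T A K : ℝ} {v : ℝ → 𝕜} {D : ℝ → ℝ → 𝕜}

/-- The time integral of `kern`, which is the derivative of the correction. -/
def kernTime (N : ℝ) (v : ℝ → 𝕜) (D : ℝ → ℝ → 𝕜) (t p : ℝ) : 𝕜 :=
  -((2⁻¹ : ℝ) • ∫ s in Ioc 0 t, kern N v D p s)

lemma stronglyMeasurable_kernTime (hN : 2 < N) (hv : StronglyMeasurable v)
    (hD : StronglyMeasurable (Function.uncurry D)) (t : ℝ) :
    StronglyMeasurable (kernTime N v D t) := by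
  refine StronglyMeasurable.neg (StronglyMeasurable.const_smul ?_ _)
  exact (stronglyMeasurable_kern (by linarith) hv hD).integral_prod_right

lemma kernTime_eq_zero (hv : Adm N R A v) (hD : Corr N R T A D) {p : ℝ} (hp : p ≤ R) (t : ℝ) :
    kernTime N v D t p = 0 := by
  simp [kernTime, kern, hv.zero p hp, hD.zero p hp, powMap_zero]

lemma integrable_kern_prod (hN : 2 < N) (hR : 0 < R) (hA : 0 ≤ A) (hv : Adm N R A v)
    (hD : Corr N R T A D) {t : ℝ} (ht : t ∈ Icc 0 T) (q : ℝ) :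
    Integrable (fun z : ℝ × ℝ => kern N v D z.2 z.1)
      ((volume.restrict (Ioc 0 t)).prod (volume.restrict (Ioc 0 q))) := by
  have hm : StronglyMeasurable fun z : ℝ × ℝ => kern N v D z.2 z.1 :=
    (stronglyMeasurable_kern (by linarith) hv.meas hD.meas).comp_measurable measurable_swap
  refine ⟨hm.aestronglyMeasurable, ?_⟩
  unfold HasFiniteIntegral
  rw [lintegral_prod _ hm.enorm.aemeasurable]
  have hb : ∀ s ∈ Ioc 0 t, ∫⁻ p in Ioc 0 q, ‖kern N v D p s‖ₑ ≤
      ENNReal.ofReal (kernBound N R A) := fun s hs =>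
    (lintegral_mono_set (show Ioc 0 q ⊆ Ioi 0 from Ioc_subset_Ioi_self)).trans
      (lintegral_kern_le_kernBound hN hR hA hv hD ⟨hs.1.le, hs.2.trans ht.2⟩)
  refine (setLIntegral_mono' measurableSet_Ioc hb).trans_lt ?_
  rw [setLIntegral_const]
  exact ENNReal.mul_lt_top ENNReal.ofReal_lt_top (by simp)

/-- Exchanging the two integrals exhibits the correction as a primitive in `q`, so that its
derivative requires no derivative of `V`. -/
lemma picOp_eq_integral_kernTime (hN : 2 < N) (hR : 0 < R) (hA : 0 ≤ A) (hv : Adm N R A v)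
    (hD : Corr N R T A D) {t : ℝ} (ht : t ∈ Icc 0 T) (q : ℝ) :
    picOp N v D q t = ∫ p in Ioc 0 q, kernTime N v D t p := by
  unfold picOp kernTime
  rw [integral_neg, integral_smul,
    integral_integral_swap (integrable_kern_prod hN hR hA hv hD ht q)]

lemma integrableOn_kernTime (hN : 2 < N) (hR : 0 < R) (hA : 0 ≤ A) (hv : Adm N R A v)
    (hD : Corr N R T A D) {t : ℝ} (ht : t ∈ Icc 0 T) (q : ℝ) :
    IntegrableOn (kernTime N v D t) (Ioc 0 q) :=
  ((integrable_kern_prod hN hR hA hv hD ht q).integral_prod_right.smul (2⁻¹ : ℝ)).neg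

lemma weakDeriv_picLim (hN : 2 < N) (hR : 0 < R) (hA : 0 ≤ A)
    (hsm : A ^ N * theta N R T ≤ kap N) (hv : Adm N R A v) {t : ℝ} (ht : t ∈ Icc 0 T) :
    WeakDeriv R (fun q => picLim N v q t) (kernTime N v (picLim N v) t) := by
  have hD := corr_picLim hN hR hA hsm hv
  refine weakDeriv_of_primitive hR (fun q hq => hD.zero q hq t)
    (fun q hq => kernTime_eq_zero hv hD hq t) (integrableOn_kernTime hN hR hA hv hD ht)
    (Eventually.of_forall fun q => ?_)
  rw [picLim_eq hN hR hA hsm hv q ht, picOp_eq_integral_kernTime hN hR hA hv hD ht]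

/-- The hypothesis on `V` says that `|u| ≤ K`. In the square `(p + s)^(-2N) |V|^(2N+2)`, the bound
`|V|^N ≤ K^N (p + s)^N` consumes one power of the weight and leaves the integrand of the `L^{N+2}`
norm. -/
lemma enorm_kern_sq_le (hN : 2 < N) (hR : 0 < R) (hK : 0 ≤ K)
    {p s : ℝ} (hp : R < p) (hs : 0 ≤ s) (h : ‖v p + D p s‖ ≤ K * (p + s)) :
    ‖kern N v D p s‖ₑ ^ 2 ≤ ENNReal.ofReal (K ^ N) *
      (ENNReal.ofReal ((p + s) ^ (-N)) * ‖v p + D p s‖ₑ ^ (N + 2)) := by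
  have hps : 0 < p + s := by linarith
  set y := ‖v p + D p s‖ with hy
  have hy0 : 0 ≤ y := norm_nonneg _
  have hNR : 0 ≤ N := by linarith
  rw [← ofReal_norm, ← ofReal_norm, ← ENNReal.ofReal_pow (norm_nonneg _),
    ENNReal.ofReal_rpow_of_nonneg hy0 (by linarith), ← ENNReal.ofReal_mul (by positivity),
    ← ENNReal.ofReal_mul (by positivity)]
  refine ENNReal.ofReal_le_ofReal ?_
  rw [kern, norm_smul, norm_powMap hNR, Real.norm_eq_abs, abs_of_nonneg (by positivity)]
  have e1 : (y ^ (N + 1)) ^ 2 = y ^ N * y ^ (N + 2) := by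
    rw [← Real.rpow_natCast, ← Real.rpow_mul hy0, ← Real.rpow_add_of_nonneg hy0 hNR (by linarith)]
    congr 1; push_cast; ring
  have e2 : y ^ N ≤ K ^ N * (p + s) ^ N := by
    rw [← Real.mul_rpow hK hps.le]
    exact Real.rpow_le_rpow hy0 h hNR
  have e3 : (p + s) ^ (-N) * (p + s) ^ N = 1 := by
    rw [← Real.rpow_add hps]; simp
  rw [← hy, mul_pow, e1]
  calc ((p + s) ^ (-N)) ^ 2 * (y ^ N * y ^ (N + 2))
      ≤ ((p + s) ^ (-N)) ^ 2 * ((K ^ N * (p + s) ^ N) * y ^ (N + 2)) := by gcongr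
    _ = ((p + s) ^ (-N) * (p + s) ^ N) * (K ^ N * ((p + s) ^ (-N) * y ^ (N + 2))) := by ring
    _ = _ := by rw [e3, one_mul]

lemma lintegral_kern_sq_le (hN : 2 < N) (hR : 0 < R) (hA : 0 ≤ A) (hK : 0 ≤ K) (hv : Adm N R A v)
    (hD : Corr N R T A D) (hvK : ∀ᵐ p, ‖v p‖ ≤ K * |p|) {s : ℝ} (hs : s ∈ Icc 0 T) :
    ∫⁻ p in Ioi 0, ‖kern N v D p s‖ₑ ^ 2
      ≤ ENNReal.ofReal ((K + A * (gr N R 0 / R)) ^ N) * ENNReal.ofReal (2 * A) ^ (N + 2) := by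
  have hg0 := gr_pos (N := N) hR le_rfl
  have hp2 : 0 < N + 2 := by linarith
  have hVm : StronglyMeasurable fun q => v q + D q s := hv.meas.add (hD.meas_slice s)
  have h1 : ∫⁻ p in Ioi 0, ‖kern N v D p s‖ₑ ^ 2 ≤ ∫⁻ p in Ioi R,
      ENNReal.ofReal ((K + A * (gr N R 0 / R)) ^ N) *
        (ENNReal.ofReal ((p + s) ^ (-N)) * ‖v p + D p s‖ₑ ^ (N + 2)) := by
    rw [← lintegral_indicator measurableSet_Ioi, ← lintegral_indicator measurableSet_Ioi]
    refine lintegral_mono_ae ?_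
    filter_upwards [hvK] with p hpK
    by_cases hp : R < p
    · rw [indicator_of_mem (show p ∈ Ioi 0 from hR.trans hp),
        indicator_of_mem (show p ∈ Ioi R from hp)]
      refine enorm_kern_sq_le hN hR (by positivity) hp hs.1 ?_
      refine (norm_add_le _ _).trans ?_
      rw [abs_of_pos (hR.trans hp)] at hpK
      have h2 := hD.bound p s hs
      have h3 : A * gr N R s ≤ A * (gr N R 0 / R * (p + s)) := by
        refine mul_le_mul_of_nonneg_left ((gr_le_mul hN hR hs.1).trans ?_) hA
        gcongr
      have h4 : K * p ≤ K * (p + s) := by gcongr; linarith [hs.1]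
      nlinarith
    · have h0 : kern N v D p s = 0 := by
        simp [kern, hv.zero p (not_lt.1 hp), hD.zero p (not_lt.1 hp), powMap_zero]
      simp [indicator, h0]
  refine h1.trans ?_
  rw [lintegral_const_mul' _ _ ENNReal.ofReal_ne_top]
  gcongr
  have h5 := eLpNorm_add_corr_le hN hR hA hv hD hs
  rw [eLpNorm_eq_lintegral_rpow_enorm_toReal (by simpa using hp2) ENNReal.ofReal_ne_top,
    ENNReal.toReal_ofReal hp2.le, one_div] at h5
  have h6 := ENNReal.rpow_le_rpow h5 hp2.le
  rw [← ENNReal.rpow_mul, inv_mul_cancel₀ hp2.ne', ENNReal.rpow_one] at h6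
  refine le_trans (le_of_eq ?_) h6
  unfold nuMeas
  rw [lintegral_withDensity_eq_lintegral_mul₀ (by fun_prop) (hVm.enorm.pow_const _).aemeasurable]
  rfl

/-- Cauchy-Schwarz in time gives one factor `T`; exchanging the integrals and bounding each time
slice uniformly gives the other. -/
lemma lintegral_kernTime_sq_le (hN : 2 < N) (hR : 0 < R) (hA : 0 ≤ A) (hK : 0 ≤ K)
    (hv : Adm N R A v) (hD : Corr N R T A D) (hvK : ∀ᵐ p, ‖v p‖ ≤ K * |p|) {t : ℝ}
    (ht : t ∈ Icc 0 T) :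
    ∫⁻ p in Ioi 0, ‖kernTime N v D t p‖ₑ ^ 2 ≤ ENNReal.ofReal T * (ENNReal.ofReal T *
      (ENNReal.ofReal ((K + A * (gr N R 0 / R)) ^ N) * ENNReal.ofReal (2 * A) ^ (N + 2))) := by
  have hm : StronglyMeasurable (Function.uncurry (kern N v D)) :=
    stronglyMeasurable_kern (by linarith) hv.meas hD.meas
  have h1 : ∀ p, ‖kernTime N v D t p‖ₑ ^ 2 ≤
      ENNReal.ofReal T * ∫⁻ s in Ioc 0 t, ‖kern N v D p s‖ₑ ^ 2 := by
    intro p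
    have hmp : AEMeasurable (fun s => ‖kern N v D p s‖ₑ) (volume.restrict (Ioc 0 t)) :=
      (hm.comp_measurable (by fun_prop : Measurable fun s : ℝ => (p, s))).enorm.aemeasurable
    have h2 : ‖kernTime N v D t p‖ₑ ≤ ∫⁻ s in Ioc 0 t, ‖kern N v D p s‖ₑ := by
      rw [kernTime, enorm_neg, enorm_smul]
      refine (mul_le_of_le_one_left zero_le ?_).trans (enorm_integral_le_lintegral_enorm _)
      rw [Real.enorm_of_nonneg (by norm_num), ENNReal.ofReal_le_one]
      norm_num
    refine (pow_le_pow_left₀ zero_le h2 2).trans ((sq_lintegral_le hmp).trans ?_)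
    gcongr
    simp only [Measure.restrict_apply_univ, Real.volume_Ioc, sub_zero]
    exact ENNReal.ofReal_le_ofReal ht.2
  refine (lintegral_mono h1).trans ?_
  rw [lintegral_const_mul' _ _ ENNReal.ofReal_ne_top]
  gcongr
  rw [lintegral_lintegral_swap (hm.enorm.pow_const 2).aemeasurable]
  refine (setLIntegral_mono' measurableSet_Ioc fun s hs =>
    lintegral_kern_sq_le hN hR hA hK hv hD hvK (K := K) ⟨hs.1.le, hs.2.trans ht.2⟩).trans ?_
  rw [setLIntegral_const, mul_comm]
  gcongr
  simp only [Real.volume_Ioc, sub_zero]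
  exact ENNReal.ofReal_le_ofReal ht.2

end kernelL2

section sobolev

lemma memLp_radialGradient {W : ℝ → 𝕜} (hW : StronglyMeasurable W)
    (h2 : ∫⁻ r in Ioi (0 : ℝ), ‖r • W r‖ₑ ^ 2 ≠ ⊤) : MemLp (rad W) 2 (volume : Measure E3) ∧
    ∫ x : E3, ‖rad W x‖ ^ 2 = 4 * Real.pi * (∫⁻ r in Ioi (0 : ℝ), ‖r • W r‖ₑ ^ 2).toReal := by
  have hm : StronglyMeasurable (rad W : E3 → 𝕜) := hW.comp_measurable measurable_norm
  have e : ∫⁻ x : E3, ‖rad W x‖ₑ ^ 2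
      = ENNReal.ofReal (4 * Real.pi) * ∫⁻ r in Ioi (0 : ℝ), ‖r • W r‖ₑ ^ 2 := by
    simp only [rad]
    rw [lintegral_norm (F := fun r => ‖W r‖ₑ ^ 2) (hW.enorm.pow_const 2).aemeasurable]
    congr 1
    refine setLIntegral_congr_fun measurableSet_Ioi fun r hr => ?_
    have hr0 : 0 ≤ r := le_of_lt hr
    simp only [enorm_smul, mul_pow, Real.enorm_of_nonneg hr0, ENNReal.ofReal_pow hr0]
  constructor
  · refine ⟨hm.aestronglyMeasurable, ?_⟩
    rw [eLpNorm_lt_top_iff_lintegral_rpow_enorm_lt_top (by norm_num) (by norm_num)]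
    have : ∫⁻ x : E3, ‖rad W x‖ₑ ^ 2 < ⊤ := by
      rw [e]
      exact ENNReal.mul_lt_top ENNReal.ofReal_lt_top h2.lt_top
    simpa using this
  · rw [integral_eq_lintegral_of_nonneg_ae (f := fun x : E3 => ‖rad W x‖ ^ 2)
      (Eventually.of_forall fun x => sq_nonneg _) (hm.norm.pow 2).aestronglyMeasurable]
    have e' : ∀ x : E3, ENNReal.ofReal (‖rad W x‖ ^ 2) = ‖rad W x‖ₑ ^ 2 := fun x => by
      rw [ENNReal.ofReal_pow (norm_nonneg _), ofReal_norm]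
    simp only [e']
    rw [e, ENNReal.toReal_mul, ENNReal.toReal_ofReal (by positivity)]

/-- The gradient is `(x / |x|) W`. Each of its three components is bounded by `|W|`, whence the
factor `3`, which is not sharp. -/
lemma hdotOneLE_of_weakDeriv {R : ℝ} (hR : 0 < R) {f W : ℝ → 𝕜} (hW : StronglyMeasurable W)
    (hf : WeakDeriv R f W) (h6 : MemLp (rad f) 6 (volume : Measure E3)) {C : ℝ≥0∞} (hC : C ≠ ⊤)
    (h2 : ∫⁻ r in Ioi (0 : ℝ), ‖r • W r‖ₑ ^ 2 ≤ C) :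
    HdotOneLE (rad f) √(3 * (4 * Real.pi * C.toReal)) := by
  obtain ⟨hmem, hint⟩ := memLp_radialGradient hW (ne_top_of_le_ne_top hC h2)
  have hm : StronglyMeasurable (rad W : E3 → 𝕜) := hW.comp_measurable measurable_norm
  have hgm : ∀ i, StronglyMeasurable fun x : E3 => (x i * ‖x‖⁻¹) • rad W x := fun i =>
    (by fun_prop : Measurable fun x : E3 => x i * ‖x‖⁻¹).stronglyMeasurable.smul hm
  have hle : ∀ (x : E3) (i : Fin 3), ‖(x i * ‖x‖⁻¹) • rad W x‖ ≤ ‖rad W x‖ := fun x i => by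
    rw [norm_smul, norm_mul, norm_inv, norm_norm, ← div_eq_mul_inv]
    exact mul_le_of_le_one_left (norm_nonneg _)
      (div_le_one_of_le₀ (PiLp.norm_apply_le x i) (norm_nonneg _))
  have hg2 : ∀ i, MemLp (fun x : E3 => (x i * ‖x‖⁻¹) • rad W x) 2 volume := fun i =>
    hmem.of_le (hgm i).aestronglyMeasurable (Eventually.of_forall fun x => hle x i)
  refine ⟨h6, fun i x => (x i * ‖x‖⁻¹) • rad W x, hg2,
    fun i φ => hf.integral_fderiv_smul_rad hR φ i, Real.sqrt_le_sqrt ?_⟩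
  have hi : ∀ i : Fin 3, ∫ x : E3, ‖(x i * ‖x‖⁻¹) • rad W x‖ ^ 2 ≤ 4 * Real.pi * C.toReal := by
    intro i
    refine (integral_mono ((hg2 i).integrable_norm_pow (by norm_num))
      (hmem.integrable_norm_pow (by norm_num)) fun x => pow_le_pow_left₀ (norm_nonneg _) (hle x i)
        2).trans ?_
    have := ENNReal.toReal_mono hC h2
    rw [hint]
    gcongr
  refine (Finset.sum_le_sum fun i _ => hi i).trans (le_of_eq ?_)
  simp

end sobolev

end OutgoingWave
end

/-! ### Persistence of `Ḣ¹` regularity -/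

noncomputable section

namespace OutgoingWave

variable {𝕜 : Type*} [RCLike 𝕜]

section sobolevSol

variable {N R T A K : ℝ} {u₀ : ℝ → 𝕜}

lemma lintegral_Ioi_inv_sq_lt_top {R : ℝ} (hR : 0 < R) :
    ∫⁻ r in Ioi R, ENNReal.ofReal ((r⁻¹) ^ 2) < ⊤ := by
  have h := (integrableOn_Ioi_rpow_of_lt (a := -2) (by norm_num) hR).2
  refine lt_of_le_of_lt (le_of_eq ?_) h
  refine setLIntegral_congr_fun measurableSet_Ioi fun r hr => ?_
  have hr0 : 0 < r := hR.trans hr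
  simp only
  rw [Real.enorm_of_nonneg (by positivity), Real.rpow_neg hr0.le, inv_pow]
  norm_cast

lemma lintegral_Ioi_sub_right {G : ℝ → ℝ≥0∞} {t : ℝ} (ht : 0 ≤ t) (hG : ∀ q ≤ 0, G q = 0) :
    ∫⁻ r in Ioi (0 : ℝ), G (r - t) = ∫⁻ q in Ioi (0 : ℝ), G q := by
  rw [← lintegral_indicator measurableSet_Ioi, ← lintegral_indicator measurableSet_Ioi,
    ← lintegral_sub_right_eq_self (μ := volume) ((Ioi (0 : ℝ)).indicator G) t]
  refine lintegral_congr fun r => ?_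
  simp only [indicator, mem_Ioi, sub_pos]
  by_cases h : t < r
  · simp [h, ht.trans_lt h]
  · simp [h, hG (r - t) (by linarith)]

lemma memLp_six_rad_iff {f : ℝ → 𝕜} (hf : StronglyMeasurable f) :
    MemLp (rad f) 6 (volume : Measure E3) ↔
      ∫⁻ r in Ioi (0 : ℝ), ENNReal.ofReal (r ^ 2) * ‖f r‖ₑ ^ 6 < ⊤ := by
  have hm : StronglyMeasurable (rad f : E3 → 𝕜) := hf.comp_measurable measurable_norm
  have e : ∫⁻ x : E3, ‖rad f x‖ₑ ^ (6 : ℕ) = ENNReal.ofReal (4 * Real.pi) *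
      ∫⁻ r in Ioi (0 : ℝ), ENNReal.ofReal (r ^ 2) * ‖f r‖ₑ ^ 6 :=
    lintegral_norm (F := fun r => ‖f r‖ₑ ^ 6) (hf.enorm.pow_const 6).aemeasurable
  have e2 : MemLp (rad f) 6 (volume : Measure E3) ↔ ∫⁻ x : E3, ‖rad f x‖ₑ ^ (6 : ℕ) < ⊤ := by
    unfold MemLp
    rw [eLpNorm_lt_top_iff_lintegral_rpow_enorm_lt_top (by norm_num) (by norm_num),
      and_iff_right hm.aestronglyMeasurable]
    have : ((6 : ℝ≥0∞).toReal) = ((6 : ℕ) : ℝ) := by norm_num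
    simp only [this, ENNReal.rpow_natCast]
  rw [e2, e]
  constructor
  · intro h
    by_contra h'
    rw [not_lt, top_le_iff] at h'
    rw [h', ENNReal.mul_top four_pi_ne_zero] at h
    exact lt_irrefl _ h
  · exact fun h => ENNReal.mul_lt_top ENNReal.ofReal_lt_top h

/-- The translated profile is `u₀(r - t)` times `(r - t)/r ≤ 1`. Two of the six powers of this ratio
turn `r²` into `(r - t)²`, so the sixth-power integral does not increase. -/
lemma memLp_six_prof_mulId (hum : StronglyMeasurable u₀)
    (h6 : MemLp (rad u₀) 6 (volume : Measure E3)) {t : ℝ} (ht : 0 ≤ t) :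
    MemLp (rad (prof t (mulId u₀))) 6 (volume : Measure E3) := by
  have hm : StronglyMeasurable (mulId u₀) := stronglyMeasurable_id.smul hum
  rw [memLp_six_rad_iff (stronglyMeasurable_prof_slice hm t)]
  rw [memLp_six_rad_iff hum] at h6
  set G : ℝ → ℝ≥0∞ := (Ioi (0 : ℝ)).indicator fun q => ENNReal.ofReal (q ^ 2) * ‖u₀ q‖ₑ ^ 6 with hG
  have hG0 : ∀ q ≤ 0, G q = 0 := fun q hq => indicator_of_notMem (not_lt.2 hq) _
  have e : ∫⁻ q in Ioi (0 : ℝ), G q < ⊤ := by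
    rw [hG, setLIntegral_indicator measurableSet_Ioi, inter_self]
    exact h6
  rw [← lintegral_Ioi_sub_right ht hG0] at e
  refine lt_of_le_of_lt (setLIntegral_mono' measurableSet_Ioi fun r hr => ?_) e
  unfold prof
  split_ifs with h
  · have hq : 0 < r - t := sub_pos.2 h
    have hr0 : 0 < r := hr
    rw [hG, indicator_of_mem (show r - t ∈ Ioi 0 from hq), mulId, smul_smul, enorm_smul, mul_pow,
      ← mul_assoc, Real.enorm_of_nonneg (by positivity), ← ENNReal.ofReal_pow (by positivity),
      ← ENNReal.ofReal_mul (by positivity)]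
    gcongr
    have h1 : r⁻¹ * (r - t) ≤ 1 := by
      rw [inv_mul_eq_div, div_le_one hr0]; linarith
    have h0 : 0 ≤ r⁻¹ * (r - t) := by positivity
    calc r ^ 2 * (r⁻¹ * (r - t)) ^ 6 ≤ r ^ 2 * (r⁻¹ * (r - t)) ^ 2 := by
          gcongr ?_ * ?_
          exact pow_le_pow_of_le_one h0 h1 (by norm_num)
      _ = (r - t) ^ 2 := by field_simp
  · simp

/-- A bounded numerator over `r` contributes `r² r^(-6) = r^(-4)`, integrable on `(R, ∞)`, outside
of which the profile vanishes. -/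
lemma memLp_six_prof_of_bounded (hR : 0 < R) {E : ℝ → 𝕜} (hE : StronglyMeasurable E)
    (hE0 : ∀ q ≤ R, E q = 0) {M : ℝ} (hM : ∀ q, ‖E q‖ ≤ M) {t : ℝ} (ht : 0 ≤ t) :
    MemLp (rad (prof t E)) 6 (volume : Measure E3) := by
  have hM0 : 0 ≤ M := (norm_nonneg _).trans (hM 0)
  rw [memLp_six_rad_iff (stronglyMeasurable_prof_slice hE t)]
  have hle : ∫⁻ r in Ioi (0 : ℝ), ENNReal.ofReal (r ^ 2) * ‖prof t E r‖ₑ ^ 6 ≤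
      ENNReal.ofReal (M ^ 6 * (R⁻¹) ^ 2) * ∫⁻ r in Ioi R, ENNReal.ofReal ((r⁻¹) ^ 2) := by
    rw [← lintegral_const_mul' _ _ ENNReal.ofReal_ne_top, ← lintegral_indicator measurableSet_Ioi,
      ← lintegral_indicator measurableSet_Ioi]
    refine lintegral_mono fun r => ?_
    by_cases hr : R < r
    · have hr0 : 0 < r := hR.trans hr
      rw [indicator_of_mem (show r ∈ Ioi 0 from hr0), indicator_of_mem (show r ∈ Ioi R from hr),
        ← ENNReal.ofReal_mul (by positivity), ← ofReal_norm,
        ← ENNReal.ofReal_pow (norm_nonneg _), ← ENNReal.ofReal_mul (by positivity)]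
      refine ENNReal.ofReal_le_ofReal ?_
      have h1 : ‖prof t E r‖ ≤ r⁻¹ * M := by
        unfold prof
        split_ifs
        · rw [norm_smul, Real.norm_eq_abs, abs_of_pos (inv_pos.2 hr0)]
          gcongr
          exact hM _
        · rw [norm_zero]; positivity
      calc r ^ 2 * ‖prof t E r‖ ^ 6 ≤ r ^ 2 * (r⁻¹ * M) ^ 6 := by gcongr
        _ = M ^ 6 * (r⁻¹) ^ 2 * (r⁻¹) ^ 2 := by field_simp
        _ ≤ M ^ 6 * (R⁻¹) ^ 2 * (r⁻¹) ^ 2 := by gcongr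
    · have h0 : prof t E r = 0 := by
        unfold prof
        rw [hE0 _ (by linarith), smul_zero, ite_self]
      simp [indicator, h0]
  exact hle.trans_lt (ENNReal.mul_lt_top ENNReal.ofReal_lt_top (lintegral_Ioi_inv_sq_lt_top hR))

lemma rad_prof_add (V E : ℝ → 𝕜) (t : ℝ) :
    (rad (prof t fun q => V q + E q) : E3 → 𝕜) = rad (prof t V) + rad (prof t E) := by
  funext x
  simp only [rad, prof, Pi.add_apply]
  split_ifs
  · rw [smul_add]
  · rw [add_zero]

lemma memLp_six_sol (hN : 2 < N) (hR : 0 < R) (hA : 0 ≤ A) (hum : StronglyMeasurable u₀)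
    (h6 : MemLp (rad u₀) 6 (volume : Measure E3))
    (hsm : A ^ N * theta N R T ≤ kap N) (hv : Adm N R A (mulId u₀)) {t : ℝ} (ht : t ∈ Icc 0 T) :
    MemLp (rad (sol N u₀ t)) 6 (volume : Measure E3) := by
  have hD := corr_picLim hN hR hA hsm hv
  unfold sol
  rw [rad_prof_add]
  exact (memLp_six_prof_mulId hum h6 ht.1).add (memLp_six_prof_of_bounded hR (hD.meas_slice t)
    (fun q hq => hD.zero q hq t) (fun q => hD.bound q t ht) ht.1)

/-- The derivative of the profile of the solution. -/
def solDeriv (N : ℝ) (u₀ h : ℝ → 𝕜) (t r : ℝ) : 𝕜 :=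
  (-(r ^ 2)⁻¹ : ℝ) • (mulId u₀ (r - t) + picLim N (mulId u₀) (r - t) t) +
    r⁻¹ • (((1 : ℝ) • u₀ (r - t) + (r - t) • h (r - t)) +
      kernTime N (mulId u₀) (picLim N (mulId u₀)) t (r - t))

lemma stronglyMeasurable_solDeriv (hN : 2 < N) {h : ℝ → 𝕜} (hum : StronglyMeasurable u₀)
    (hh : StronglyMeasurable h) (hD : Corr N R T A (picLim N (mulId u₀))) (t : ℝ) :
    StronglyMeasurable (solDeriv N u₀ h t) := by
  have hm : StronglyMeasurable (mulId u₀) := stronglyMeasurable_id.smul hum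
  have hs : Measurable fun r : ℝ => r - t := by fun_prop
  refine StronglyMeasurable.add ?_ ?_
  · exact (by fun_prop : Measurable fun r : ℝ => -(r ^ 2)⁻¹).stronglyMeasurable.smul
      ((hm.comp_measurable hs).add ((hD.meas_slice t).comp_measurable hs))
  · refine (by fun_prop : Measurable fun r : ℝ => r⁻¹).stronglyMeasurable.smul
      (StronglyMeasurable.add (StronglyMeasurable.add ?_ ?_) ?_)
    · exact (hum.comp_measurable hs).const_smul (1 : ℝ)
    · exact hs.stronglyMeasurable.smul (hh.comp_measurable hs)
    · exact (stronglyMeasurable_kernTime hN hm hD.meas t).comp_measurable hs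

lemma weakDeriv_sol (hN : 2 < N) (hR : 0 < R) (hA : 0 ≤ A) {h : ℝ → 𝕜}
    (huh : WeakDeriv R u₀ h) (hsm : A ^ N * theta N R T ≤ kap N) (hv : Adm N R A (mulId u₀))
    {t : ℝ} (ht : t ∈ Icc 0 T) : WeakDeriv R (sol N u₀ t) (solDeriv N u₀ h t) := by
  have h1 := huh.smul hR (a := fun r => r) (a' := fun _ => 1) (fun r _ => hasDerivAt_id r)
    continuousOn_const
  have h2 := ((h1.add hR (weakDeriv_picLim hN hR hA hsm hv ht)).shift hR ht.1).smul hR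
    (a := fun r => r⁻¹) (a' := fun r => -(r ^ 2)⁻¹) (fun r hr => hasDerivAt_inv hr.ne')
    (((continuousOn_id.pow 2).inv₀ fun r hr => pow_ne_zero 2 (ne_of_gt hr)).neg)
  have e : sol N u₀ t = fun r => r⁻¹ • ((r - t) • u₀ (r - t) + picLim N (mulId u₀) (r - t) t) := by
    funext r
    unfold sol prof
    split_ifs with h
    · rfl
    · have hD := corr_picLim hN hR hA hsm hv
      rw [huh.zero _ (by linarith), hD.zero _ (by linarith)]
      simp
  rw [e]
  exact h2

/-- The term `u₀(r - t)` alone is bounded but not controlled in `L²(dr)`. It combines with `-((r -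
t)/r) u₀(r - t)`, from differentiating `1/r`, to give `(t/r) u₀(r - t)`, which is square integrable
on `(R, ∞)`. -/
lemma norm_smul_solDeriv_le (hR : 0 < R) (hA : 0 ≤ A) (hN : 2 < N)
    {h : ℝ → 𝕜} (hu0 : ∀ q ≤ R, u₀ q = 0)
    (hD : Corr N R T A (picLim N (mulId u₀))) {t : ℝ} (ht : t ∈ Icc 0 T) {r : ℝ} (hr : 0 < r)
    (hu : ‖u₀ (r - t)‖ ≤ K) :
    ‖r • solDeriv N u₀ h t r‖ ≤ (Ioi R).indicator (fun r => (T * K + A * gr N R T) * r⁻¹) r +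
      ‖(r - t) • h (r - t)‖ + ‖kernTime N (mulId u₀) (picLim N (mulId u₀)) t (r - t)‖ := by
  have e : r • solDeriv N u₀ h t r = ((r⁻¹ * t) • u₀ (r - t) -
      r⁻¹ • picLim N (mulId u₀) (r - t) t) + (r - t) • h (r - t) +
      kernTime N (mulId u₀) (picLim N (mulId u₀)) t (r - t) := by
    have e1 : (r⁻¹ * t) • u₀ (r - t) = u₀ (r - t) - (r⁻¹ * (r - t)) • u₀ (r - t) := by
      nth_rewrite 2 [← one_smul ℝ (u₀ (r - t))]
      rw [← sub_smul]
      congr 1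
      field_simp
      ring
    have e2 : r * -(r ^ 2)⁻¹ = -r⁻¹ := by field_simp
    rw [solDeriv, smul_add, smul_smul, e2, smul_inv_smul₀ hr.ne', e1, mulId, one_smul, smul_add,
      smul_smul, neg_mul, neg_smul, neg_smul]
    abel
  rw [e]
  refine (norm_add_le _ _).trans (add_le_add_left ((norm_add_le _ _).trans
    (add_le_add_left ?_ _)) _)
  by_cases hRr : R < r
  · rw [indicator_of_mem (show r ∈ Ioi R from hRr)]
    have hT : 0 ≤ T := ht.1.trans ht.2
    have hg := gr_mono hN hR ht.1 ht.2
    have hb := hD.bound (r - t) t ht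
    refine (norm_sub_le _ _).trans ?_
    rw [norm_smul, norm_smul, norm_mul, Real.norm_eq_abs, Real.norm_eq_abs,
      abs_of_pos (inv_pos.2 hr), abs_of_nonneg ht.1]
    calc r⁻¹ * t * ‖u₀ (r - t)‖ + r⁻¹ * ‖picLim N (mulId u₀) (r - t) t‖
        ≤ r⁻¹ * T * K + r⁻¹ * (A * gr N R T) := by
          have := ht.2
          gcongr
          exact hb.trans (by gcongr)
      _ = _ := by ring
  · rw [indicator_of_notMem (show r ∉ Ioi R from hRr),
      hu0 _ (by linarith [ht.1]), hD.zero _ (by linarith [ht.1])]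
    simp

lemma sq_enorm_le_three {x : 𝕜} {a b c : ℝ} (h : ‖x‖ ≤ a + b + c) :
    ‖x‖ₑ ^ 2 ≤ 3 * (ENNReal.ofReal (a ^ 2) + ENNReal.ofReal (b ^ 2) + ENNReal.ofReal (c ^ 2)) := by
  have h3 : (3 : ℝ≥0∞) = ENNReal.ofReal 3 := by norm_num
  rw [← ofReal_norm, ← ENNReal.ofReal_pow (norm_nonneg _), h3,
    ← ENNReal.ofReal_add (by positivity) (by positivity),
    ← ENNReal.ofReal_add (by positivity) (by positivity), ← ENNReal.ofReal_mul (by positivity)]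
  refine ENNReal.ofReal_le_ofReal ?_
  have h1 := pow_le_pow_left₀ (norm_nonneg x) h 2
  nlinarith [sq_nonneg (a - b), sq_nonneg (a - c), sq_nonneg (b - c)]

/-- Persistence of `Ḣ¹` regularity. -/
lemma exists_hdotOneLE_sol (hN : 2 < N) (hR : 0 < R) (hA : 0 ≤ A) (hK : 0 ≤ K)
    (hum : StronglyMeasurable u₀) (hu0 : ∀ q ≤ R, u₀ q = 0) (hu : ∀ᵐ q, ‖u₀ q‖ ≤ K)
    (hui : ∀ M, IntegrableOn u₀ (Ioc 0 M)) {L : ℝ} (hH : HdotOneLE (rad u₀) L)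
    (hsm : A ^ N * theta N R T ≤ kap N) (hv : Adm N R A (mulId u₀)) :
    ∃ K' : ℝ, ∀ t ∈ Icc 0 T, HdotOneLE (rad (sol N u₀ t)) K' := by
  obtain ⟨h, hh, huh, hh2⟩ := hH.exists_weakDeriv hR hu0 hui
  have hD := corr_picLim hN hR hA hsm hv
  have hvK : ∀ᵐ q, ‖mulId u₀ q‖ ≤ K * |q| := by
    filter_upwards [hu] with q hq
    rw [mulId, norm_smul, Real.norm_eq_abs, mul_comm]
    gcongr
  set c := T * K + A * gr N R T with hc
  -- `C₁`, `C₂`, `C₃` bound the squared `L²` norms of the three terms in `norm_smul_solDeriv_le`.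
  -- None depends on `t`: the last two terms are translates, and translation does not change their
  -- integrals.
  set C₁ : ℝ≥0∞ := ENNReal.ofReal (c ^ 2) * ∫⁻ r in Ioi R, ENNReal.ofReal ((r⁻¹) ^ 2) with hC₁
  set C₂ : ℝ≥0∞ := ∫⁻ r in Ioi (0 : ℝ), ‖r • h r‖ₑ ^ 2 with hC₂
  set C₃ : ℝ≥0∞ := ENNReal.ofReal T * (ENNReal.ofReal T *
      (ENNReal.ofReal ((K + A * (gr N R 0 / R)) ^ N) * ENNReal.ofReal (2 * A) ^ (N + 2))) with hC₃
  have hC : 3 * (C₁ + C₂ + C₃) ≠ ⊤ := by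
    refine ENNReal.mul_ne_top (by norm_num) (ENNReal.add_ne_top.2 ⟨ENNReal.add_ne_top.2
      ⟨?_, hh2.ne⟩, ?_⟩)
    · exact ENNReal.mul_ne_top ENNReal.ofReal_ne_top (lintegral_Ioi_inv_sq_lt_top hR).ne
    · refine ENNReal.mul_ne_top ENNReal.ofReal_ne_top (ENNReal.mul_ne_top ENNReal.ofReal_ne_top
        (ENNReal.mul_ne_top ENNReal.ofReal_ne_top ?_))
      exact ENNReal.rpow_ne_top_of_nonneg (by linarith) ENNReal.ofReal_ne_top
  refine ⟨_, fun t ht => hdotOneLE_of_weakDeriv hR (stronglyMeasurable_solDeriv hN hum hh hD t)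
    (weakDeriv_sol hN hR hA huh hsm hv ht) (memLp_six_sol hN hR hA hum hH.1 hsm hv ht) hC ?_⟩
  set F₁ : ℝ → ℝ≥0∞ := (Ioi R).indicator fun r => ENNReal.ofReal ((c * r⁻¹) ^ 2) with hF₁
  set F₂ : ℝ → ℝ≥0∞ := fun q => ‖q • h q‖ₑ ^ 2 with hF₂
  set F₃ : ℝ → ℝ≥0∞ := fun q =>
    ‖kernTime N (mulId u₀) (picLim N (mulId u₀)) t q‖ₑ ^ 2 with hF₃
  have hle : ∫⁻ r in Ioi (0 : ℝ), ‖r • solDeriv N u₀ h t r‖ₑ ^ 2 ≤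
      ∫⁻ r in Ioi (0 : ℝ), 3 * (F₁ r + F₂ (r - t) + F₃ (r - t)) := by
    refine lintegral_mono_ae ?_
    filter_upwards [ae_restrict_mem measurableSet_Ioi, ae_restrict_of_ae (ae_sub_right hu t)]
      with r hr hur
    have h1 := norm_smul_solDeriv_le hR hA hN (h := h) hu0 hD ht hr hur
    refine (sq_enorm_le_three h1).trans (le_of_eq ?_)
    rw [hF₁, hF₂, hF₃]
    simp only [ENNReal.ofReal_pow (norm_nonneg _), ofReal_norm]
    congr 3
    by_cases hRr : R < r
    · rw [indicator_of_mem (show r ∈ Ioi R from hRr), indicator_of_mem (show r ∈ Ioi R from hRr)]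
    · rw [indicator_of_notMem (show r ∉ Ioi R from hRr),
        indicator_of_notMem (show r ∉ Ioi R from hRr)]
      simp
  refine hle.trans ?_
  have hs : Measurable fun r : ℝ => r - t := by fun_prop
  have hm₁ : Measurable F₁ := (by fun_prop : Measurable fun r : ℝ =>
    ENNReal.ofReal ((c * r⁻¹) ^ 2)).indicator measurableSet_Ioi
  have hm₂ : Measurable fun r => F₂ (r - t) :=
    ((stronglyMeasurable_id.smul hh).enorm.pow_const 2).comp hs
  rw [lintegral_const_mul' _ _ (by norm_num), lintegral_add_left
      (f := fun r => F₁ r + F₂ (r - t)) (hm₁.add hm₂),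
    lintegral_add_left hm₁, lintegral_Ioi_sub_right ht.1, lintegral_Ioi_sub_right ht.1]
  · gcongr
    · rw [hF₁, setLIntegral_indicator measurableSet_Ioi, hC₁,
        ← lintegral_const_mul' _ _ ENNReal.ofReal_ne_top]
      refine (lintegral_mono_set inter_subset_left).trans (le_of_eq ?_)
      refine lintegral_congr fun r => ?_
      rw [← ENNReal.ofReal_mul (sq_nonneg _), mul_pow]
    · exact lintegral_kernTime_sq_le hN hR hA hK hv hD hvK ht
  · intro q hq
    simp [hF₃, kernTime_eq_zero hv hD (hq.trans hR.le)]
  · intro q hq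
    simp [hF₂, huh.zero' q (hq.trans hR.le)]

end sobolevSol

end OutgoingWave
end

/-! ### A representative independent of the support radius -/

noncomputable section

namespace OutgoingWave

variable {𝕜 : Type*} [RCLike 𝕜]

section representative

/-- The complement of the largest interval starting at `0` on which `u₀` vanishes almost
everywhere. -/
def essRange (u₀ : ℝ → 𝕜) : Set ℝ := {r | ¬ ∀ᵐ s ∂(volume.restrict (Ioo 0 r)), u₀ s = 0}

lemma essRange_upward {u₀ : ℝ → 𝕜} {r r' : ℝ} (h : r ∈ essRange u₀) (hr : r ≤ r') :
    r' ∈ essRange u₀ := fun h' =>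
  h (ae_restrict_of_ae_restrict_of_subset (Ioo_subset_Ioo_right hr) h')

lemma measurableSet_essRange (u₀ : ℝ → 𝕜) : MeasurableSet (essRange u₀) :=
  OrdConnected.measurableSet ⟨fun _ hx _ _ _ hz => essRange_upward hx hz.1⟩

/-- The set `essRange u₀` is upward closed. A point outside it with a rational outside it to the
right is covered by countably many intervals on which `u₀` vanishes almost everywhere. -/
lemma ae_eq_zero_of_notMem_essRange (u₀ : ℝ → 𝕜) :
    ∀ᵐ r ∂(volume.restrict (Ioi (0 : ℝ))), r ∉ essRange u₀ → u₀ r = 0 := by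
  rw [ae_restrict_iff' measurableSet_Ioi]
  have h1 : ∀ᵐ r : ℝ, ∀ q : ℚ, (q : ℝ) ∉ essRange u₀ → r ∈ Ioo 0 (q : ℝ) → u₀ r = 0 := by
    refine ae_all_iff.2 fun q => ?_
    by_cases hq : (q : ℝ) ∈ essRange u₀
    · exact Eventually.of_forall fun r h => absurd hq h
    · have h2 := not_not.1 hq
      rw [ae_restrict_iff' measurableSet_Ioo] at h2
      filter_upwards [h2] with r hr _ using hr
  -- Two distinct points outside the set would have a rational between them, so at most one such
  -- point has every larger rational inside the set: its left endpoint.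
  have h2 : ∀ᵐ r : ℝ, ¬(r ∉ essRange u₀ ∧ ∀ q : ℚ, r < q → (q : ℝ) ∈ essRange u₀) := by
    rw [ae_iff]
    simp only [not_not]
    have key : ∀ r r' : ℝ, (r ∉ essRange u₀ ∧ ∀ q : ℚ, r < q → (q : ℝ) ∈ essRange u₀) →
        (r' ∉ essRange u₀ ∧ ∀ q : ℚ, r' < q → (q : ℝ) ∈ essRange u₀) → r' ≤ r := by
      intro r r' h h'
      by_contra hlt
      obtain ⟨q, hq1, hq2⟩ := exists_rat_btwn (not_le.1 hlt)
      exact h'.1 (essRange_upward (h.2 q hq1) hq2.le)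
    exact Set.Subsingleton.measure_zero
      (fun r hr r' hr' => le_antisymm (key _ _ hr' hr) (key _ _ hr hr')) _
  filter_upwards [h1, h2] with r hr1 hr2 hr0 hr
  push Not at hr2
  obtain ⟨q, hrq, hq⟩ := hr2 hr
  exact hr1 q hq ⟨hr0, hrq⟩

open Classical in
/-- A measurable representative of the profile of a radial function that vanishes near the origin
wherever the function does. -/
def rep (u₀ : ℝ → 𝕜) : ℝ → 𝕜 :=
  if h : AEStronglyMeasurable u₀ (volume.restrict (Ioi 0)) then
    (essRange u₀).indicator (h.mk u₀) else 0

lemma stronglyMeasurable_rep (u₀ : ℝ → 𝕜) : StronglyMeasurable (rep u₀) := by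
  unfold rep
  split_ifs with h
  · exact h.stronglyMeasurable_mk.indicator (measurableSet_essRange u₀)
  · exact stronglyMeasurable_zero

variable {N R : ℝ} {u₀ : ℝ → 𝕜} {u₁ : Distr 𝕜}

lemma IsData.rep_ae_eq (h : IsData N R u₀ u₁) :
    ∀ᵐ r ∂(volume.restrict (Ioi (0 : ℝ))), rep u₀ r = u₀ r := by
  have hm : AEStronglyMeasurable u₀ (volume.restrict (Ioi 0)) :=
    aestronglyMeasurable_rad_iff.1 h.memLp.1
  filter_upwards [ae_eq_zero_of_notMem_essRange u₀, hm.ae_eq_mk] with r h1 h2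
  rw [rep, dif_pos hm]
  by_cases hr : r ∈ essRange u₀
  · rw [indicator_of_mem hr, h2]
  · rw [indicator_of_notMem hr, h1 hr]

/-- The construction of `rep` does not mention `R`. If `u₀` vanishes almost everywhere on `(0, R)`,
then `R` lies outside the upward closed set `essRange u₀`, and hence so does every smaller number;
the vanishing holds pointwise. -/
lemma IsData.rep_eq_zero (h : IsData N R u₀ u₁) {r : ℝ} (hr : r ≤ R) : rep u₀ r = 0 := by
  have hs := ae_norm_iff (P := fun r => r < R → u₀ r = 0) |>.1 h.support
  have hR : R ∉ essRange u₀ := by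
    refine not_not.2 ?_
    rw [ae_restrict_iff' measurableSet_Ioo]
    rw [ae_restrict_iff' measurableSet_Ioi] at hs
    filter_upwards [hs] with s h1 h2 using h1 h2.1 h2.2
  unfold rep
  split_ifs
  · exact indicator_of_notMem (fun h' => hR (essRange_upward h' hr)) _
  · rfl

lemma IsData.rad_rep_ae_eq (h : IsData N R u₀ u₁) : rad (rep u₀) =ᵐ[(volume : Measure E3)] rad u₀ :=
  ae_norm_iff.2 h.rep_ae_eq

lemma IsData.hasRadialDeriv_rep (h : IsData N R u₀ u₁) : HasRadialDeriv (rep u₀) (-u₁) := by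
  obtain ⟨h1, h2⟩ := h.outgoing.snd_eq_zero
  refine ⟨fun r hr => (h1 r hr).congr_ae ?_, fun φ => ?_⟩
  · rw [uIoc_of_le hr.le]
    filter_upwards [ae_restrict_of_ae_restrict_of_subset
      (show Ioc 0 r ⊆ Ioi 0 from Ioc_subset_Ioi_self) h.rep_ae_eq] with ρ hρ
    rw [hρ]
  · rw [h2 φ]
    congr 1
    refine integral_congr_ae ?_
    filter_upwards [h.rad_rep_ae_eq] with x hx
    rw [hx]

/-- The initial profile enters the equation only through its pairing with test functions, which
ignores null sets. -/
lemma IsData.isSolutionOn (h : IsData N R u₀ u₁) {T : ℝ} {u : ℝ → ℝ → 𝕜}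
    (hu : IsSolutionOn N T (rep u₀) u₁ u) : IsSolutionOn N T u₀ u₁ u := by
  have e : radFunctional (rep u₀) = radFunctional u₀ := by
    funext φ
    refine integral_congr_ae ?_
    filter_upwards [h.rad_rep_ae_eq] with x hx
    rw [hx]
  refine ⟨hu.1, hu.2, hu.3, hu.4, hu.5, ?_⟩
  rw [← e]
  exact hu.6

lemma IsData.hdotOneLE_rep (h : IsData N R u₀ u₁) {K : ℝ} (hK : HdotOneLE (rad u₀) K) :
    HdotOneLE (rad (rep u₀)) K := by
  obtain ⟨h6, g, hg2, hg, hgK⟩ := hK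
  refine ⟨h6.ae_eq h.rad_rep_ae_eq.symm, g, hg2, fun i φ => ?_, hgK⟩
  rw [← hg i φ]
  refine integral_congr_ae ?_
  filter_upwards [h.rad_rep_ae_eq] with x hx
  rw [hx]

lemma ae_of_ae_Ioi {P : ℝ → Prop} (h : ∀ᵐ r ∂(volume.restrict (Ioi (0 : ℝ))), P r)
    (h0 : ∀ r ≤ 0, P r) : ∀ᵐ r, P r := by
  rw [ae_restrict_iff' measurableSet_Ioi] at h
  filter_upwards [h] with r hr
  rcases le_or_gt r 0 with h1 | h1
  · exact h0 r h1
  · exact hr h1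

lemma IsData.norm_rep_le (h : IsData N R u₀ u₁) (hR : 0 < R) (hu : LpNorm ⊤ u₀ < ⊤) :
    ∀ᵐ r, ‖rep u₀ r‖ ≤ (LpNorm ⊤ u₀).toReal := by
  refine ae_of_ae_Ioi ?_ fun r hr => by
    rw [h.rep_eq_zero (hr.trans hR.le), norm_zero]
    exact ENNReal.toReal_nonneg
  have h1 : ∀ᵐ x : E3, ‖rad u₀ x‖ ≤ (LpNorm ⊤ u₀).toReal := by
    filter_upwards [ae_le_eLpNormEssSup (f := rad u₀) (μ := (volume : Measure E3))] with x hx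
    unfold LpNorm at hu ⊢
    rw [eLpNorm_exponent_top] at hu ⊢
    rw [← toReal_enorm]
    exact ENNReal.toReal_mono hu.ne hx
  filter_upwards [ae_norm_iff (P := fun r => ‖u₀ r‖ ≤ (LpNorm ⊤ u₀).toReal) |>.1 h1,
    h.rep_ae_eq] with r h2 h3
  rwa [h3]

lemma IsData.norm_mulId_rep_le (h : IsData N R u₀ u₁) (hR : 0 < R) {K : ℝ}
    (hu : DecayLE (rad u₀) K) : ∀ᵐ r, ‖mulId (rep u₀) r‖ ≤ max K 0 := by
  refine ae_of_ae_Ioi ?_ fun r hr => by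
    rw [mulId, h.rep_eq_zero (hr.trans hR.le), smul_zero, norm_zero]
    exact le_max_right _ _
  filter_upwards [ae_norm_iff (P := fun r => √(1 + r ^ 2) * ‖u₀ r‖ ≤ K) |>.1 hu.2,
    h.rep_ae_eq] with r h2 h3
  rw [mulId, norm_smul, h3]
  refine le_trans ?_ (h2.trans (le_max_left _ _))
  gcongr
  rw [Real.norm_eq_abs, ← Real.sqrt_sq_eq_abs]
  exact Real.sqrt_le_sqrt (by linarith)

lemma IsData.integrableOn_rep (h : IsData N R u₀ u₁) (hR : 0 < R) (M : ℝ) :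
    IntegrableOn (rep u₀) (Ioc 0 M) := by
  have hi : ∀ M, IntegrableOn (mulId (rep u₀)) (Ioc 0 M) := fun M => by
    rcases le_or_gt M 0 with hM | hM
    · simp [Ioc_eq_empty (not_lt.2 hM)]
    · exact (intervalIntegrable_iff_integrableOn_Ioc_of_le hM.le).1
        (h.hasRadialDeriv_rep.1 M hM)
  refine (integrableOn_smul_of_zero hR (continuousOn_inv₀.mono fun r (hr : r ∈ Ioi (0 : ℝ)) =>
    ne_of_gt hr) (fun r hr => by rw [mulId, h.rep_eq_zero hr, smul_zero]) hi M).congr_fun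
    (fun r hr => ?_) measurableSet_Ioc
  exact inv_smul_smul₀ hr.1.ne' _

end representative

/-! ### Estimates in terms of the original data -/

section norms

variable {N R T : ℝ} {u₀ v₀ : ℝ → 𝕜} {u₁ v₁ : Distr 𝕜}

lemma one_le_sphConst (hN : 2 < N) : 1 ≤ sphConst N := by
  refine ENNReal.one_le_rpow ?_ (inv_pos.2 (by linarith))
  rw [← ENNReal.ofReal_one]
  exact ENNReal.ofReal_le_ofReal (by linarith [Real.pi_gt_three])

lemma IsData.LpNorm_lt_top (h : IsData N R u₀ u₁) : LpNorm (ENNReal.ofReal (N + 2)) u₀ < ⊤ :=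
  h.memLp.2

lemma IsData.LpNorm_eq (h : IsData N R u₀ u₁) (hN : 2 < N) (hR : 0 < R) :
    LpNorm (ENNReal.ofReal (N + 2)) u₀ =
      sphConst N * eLpNorm (mulId (rep u₀)) (ENNReal.ofReal (N + 2)) (nuMeas N R 0) := by
  rw [← LpNorm_congr h.rep_ae_eq,
    LpNorm_mulId hN hR (stronglyMeasurable_rep u₀) fun q hq => h.rep_eq_zero hq]

lemma mulId_sub (f g : ℝ → 𝕜) : mulId (f - g) = mulId f - mulId g := by
  funext q
  simp only [mulId, Pi.sub_apply, smul_sub]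

lemma IsData.LpNorm_sub_eq (hu : IsData N R u₀ u₁) (hv : IsData N R v₀ v₁) (hN : 2 < N)
    (hR : 0 < R) : LpNorm (ENNReal.ofReal (N + 2)) (v₀ - u₀) = sphConst N *
      eLpNorm (mulId (rep v₀) - mulId (rep u₀)) (ENNReal.ofReal (N + 2)) (nuMeas N R 0) := by
  have h1 : ∀ᵐ r ∂(volume.restrict (Ioi (0 : ℝ))), (rep v₀ - rep u₀) r = (v₀ - u₀) r := by
    filter_upwards [hu.rep_ae_eq, hv.rep_ae_eq] with r h1 h2
    rw [Pi.sub_apply, Pi.sub_apply, h1, h2]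
  rw [← LpNorm_congr h1, LpNorm_mulId hN hR
    ((stronglyMeasurable_rep v₀).sub (stronglyMeasurable_rep u₀))
    fun q hq => by rw [Pi.sub_apply, hu.rep_eq_zero hq, hv.rep_eq_zero hq, sub_zero], mulId_sub]

lemma IsData.eLpNorm_mulId_le (h : IsData N R u₀ u₁) (hN : 2 < N) (hR : 0 < R) :
    eLpNorm (mulId (rep u₀)) (ENNReal.ofReal (N + 2)) (nuMeas N R 0)
      ≤ LpNorm (ENNReal.ofReal (N + 2)) u₀ := by
  rw [h.LpNorm_eq hN hR]
  exact le_mul_of_one_le_left zero_le (one_le_sphConst hN)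

lemma IsData.adm (h : IsData N R u₀ u₁) {A : ℝ}
    (hA : eLpNorm (mulId (rep u₀)) (ENNReal.ofReal (N + 2)) (nuMeas N R 0) ≤ ENNReal.ofReal A) :
    Adm N R A (mulId (rep u₀)) :=
  ⟨stronglyMeasurable_id.smul (stronglyMeasurable_rep u₀),
    fun q hq => by rw [mulId, h.rep_eq_zero hq, smul_zero], hA⟩

lemma IsData.adm_of_le (h : IsData N R u₀ u₁) (hN : 2 < N) (hR : 0 < R) {A : ℝ}
    (hA : LpNorm (ENNReal.ofReal (N + 2)) u₀ ≤ ENNReal.ofReal A) :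
    Adm N R A (mulId (rep u₀)) :=
  h.adm ((h.eLpNorm_mulId_le hN hR).trans hA)

lemma LpNorm_sol_rep_le (hu : IsData N R u₀ u₁) (hN : 2 < N) (hR : 0 < R) {A : ℝ}
    (hA : LpNorm (ENNReal.ofReal (N + 2)) u₀ ≤ ENNReal.ofReal A) (hA0 : 0 ≤ A)
    (hsm : A ^ N * theta N R T ≤ kap N) {t : ℝ} (ht : t ∈ Icc 0 T) :
    LpNorm (ENNReal.ofReal (N + 2)) (sol N (rep u₀) t)
      ≤ ENNReal.ofReal 2 * LpNorm (ENNReal.ofReal (N + 2)) u₀ := by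
  set a := eLpNorm (mulId (rep u₀)) (ENNReal.ofReal (N + 2)) (nuMeas N R 0) with ha
  have haA : a ≤ ENNReal.ofReal A := (hu.eLpNorm_mulId_le hN hR).trans hA
  have hat : a ≠ ⊤ := ne_top_of_le_ne_top ENNReal.ofReal_ne_top haA
  -- The level `A` is lowered to the exact weighted norm of `v`, for which smallness still holds.
  -- The free part and the correction each contribute at most this norm, hence the factor `2`
  -- relative to `u₀` itself.
  have hadm : Adm N R a.toReal (mulId (rep u₀)) := hu.adm (ENNReal.ofReal_toReal hat).ge
  have haA' : a.toReal ≤ A := ENNReal.toReal_le_of_le_ofReal hA0 haA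
  have ha0 : 0 ≤ a.toReal := ENNReal.toReal_nonneg
  have hsm' : a.toReal ^ N * theta N R T ≤ kap N := by
    refine le_trans ?_ hsm
    have := theta_nonneg N R T
    gcongr
  have hD := corr_picLim hN hR ha0 hsm' hadm
  have hm : StronglyMeasurable fun q => mulId (rep u₀) q + picLim N (mulId (rep u₀)) q t :=
    hadm.meas.add (hD.meas_slice t)
  unfold sol
  rw [LpNorm_prof hN hR ht.1 hm
    fun q hq => by rw [hadm.zero q hq, hD.zero q hq, add_zero], hu.LpNorm_eq hN hR, mul_left_comm]
  gcongr
  refine (eLpNorm_add_corr_le hN hR ha0 hadm hD ht).trans ?_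
  rw [ENNReal.ofReal_mul (by norm_num), ENNReal.ofReal_toReal hat]

/-- The free parts and the corrections each differ by at most the norm of the data difference, which
gives the constant `2`. -/
lemma LpNorm_sol_rep_sub_le (hu : IsData N R u₀ u₁) (hv : IsData N R v₀ v₁) (hN : 2 < N)
    (hR : 0 < R) {A : ℝ} (hA0 : 0 ≤ A)
    (hA : LpNorm (ENNReal.ofReal (N + 2)) u₀ ≤ ENNReal.ofReal A)
    (hA' : LpNorm (ENNReal.ofReal (N + 2)) v₀ ≤ ENNReal.ofReal A)
    (hsm : A ^ N * theta N R T ≤ kap N) {t : ℝ} (ht : t ∈ Icc 0 T) :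
    LpNorm (ENNReal.ofReal (N + 2)) (sol N (rep v₀) t - sol N (rep u₀) t)
      ≤ ENNReal.ofReal 2 * LpNorm (ENNReal.ofReal (N + 2)) (v₀ - u₀) := by
  have hau := hu.adm_of_le hN hR hA
  have hav := hv.adm_of_le hN hR hA'
  have hDu := corr_picLim hN hR hA0 hsm hau
  have hDv := corr_picLim hN hR hA0 hsm hav
  set b := eLpNorm (mulId (rep v₀) - mulId (rep u₀)) (ENNReal.ofReal (N + 2)) (nuMeas N R 0) with hb
  have hbt : b ≠ ⊤ := by
    refine ne_top_of_le_ne_top ?_ (eLpNorm_sub_le hav.meas.aestronglyMeasurable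
      hau.meas.aestronglyMeasurable (one_le_ofReal hN))
    exact ENNReal.add_ne_top.2 ⟨ne_top_of_le_ne_top ENNReal.ofReal_ne_top hav.norm,
      ne_top_of_le_ne_top ENNReal.ofReal_ne_top hau.norm⟩
  have hb0 : 0 ≤ b.toReal := ENNReal.toReal_nonneg
  have hbe : b ≤ ENNReal.ofReal b.toReal := (ENNReal.ofReal_toReal hbt).ge
  have e : sol N (rep v₀) t - sol N (rep u₀) t =
      prof t ((fun q => mulId (rep v₀) q + picLim N (mulId (rep v₀)) q t) -
        fun q => mulId (rep u₀) q + picLim N (mulId (rep u₀)) q t) := by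
    funext r
    simp only [sol, prof, Pi.sub_apply]
    split_ifs
    · rw [smul_sub]
    · rw [sub_zero]
  have hmu : StronglyMeasurable fun q => mulId (rep u₀) q + picLim N (mulId (rep u₀)) q t :=
    hau.meas.add (hDu.meas_slice t)
  have hmv : StronglyMeasurable fun q => mulId (rep v₀) q + picLim N (mulId (rep v₀)) q t :=
    hav.meas.add (hDv.meas_slice t)
  rw [e, LpNorm_prof hN hR ht.1 (hmv.sub hmu) fun q hq => by
      simp only [Pi.sub_apply, hau.zero q hq, hav.zero q hq, hDu.zero q hq, hDv.zero q hq,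
        add_zero, sub_zero],
    hu.LpNorm_sub_eq hv hN hR, mul_left_comm]
  gcongr
  refine (eLpNorm_corr_sub_le hN hR hav.meas hau.meas hDv.meas hDu.meas hb0 hb0 hbe ht.1
    fun q => norm_picLim_sub_le hN hR hA0 hsm hav hau hb0 hbe q ht).trans ?_
  rw [← two_mul, ENNReal.ofReal_mul (by norm_num), ENNReal.ofReal_toReal hbt]

/-- The properties of the solution on an interval on which the data are small. -/
lemma isSolutionOn_sol_rep (hu : IsData N R u₀ u₁) (hN : 2 < N) (hR : 0 < R) {A : ℝ} (hA0 : 0 ≤ A)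
    (hA : LpNorm (ENNReal.ofReal (N + 2)) u₀ ≤ ENNReal.ofReal A)
    (hsm : A ^ N * theta N R T ≤ kap N) : IsSolutionOn N T u₀ u₁ (sol N (rep u₀)) :=
  hu.isSolutionOn (isSolutionOn_sol hN hR hA0 hsm (hu.adm_of_le hN hR hA) hu.hasRadialDeriv_rep)

lemma exists_hdotOneLE_sol_rep (hu : IsData N R u₀ u₁) (hN : 2 < N) (hR : 0 < R) {A : ℝ}
    (hA0 : 0 ≤ A) (hA : LpNorm (ENNReal.ofReal (N + 2)) u₀ ≤ ENNReal.ofReal A)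
    (hsm : A ^ N * theta N R T ≤ kap N) (hH : ∃ K, HdotOneLE (rad u₀) K)
    (hb : LpNorm ⊤ u₀ < ⊤) :
    ∃ K : ℝ, ∀ t ∈ Icc 0 T, HdotOneLE (rad (sol N (rep u₀) t)) K := by
  obtain ⟨K, hK⟩ := hH
  exact exists_hdotOneLE_sol hN hR hA0 ENNReal.toReal_nonneg (stronglyMeasurable_rep u₀)
    (fun _ hq => hu.rep_eq_zero hq) (hu.norm_rep_le hR hb) (hu.integrableOn_rep hR)
    (hu.hdotOneLE_rep hK) hsm (hu.adm_of_le hN hR hA)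

lemma LpNorm_top_sol_rep_le (hu : IsData N R u₀ u₁) (hN : 2 < N) (hR : 0 < R) {A : ℝ}
    (hA0 : 0 ≤ A) (hA : LpNorm (ENNReal.ofReal (N + 2)) u₀ ≤ ENNReal.ofReal A)
    (hsm : A ^ N * theta N R T ≤ kap N) (hb : LpNorm ⊤ u₀ < ⊤) {t : ℝ} (ht : t ∈ Icc 0 T) :
    LpNorm ⊤ (sol N (rep u₀) t)
      ≤ ENNReal.ofReal ((LpNorm ⊤ u₀).toReal + A * (gr N R 0 / R)) :=
  LpNorm_top_sol_le hN hR hA0 ENNReal.toReal_nonneg (fun _ hq => hu.rep_eq_zero hq)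
    (hu.norm_rep_le hR hb) (corr_picLim hN hR hA0 hsm (hu.adm_of_le hN hR hA)) ht

lemma exists_decayLE_sol_rep (hu : IsData N R u₀ u₁) (hN : 2 < N) (hR : 0 < R) {A : ℝ}
    (hA0 : 0 ≤ A) (hA : LpNorm (ENNReal.ofReal (N + 2)) u₀ ≤ ENNReal.ofReal A)
    (hsm : A ^ N * theta N R T ≤ kap N) (hd : ∃ K, DecayLE (rad u₀) K) :
    ∃ K : ℝ, ∀ t ∈ Icc 0 T, DecayLE (rad (sol N (rep u₀) t)) K := by
  obtain ⟨K, hK⟩ := hd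
  exact ⟨_, fun t ht => decayLE_sol hN hR hA0 (le_max_right K 0) (stronglyMeasurable_rep u₀)
    (fun _ hq => hu.rep_eq_zero hq) (hu.norm_mulId_rep_le hR hK)
    (corr_picLim hN hR hA0 hsm (hu.adm_of_le hN hR hA)) ht⟩

/-- Smallness is required at level `2a`, twice the norm of `u₀`, to cover all comparison data. This
costs the factor `2^N` in the constant. -/
lemma small_of_local (hN : 2 < N) (hR : 0 < R) (hT : 0 ≤ T) {a : ℝ} (ha : 0 ≤ a)
    (h : T * a ^ N ≤ kap N / 2 ^ N * R ^ ((2 * N - 2) / (N + 2))) :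
    (2 * a) ^ N * theta N R T ≤ kap N := by
  have hRp : 0 < R ^ ((2 * N - 2) / (N + 2)) := Real.rpow_pos_of_pos hR _
  have h2 : (0 : ℝ) < 2 ^ N := Real.rpow_pos_of_pos two_pos _
  calc (2 * a) ^ N * theta N R T
      ≤ (2 * a) ^ N * (T * R ^ (-((2 * N - 2) / (N + 2)))) := by
        gcongr
        exact theta_le_linear hN hR hT
    _ = 2 ^ N * (T * a ^ N) * (R ^ ((2 * N - 2) / (N + 2)))⁻¹ := by
        rw [Real.mul_rpow two_pos.le ha, Real.rpow_neg hR.le]; ring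
    _ ≤ 2 ^ N * (kap N / 2 ^ N * R ^ ((2 * N - 2) / (N + 2)))
          * (R ^ ((2 * N - 2) / (N + 2)))⁻¹ := by gcongr
    _ = kap N := by field_simp

/-- The bound on `theta` for `N > 4` is uniform in `T`, so one condition on the data serves all
times. -/
lemma small_of_global (hN : 4 < N) (hR : 0 < R) {a : ℝ} (ha : 0 ≤ a)
    (h : R ^ ((4 - N) / (N + 2)) * a ^ N ≤ kap N * (N - 4) / (2 ^ N * (N + 2))) :
    (2 * a) ^ N * theta N R T ≤ kap N := by
  have h2 : (0 : ℝ) < 2 ^ N := Real.rpow_pos_of_pos two_pos _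
  have h4 : 0 < N - 4 := by linarith
  have h5 : 0 < N + 2 := by linarith
  calc (2 * a) ^ N * theta N R T
      ≤ (2 * a) ^ N * ((N + 2) / (N - 4) * R ^ ((4 - N) / (N + 2))) := by
        gcongr
        exact theta_le_global hN hR
    _ = 2 ^ N * ((N + 2) / (N - 4)) * (R ^ ((4 - N) / (N + 2)) * a ^ N) := by
        rw [Real.mul_rpow two_pos.le ha]; ring
    _ ≤ 2 ^ N * ((N + 2) / (N - 4)) * (kap N * (N - 4) / (2 ^ N * (N + 2))) := by gcongr
    _ = kap N := by field_simp

end norms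

end OutgoingWave
end

/-! ### The proposition -/

theorem proposition5p3 {𝕜 : Type*} [RCLike 𝕜] (N : ℝ) (hN : 2 < N) :
    -- constants depending only on `N`, and the map `S` sending data to the corresponding solution
    ∃ c C ε : ℝ, 0 < c ∧ 0 < C ∧ 0 < ε ∧
    ∃ S : (ℝ → 𝕜) → OutgoingWave.Distr 𝕜 → ℝ → ℝ → 𝕜,
    ∀ (R : ℝ), 0 < R → ∀ (u₀ : ℝ → 𝕜) (u₁ : OutgoingWave.Distr 𝕜),
    OutgoingWave.IsData N R u₀ u₁ →
    -- local existence on `I = [0, T]`, for `T` up to `c R^{(2N-2)/(N+2)} ‖u₀‖^{-N}`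
    (∀ T : ℝ, 0 ≤ T →
      T * (OutgoingWave.LpNorm (ENNReal.ofReal (N + 2)) u₀).toReal ^ N
        ≤ c * R ^ ((2 * N - 2) / (N + 2)) →
      OutgoingWave.IsSolutionOn N T u₀ u₁ (S u₀ u₁) ∧
      (∀ t ∈ Set.Icc 0 T, OutgoingWave.LpNorm (ENNReal.ofReal (N + 2)) (S u₀ u₁ t)
        ≤ ENNReal.ofReal C * OutgoingWave.LpNorm (ENNReal.ofReal (N + 2)) u₀) ∧
      -- continuous dependence on the data
      (∀ (v₀ : ℝ → 𝕜) (v₁ : OutgoingWave.Distr 𝕜), OutgoingWave.IsData N R v₀ v₁ →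
        OutgoingWave.LpNorm (ENNReal.ofReal (N + 2)) v₀
          ≤ 2 * OutgoingWave.LpNorm (ENNReal.ofReal (N + 2)) u₀ →
        OutgoingWave.IsSolutionOn N T v₀ v₁ (S v₀ v₁) ∧
        ∀ t ∈ Set.Icc 0 T,
          OutgoingWave.LpNorm (ENNReal.ofReal (N + 2)) (S v₀ v₁ t - S u₀ u₁ t)
            ≤ ENNReal.ofReal C * OutgoingWave.LpNorm (ENNReal.ofReal (N + 2)) (v₀ - u₀)) ∧
      -- persistence of regularity
      ((∃ K, OutgoingWave.HdotOneLE (OutgoingWave.rad u₀) K) →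
        OutgoingWave.LpNorm ⊤ u₀ < ⊤ →
        ∃ K : ℝ, ∀ t ∈ Set.Icc 0 T,
          OutgoingWave.HdotOneLE (OutgoingWave.rad (S u₀ u₁ t)) K ∧
          OutgoingWave.LpNorm ⊤ (S u₀ u₁ t) ≤ ENNReal.ofReal K) ∧
      -- persistence of decay
      ((∃ K, OutgoingWave.DecayLE (OutgoingWave.rad u₀) K) →
        ∃ K : ℝ, ∀ t ∈ Set.Icc 0 T,
          OutgoingWave.DecayLE (OutgoingWave.rad (S u₀ u₁ t)) K)) ∧
    -- global existence for small data
    (4 < N →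
      R ^ ((4 - N) / (N + 2)) * (OutgoingWave.LpNorm (ENNReal.ofReal (N + 2)) u₀).toReal ^ N ≤ ε →
      (∀ T : ℝ, 0 ≤ T → OutgoingWave.IsSolutionOn N T u₀ u₁ (S u₀ u₁)) ∧
      (∀ t : ℝ, 0 ≤ t → OutgoingWave.LpNorm (ENNReal.ofReal (N + 2)) (S u₀ u₁ t)
        ≤ ENNReal.ofReal C * OutgoingWave.LpNorm (ENNReal.ofReal (N + 2)) u₀) ∧
      -- continuous dependence on the data
      (∀ (v₀ : ℝ → 𝕜) (v₁ : OutgoingWave.Distr 𝕜), OutgoingWave.IsData N R v₀ v₁ →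
        OutgoingWave.LpNorm (ENNReal.ofReal (N + 2)) v₀
          ≤ 2 * OutgoingWave.LpNorm (ENNReal.ofReal (N + 2)) u₀ →
        (∀ T : ℝ, 0 ≤ T → OutgoingWave.IsSolutionOn N T v₀ v₁ (S v₀ v₁)) ∧
        ∀ t : ℝ, 0 ≤ t →
          OutgoingWave.LpNorm (ENNReal.ofReal (N + 2)) (S v₀ v₁ t - S u₀ u₁ t)
            ≤ ENNReal.ofReal C * OutgoingWave.LpNorm (ENNReal.ofReal (N + 2)) (v₀ - u₀)) ∧
      -- boundedness
      (OutgoingWave.LpNorm ⊤ u₀ < ⊤ →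
        ∃ K : ℝ, ∀ t : ℝ, 0 ≤ t → OutgoingWave.LpNorm ⊤ (S u₀ u₁ t) ≤ ENNReal.ofReal K) ∧
      -- persistence of regularity for all times
      ((∃ K, OutgoingWave.HdotOneLE (OutgoingWave.rad u₀) K) →
        OutgoingWave.LpNorm ⊤ u₀ < ⊤ →
        ∀ T : ℝ, 0 ≤ T → ∃ K : ℝ, ∀ t ∈ Set.Icc 0 T,
          OutgoingWave.HdotOneLE (OutgoingWave.rad (S u₀ u₁ t)) K) ∧
      -- persistence of decay for all times
      ((∃ K, OutgoingWave.DecayLE (OutgoingWave.rad u₀) K) →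
        ∀ T : ℝ, 0 ≤ T → ∃ K : ℝ, ∀ t ∈ Set.Icc 0 T,
          OutgoingWave.DecayLE (OutgoingWave.rad (S u₀ u₁ t)) K)) := by
  have hkap : 0 < OutgoingWave.kap N := OutgoingWave.kap_pos hN
  have h2N : (0 : ℝ) < 2 ^ N := Real.rpow_pos_of_pos two_pos _
  refine ⟨OutgoingWave.kap N / 2 ^ N, 2,
    if 4 < N then OutgoingWave.kap N * (N - 4) / (2 ^ N * (N + 2)) else 1, by positivity,
    two_pos, ?_, fun u₀ _ => OutgoingWave.sol N (OutgoingWave.rep u₀), ?_⟩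
  · split_ifs with h
    · have : 0 < N - 4 := by linarith
      positivity
    · exact one_pos
  intro R hR u₀ u₁ hu
  set a := (OutgoingWave.LpNorm (ENNReal.ofReal (N + 2)) u₀).toReal with ha
  have ha0 : 0 ≤ a := ENNReal.toReal_nonneg
  -- The common level `2a` admits both `u₀` and every `v₀` of at most twice its norm, so both
  -- solutions come from the same contraction.
  have hA0 : 0 ≤ 2 * a := by positivity
  have hae : ENNReal.ofReal (2 * a) = 2 * OutgoingWave.LpNorm (ENNReal.ofReal (N + 2)) u₀ := by
    rw [ENNReal.ofReal_mul two_pos.le, ha, ENNReal.ofReal_toReal hu.LpNorm_lt_top.ne,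
      ENNReal.ofReal_ofNat]
  have hA : OutgoingWave.LpNorm (ENNReal.ofReal (N + 2)) u₀ ≤ ENNReal.ofReal (2 * a) := by
    rw [hae]
    exact le_mul_of_one_le_left zero_le one_le_two
  refine ⟨fun T hT hsmall => ?_, fun hN4 hsmall => ?_⟩
  · have hsm := OutgoingWave.small_of_local hN hR hT ha0 hsmall
    refine ⟨OutgoingWave.isSolutionOn_sol_rep hu hN hR hA0 hA hsm,
      fun t ht => OutgoingWave.LpNorm_sol_rep_le hu hN hR hA hA0 hsm ht,
      fun v₀ v₁ hv hle => ?_, fun hH hb => ?_,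
      OutgoingWave.exists_decayLE_sol_rep hu hN hR hA0 hA hsm⟩
    · rw [← hae] at hle
      exact ⟨OutgoingWave.isSolutionOn_sol_rep hv hN hR hA0 hle hsm,
        fun t ht => OutgoingWave.LpNorm_sol_rep_sub_le hu hv hN hR hA0 hA hle hsm ht⟩
    · obtain ⟨K, hK⟩ := OutgoingWave.exists_hdotOneLE_sol_rep hu hN hR hA0 hA hsm hH hb
      refine ⟨max K _, fun t ht => ⟨?_, (OutgoingWave.LpNorm_top_sol_rep_le hu hN hR hA0 hA hsm
        hb ht).trans (ENNReal.ofReal_le_ofReal (le_max_right _ _))⟩⟩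
      obtain ⟨h6, g, hg2, hg, hgK⟩ := hK t ht
      exact ⟨h6, g, hg2, hg, hgK.trans (le_max_left _ _)⟩
  · rw [if_pos hN4] at hsmall
    have hsm : ∀ T, (2 * a) ^ N * OutgoingWave.theta N R T ≤ OutgoingWave.kap N :=
      fun T => OutgoingWave.small_of_global hN4 hR ha0 hsmall
    refine ⟨fun T _ => OutgoingWave.isSolutionOn_sol_rep hu hN hR hA0 hA (hsm T),
      fun t ht => OutgoingWave.LpNorm_sol_rep_le hu hN hR hA hA0 (hsm t) ⟨ht, le_rfl⟩,
      fun v₀ v₁ hv hle => ?_,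
      fun hb => ⟨_, fun t ht => OutgoingWave.LpNorm_top_sol_rep_le hu hN hR hA0 hA (hsm t) hb
        ⟨ht, le_rfl⟩⟩,
      fun hH hb T _ => OutgoingWave.exists_hdotOneLE_sol_rep hu hN hR hA0 hA (hsm T) hH hb,
      fun hd T _ => OutgoingWave.exists_decayLE_sol_rep hu hN hR hA0 hA (hsm T) hd⟩
    rw [← hae] at hle
    exact ⟨fun T _ => OutgoingWave.isSolutionOn_sol_rep hv hN hR hA0 hle (hsm T),
      fun t ht => OutgoingWave.LpNorm_sol_rep_sub_le hu hv hN hR hA0 hA hle (hsm t)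
        ⟨ht, le_rfl⟩⟩
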